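/- Let $\alpha>1$, let $\Pi^+=\{z=x+iy\in\mathbb C: y>0\}$, and let $\psi_\alpha$ be the Cauchy wavelet, $\psi_\alpha(t)=\int_0^\infty \xi^{(\alpha-1)/2}e^{-\xi}e^{it\xi}\,d\xi$. For $s\in L^2(\mathbb R)$ and $z=x+iy\in\Pi^+$ let $$W_{\psi_\alpha}s(z)=\langle s,\mathbf T_x\mathbf D_y\psi_\alpha\rangle=\frac1{\sqrt y}\int_{\mathbb R}s(t)\,\overline{\psi_\alpha\Big(\frac{t-x}{y}\Big)}\,dt .$$ Let $H^2(\mathbb R)$ be the space of all $s\in L^2(\mathbb R)$ whose Fourier transform vanishes almost everywhere on $(-\infty,0)$, and let $A^2_\alpha$ be the Hilbert space of analytic functions $f$ on $\Pi^+$ with $\|f\|^2=\frac1\pi\int_{\Pi^+}|f(x+iy)|^2y^{\alpha-2}\,dx\,dy<\infty$. A standard complex Gaussian has independent real and imaginary parts, each centered with variance $1/2$. A hyperbolic Gaussian analytic function (GAF) is a random series $\sum_n a_nb_n$ with $(b_n)_{n\ge0}$ an orthonormal basis of $A^2_\alpha$ and $(a_n)_{n\ge 0}$ independent standard complex Gaussians;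 complex white noise is the formal series $\mathcal N=\sum_n a_ne_n$ with $(e_n)_{n\ge0}$ an orthonormal basis of $L^2(\mathbb R)$ and such $(a_n)$, acting on $s\in L^2(\mathbb R)$ by the $L^2(\Omega)$-convergent series $\langle\mathcal N,s\rangle=\sum_n a_n\langle e_n,s\rangle$. There is a constant $c_\alpha>0$, depending only on $\alpha$, such that the following hold. (1) If $(h_n)_{n\ge0}$ is an orthonormal basis of $H^2(\mathbb R)$, then the functions $z\mapsto c_\alpha y^{-\alpha/2}W_{\psi_\alpha}h_n(z)$ form an orthonormal basis of $A^2_\alpha$. (2) Let $\mathcal N=\sum_n a_ne_n$ be complex white noise. Almost surely the series $W_{\psi_\alpha}(\mathcal N)(z)=\sum_n a_nW_{\psi_\alpha}e_n(z)$ converges locally uniformly on $\Pi^+$, and for each $z\in\Pi^+$ it also converges in $L^2(\Omega)$, to the same limit, so that $W_{\psi_\alpha}(\mathcal N)(z)=\langle\mathcal N,\mathbf T_x\mathbf D_y\psi_\alpha\rangle$. Almost surely the series $f_\alpha(z)=\sum_n a_n\,c_\alpha y^{-\alpha/2}W_{\psi_\alpha}e_n(z)$ converges locally uniformly on $\Pi^+$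 to an analytic function, and $$W_{\psi_\alpha}(\mathcal N)(z)=\frac{y^{\alpha/2}}{c_\alpha}f_\alpha(z)\qquad\text{for all }z\in\Pi^+ .$$ (3) $f_\alpha$ is a hyperbolic GAF: for every orthonormal basis $(h_n)$ of $H^2(\mathbb R)$, with $b_n=c_\alpha y^{-\alpha/2}W_{\psi_\alpha}h_n$ the orthonormal basis of $A^2_\alpha$ in (1), the random variables $\zeta_n=\langle\mathcal N,h_n\rangle$ (for suitable choices of their representatives) are independent standard complex Gaussians, and almost surely $\sum_n\zeta_nb_n$ converges locally uniformly on $\Pi^+$ and $W_{\psi_\alpha}(\mathcal N)(z)=\frac{y^{\alpha/2}}{c_\alpha}\sum_n\zeta_nb_n(z)$ for all $z\in\Pi^+$. (4) Every hyperbolic GAF $\sum_n a'_nb'_n$, on any probability space and for any orthonormal basis $(b'_n)$ of $A^2_\alpha$, converges almost surely locally uniformly on $\Pi^+$ to an analytic function, and its zero set in $\Pi^+$, as a point process (a Dirac mass at each zero), has the same law as the zero set of $W_{\psi_\alpha}(\mathcal N)$ in $\Pi^+$. -/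

import Mathlib

open MeasureTheory ProbabilityTheory Filter Topology
open scoped ComplexConjugate FourierTransform NNReal ENNReal

noncomputable section

/-- The Hilbert space `L²(ℝ)` of complex-valued signals. -/
abbrev L2R : Type := Lp ℂ 2 (volume : Measure ℝ)

/-- The open upper half-plane `{x + iy : y > 0}` as a subset of `ℂ`. -/
def upperHalf : Set ℂ := {z | 0 < z.im}

/-! ### The wavelet transform -/

/-- The Fourier transform of the Cauchy wavelet: `ξ ^ ((α - 1) / 2) * exp (-ξ)` for `ξ ≥ 0`,
and `0` for `ξ < 0`. -/
def cauchyWaveletHat (α ξ : ℝ) : ℝ :=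
  if 0 ≤ ξ then ξ ^ ((α - 1) / 2) * Real.exp (-ξ) else 0

/-- The Cauchy wavelet `ψ_α`, recovered from its Fourier transform by
`ψ(t) = ∫ ψ̂(ξ) exp(i t ξ) dξ`; in closed form
`ψ_α(t) = Γ((α + 1) / 2) (1 - i t) ^ (-(α + 1) / 2)`. -/
def cauchyWavelet (α t : ℝ) : ℂ :=
  ∫ ξ : ℝ, (cauchyWaveletHat α ξ : ℂ) * Complex.exp (Complex.I * t * ξ)

/-- The pairing `⟨f, g⟩ = ∫ f(t) conj (g(t)) dt` (linear in the first argument). -/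
def pairing (f g : ℝ → ℂ) : ℂ := ∫ t : ℝ, f t * conj (g t)

/-- Translation `(T_x s)(t) = s(t - x)`. -/
def translateOp (x : ℝ) (s : ℝ → ℂ) : ℝ → ℂ := fun t => s (t - x)

/-- Dilation `(D_y s)(t) = y ^ (-1/2) s(t / y)`. -/
def dilateOp (y : ℝ) (s : ℝ → ℂ) : ℝ → ℂ := fun t => ((Real.sqrt y)⁻¹ : ℝ) * s (t / y)

/-- The continuous wavelet transform `W_ψ s (x, y) = ⟨s, T_x D_y ψ⟩` at `z = x + iy`. -/
def waveletTransform (ψ s : ℝ → ℂ) (z : ℂ) : ℂ :=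
  pairing s (translateOp z.re (dilateOp z.im ψ))

/-- `z = x + iy ↦ c y ^ (-α/2) W_{ψ_α} s (x, y)`. -/
def normalizedTransform (α c : ℝ) (s : ℝ → ℂ) (z : ℂ) : ℂ :=
  ((c * z.im ^ (-(α / 2)) : ℝ) : ℂ) * waveletTransform (cauchyWavelet α) s z

/-! ### Hardy space and weighted Bergman space -/

/-- The Hardy space of analytic signals: those `s ∈ L²(ℝ)` whose Fourier transform vanishes
almost everywhere on the negative half-line. -/
def hardySpace : Submodule ℂ L2R where
  carrier := {s | ∀ᵐ ξ ∂(volume.restrict (Set.Iio (0 : ℝ))), (𝓕 s : L2R) ξ = 0}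
  zero_mem' := by
    have h0 : (𝓕 (0 : L2R) : L2R) = 0 := FourierTransform.fourier_zero
    simp only [Set.mem_ofPred_eq, h0]
    filter_upwards [ae_restrict_of_ae (Lp.coeFn_zero ℂ 2 (volume : Measure ℝ))] with ξ h
    rw [h, Pi.zero_apply]
  add_mem' := by
    intro f g hf hg
    simp only [Set.mem_ofPred_eq] at hf hg ⊢
    rw [FourierTransform.fourier_add]
    filter_upwards [hf, hg, ae_restrict_of_ae (Lp.coeFn_add (𝓕 f : L2R) (𝓕 g : L2R))]
      with ξ h1 h2 h3
    rw [h3, Pi.add_apply, h1, h2, add_zero]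
  smul_mem' := by
    intro r f hf
    simp only [Set.mem_ofPred_eq] at hf ⊢
    rw [FourierTransform.fourier_smul]
    filter_upwards [hf, ae_restrict_of_ae (Lp.coeFn_smul r (𝓕 f : L2R))] with ξ h1 h2
    rw [h2, Pi.smul_apply, h1, smul_zero]

/-- The measure `π⁻¹ y ^ (α - 2) dx dy` on the upper half-plane. -/
def bergmanMeasure (α : ℝ) : Measure ℂ :=
  (volume.restrict upperHalf).withDensity (fun z => ENNReal.ofReal (z.im ^ (α - 2) / Real.pi))

/-- The weighted Bergman space `A²_α`, with the Hilbert space structure of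
`L²(π⁻¹ y ^ (α - 2) dx dy)`: the classes that contain a function analytic on the upper
half-plane. -/
def bergmanSpace (α : ℝ) : Submodule ℂ (Lp ℂ 2 (bergmanMeasure α)) where
  carrier := {f | ∃ g : ℂ → ℂ, DifferentiableOn ℂ g upperHalf ∧ f =ᵐ[bergmanMeasure α] g}
  zero_mem' := ⟨0, differentiableOn_const 0, Lp.coeFn_zero _ _ _⟩
  add_mem' := by
    rintro f₁ f₂ ⟨g₁, hg₁, h₁⟩ ⟨g₂, hg₂, h₂⟩
    exact ⟨g₁ + g₂, hg₁.add hg₂, (Lp.coeFn_add f₁ f₂).trans (h₁.add h₂)⟩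
  smul_mem' := by
    rintro r f ⟨g, hg, h⟩
    exact ⟨r • g, hg.const_smul r, (Lp.coeFn_smul r f).trans (h.const_smul r)⟩

/-- The functions `b 0, b 1, …` are analytic on the upper half-plane and form an orthonormal
basis of `A²_α`. -/
def IsBergmanBasis (α : ℝ) (b : ℕ → ℂ → ℂ) : Prop :=
  (∀ n, DifferentiableOn ℂ (b n) upperHalf) ∧
    ∃ B : HilbertBasis ℕ ℂ (bergmanSpace α),
      ∀ n, ((B n : bergmanSpace α) : Lp ℂ 2 (bergmanMeasure α)) =ᵐ[bergmanMeasure α] b n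

/-! ### White noise and Gaussian analytic functions -/

/-- The standard complex Gaussian law: independent real and imaginary parts, each of mean `0`
and variance `1/2`. -/
def stdComplexGaussian : Measure ℂ :=
  ((gaussianReal 0 (1 / 2)).prod (gaussianReal 0 (1 / 2))).map
    (fun p : ℝ × ℝ => (p.1 : ℂ) + (p.2 : ℂ) * Complex.I)

/-- `a 0, a 1, …` are independent standard complex Gaussian random variables. -/
structure IsComplexGaussianSeq {Ω : Type*} [MeasurableSpace Ω] (P : Measure Ω)
    (a : ℕ → Ω → ℂ) : Prop where
  indep : iIndepFun a P
  law : ∀ n, HasLaw (a n) stdComplexGaussian P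

/-- Partial sums of the random series `∑ aₙ φₙ`. -/
def partialSum {Ω : Type*} (a : ℕ → Ω → ℂ) (φ : ℕ → ℂ → ℂ) (ω : Ω) (N : ℕ) (z : ℂ) : ℂ :=
  ∑ n ∈ Finset.range N, a n ω * φ n z

/-- The random function `∑ aₙ φₙ`, the pointwise limit of the partial sums. -/
def randomSeries {Ω : Type*} (a : ℕ → Ω → ℂ) (φ : ℕ → ℂ → ℂ) (ω : Ω) (z : ℂ) : ℂ :=
  limUnder atTop (fun N => partialSum a φ ω N z)

/-- For this `ω`, the series `∑ aₙ φₙ` converges locally uniformly on the upper half-plane. -/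
def SeriesConverges {Ω : Type*} (a : ℕ → Ω → ℂ) (φ : ℕ → ℂ → ℂ) (ω : Ω) : Prop :=
  TendstoLocallyUniformlyOn (partialSum a φ ω) (randomSeries a φ ω) atTop upperHalf

/-- The random variable `X` is the value at `s` of the white noise `∑ aₙ eₙ`: the series
`∑ aₙ ⟨eₙ, s⟩` converges to `X` in `L²(Ω)`. -/
def IsWhiteNoiseValue {Ω : Type*} [MeasurableSpace Ω] (P : Measure Ω) (a : ℕ → Ω → ℂ)
    (e : HilbertBasis ℕ ℂ L2R) (s : ℝ → ℂ) (X : Ω → ℂ) : Prop :=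
  MemLp X 2 P ∧
    Tendsto (fun N : ℕ =>
      eLpNorm (fun ω => ∑ n ∈ Finset.range N, a n ω * pairing (e n : L2R) s - X ω) 2 P)
      atTop (𝓝 0)

/-- The wavelet transform `∑ aₙ W_{ψ_α} eₙ` of the white noise `∑ aₙ eₙ`. -/
def noiseTransform {Ω : Type*} (α : ℝ) (a : ℕ → Ω → ℂ) (e : HilbertBasis ℕ ℂ L2R) :
    Ω → ℂ → ℂ :=
  randomSeries a (fun n => waveletTransform (cauchyWavelet α) (e n : L2R))

/-- The zero set in the upper half-plane as a point configuration: a Dirac mass at each zero. -/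
def zeroMeasure (f : ℂ → ℂ) : Measure ℂ :=
  Measure.count.restrict {z | z ∈ upperHalf ∧ f z = 0}

end

/-!
The proof rests on one family of vectors. For `w = x + iy` in the upper half-plane let
`κ_w = c_α y ^ (-α/2) T_x D_y ψ_α` (`atom`), so that the normalized wavelet transform of `s` at `z`
is `⟪κ_z, s⟫`.

*Analysis.* The Fourier transform of `κ_w` is, up to a constant, `u ^ ((α-1)/2) e ^ (-2πi conj(w)
u)` on the positive half-line (`fourierInv_atomHat`). Hence the atoms lie in the Hardy space, are
total in it by uniqueness of Fourier transforms (`eq_zero_of_inner_atom_eq_zero`), and their Gram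
matrix is a Gamma integral that, for the right `c_α`, equals the reproducing kernel `K_w(z) =
(α-1)/4 ((z - conj w)/(2i)) ^ (-α)` of `A²_α` (`inner_atom_atom`). The reproducing property
(`integral_conj_bergmanKernel_mul`) comes from the mean value property on the disc after a Cayley
transform centred at `w`. The kernels are total in `A²_α`, and two total families with the same
Gram matrix are exchanged by a unitary map: this is `hardyBergmanEquiv`, given by `h ↦ (z ↦ ⟪κ_z,
h⟫)`. It carries orthonormal bases of the Hardy space to those of `A²_α`, and every orthonormal
basis of `A²_α` arises in this way.

*Probability.* For a Hilbert basis `e` and iid standard Gaussians `a`, the series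
`∑ aₙ ⟪u, eₙ⟫` converges almost surely and in `L²(Ω)`, and the joint law of its sums for countably
many `u` depends only on the Gram matrix of the vectors `u` (`identDistrib_lim_sum_of_gram_eq`).
Applied to an orthonormal family this gives the independence and the law of the coefficients `ζₙ`;
applied to the atoms it shows that all the random analytic functions considered have the same
values in law on a countable dense set, whatever the basis and the probability space. Almost sure
locally uniform convergence (`ae_seriesConverges`) follows from the almost sure convergence of
Gaussian series in `L²` of a circle, together with Cauchy's formula.

*Zeros.* The values on a dense set determine an analytic function, and the point measure of its
zeros is a measurable function of these values (`measurable_zeroMeasure`): the existence of `k`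
zeros in a compact set can be read off from small values at points of the dense set. Therefore
equality in law of the values gives equality in law of the zeros (`identDistrib_zeroMeasure`).
-/

/-! ### The standard complex Gaussian law -/

lemma integral_cexp_re_mul_stdComplexGaussian (v : ℂ) :
    ∫ z, Complex.exp (Complex.I * ((z * v).re : ℝ)) ∂stdComplexGaussian =
      Complex.exp (-((‖v‖ ^ 2 / 4 : ℝ) : ℂ)) := by
  unfold stdComplexGaussian
  rw [integral_map (by fun_prop) (by fun_prop)]
  have h : ∀ p : ℝ × ℝ,
      Complex.exp (Complex.I * (((((p.1 : ℂ) + (p.2 : ℂ) * Complex.I) * v).re : ℝ) : ℂ)) =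
      Complex.exp (v.re * p.1 * Complex.I) * Complex.exp ((-v.im : ℝ) * p.2 * Complex.I) := by
    intro p
    rw [← Complex.exp_add]
    congr 1
    have : (((p.1 : ℂ) + (p.2 : ℂ) * Complex.I) * v).re = p.1 * v.re - p.2 * v.im := by
      simp
    rw [this]; push_cast; ring
  simp_rw [h]
  rw [integral_prod_mul (fun x : ℝ => Complex.exp (v.re * x * Complex.I))
    (fun x : ℝ => Complex.exp ((-v.im : ℝ) * x * Complex.I)),
    ← charFun_apply_real, ← charFun_apply_real, charFun_gaussianReal, charFun_gaussianReal,
    ← Complex.exp_add]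
  congr 1
  rw [← Complex.normSq_eq_norm_sq, Complex.normSq_apply]
  push_cast
  ring

lemma memLp_id_stdComplexGaussian : MemLp id 2 stdComplexGaussian := by
  unfold stdComplexGaussian
  rw [memLp_map_measure_iff (by fun_prop) (by fun_prop)]
  have hg : MemLp (fun x : ℝ => (x : ℂ)) 2 (gaussianReal 0 (1 / 2)) :=
    (memLp_id_gaussianReal 2).ofReal
  have h1 := hg.comp_fst (gaussianReal 0 (1 / 2))
  have h2 := (hg.comp_snd (gaussianReal 0 (1 / 2))).mul_const Complex.I
  exact h1.add h2

lemma integral_id_stdComplexGaussian : ∫ z, z ∂stdComplexGaussian = 0 := by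
  unfold stdComplexGaussian
  rw [integral_map (by fun_prop) (by fun_prop)]
  have hg : Integrable (fun x : ℝ => (x : ℂ)) (gaussianReal 0 (1 / 2)) :=
    ((memLp_id_gaussianReal 1).integrable (by simp)).ofReal
  have h0 : ∫ x : ℝ, (x : ℂ) ∂(gaussianReal 0 (1 / 2)) = 0 := by
    have := integral_id_gaussianReal (μ := 0) (v := 1 / 2)
    rw [integral_complex_ofReal, this, Complex.ofReal_zero]
  rw [integral_add (hg.comp_fst _) ((hg.comp_snd _).mul_const _), integral_mul_const,
    integral_fun_fst (fun x : ℝ => (x : ℂ)), integral_fun_snd (fun x : ℝ => (x : ℂ)), h0]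
  simp

lemma integral_norm_sq_stdComplexGaussian : ∫ z, ‖z‖ ^ 2 ∂stdComplexGaussian = 1 := by
  unfold stdComplexGaussian
  rw [integral_map (by fun_prop) (by fun_prop)]
  have h : ∀ p : ℝ × ℝ, ‖(p.1 : ℂ) + (p.2 : ℂ) * Complex.I‖ ^ 2 = p.1 ^ 2 + p.2 ^ 2 := by
    intro p
    rw [← Complex.normSq_eq_norm_sq, Complex.normSq_add_mul_I]
  have hg : Integrable (fun x : ℝ => x ^ 2) (gaussianReal 0 (1 / 2)) :=
    (memLp_id_gaussianReal 2).integrable_sq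
  have h0 : ∫ x : ℝ, x ^ 2 ∂(gaussianReal 0 (1 / 2)) = 1 / 2 := by
    have := variance_fun_id_gaussianReal (μ := 0) (v := 1 / 2)
    rw [variance_of_integral_eq_zero (by fun_prop) integral_id_gaussianReal] at this
    simpa using this
  simp_rw [h]
  rw [integral_add (hg.comp_fst _) (hg.comp_snd _),
    integral_fun_fst (fun x : ℝ => x ^ 2), integral_fun_snd (fun x : ℝ => x ^ 2), h0]
  simp; norm_num

lemma stdComplexGaussian_singleton_zero : stdComplexGaussian {0} = 0 := by
  unfold stdComplexGaussian
  rw [Measure.map_apply (by fun_prop) (measurableSet_singleton 0)]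
  have := nullSingletonClass_gaussianReal (μ := 0) (v := 1 / 2) (by norm_num)
  refine measure_mono_null (t := {0} ×ˢ Set.univ) ?_ ?_
  · rintro ⟨p, q⟩ h
    have : p = 0 := by simpa using congrArg Complex.re h
    simp [this]
  · rw [Measure.prod_prod, measure_singleton, zero_mul]

/-! ### Almost sure convergence of Gaussian series in a Hilbert space -/

section GaussianSeries

variable {Ω : Type*} [MeasurableSpace Ω] {P : Measure Ω} {a : ℕ → Ω → ℂ}

lemma IsComplexGaussianSeq.memLp (ha : IsComplexGaussianSeq P a) (n : ℕ) : MemLp (a n) 2 P := by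
  have h := memLp_id_stdComplexGaussian
  rw [← (ha.law n).map_eq, memLp_map_measure_iff (by fun_prop) (ha.law n).aemeasurable] at h
  exact h

lemma IsComplexGaussianSeq.integral_eq_zero (ha : IsComplexGaussianSeq P a) (n : ℕ) :
    ∫ ω, a n ω ∂P = 0 := by
  rw [← integral_id_stdComplexGaussian, ← (ha.law n).map_eq,
    integral_map (ha.law n).aemeasurable (by fun_prop)]

lemma IsComplexGaussianSeq.integral_norm_sq (ha : IsComplexGaussianSeq P a) (n : ℕ) :
    ∫ ω, ‖a n ω‖ ^ 2 ∂P = 1 := by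
  rw [← integral_norm_sq_stdComplexGaussian, ← (ha.law n).map_eq,
    integral_map (ha.law n).aemeasurable (by fun_prop)]

lemma IsComplexGaussianSeq.exists_measurable [IsProbabilityMeasure P]
    (ha : IsComplexGaussianSeq P a) :
    ∃ a' : ℕ → Ω → ℂ, IsComplexGaussianSeq P a' ∧ (∀ n, Measurable (a' n)) ∧
      ∀ᵐ ω ∂P, ∀ n, a n ω = a' n ω := by
  refine ⟨fun n => (ha.law n).aemeasurable.mk (a n), ⟨?_, ?_⟩,
    fun n => (ha.law n).aemeasurable.measurable_mk, ?_⟩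
  · exact ha.indep.congr fun n => (ha.law n).aemeasurable.ae_eq_mk
  · exact fun n => ⟨(ha.law n).aemeasurable.measurable_mk.aemeasurable, by
      rw [← Measure.map_congr (ha.law n).aemeasurable.ae_eq_mk, (ha.law n).map_eq]⟩
  · exact ae_all_iff.2 fun n => (ha.law n).aemeasurable.ae_eq_mk

variable {V : Type*} [NormedAddCommGroup V] [InnerProductSpace ℂ V]

lemma memLp_sum_smul (ha : IsComplexGaussianSeq P a) (v : ℕ → V) (s : Finset ℕ) :
    MemLp (fun ω => ∑ n ∈ s, a n ω • v n) 2 P :=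
  memLp_finsetSum s fun n _ => by
    have := (ContinuousLinearMap.toSpanSingleton ℂ (v n)).comp_memLp' (ha.memLp n)
    simpa [Function.comp_def, ContinuousLinearMap.toSpanSingleton_apply] using this

lemma stronglyMeasurable_sum_smul {Ω V : Type*} [NormedAddCommGroup V] [InnerProductSpace ℂ V]
    {a : ℕ → Ω → ℂ} (m : MeasurableSpace Ω) (v : ℕ → V) (s : Finset ℕ)
    (h : ∀ n ∈ s, StronglyMeasurable[m] (a n)) :
    StronglyMeasurable[m] (fun ω => ∑ n ∈ s, a n ω • v n) :=
  Finset.stronglyMeasurable_fun_sum s fun n hn => (h n hn).smul_const (v n)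

/-- A new Gaussian coefficient is orthogonal to everything that depends on the previous ones:
on an event of the past the squared norm of the partial sums grows exactly by the norm of the new
term. -/
lemma setIntegral_norm_sq_sum_succ [IsProbabilityMeasure P]
    (ha : IsComplexGaussianSeq P a) (hm : ∀ n, StronglyMeasurable (a n)) (v : ℕ → V) (N : ℕ)
    {A : Set Ω} (hA : MeasurableSet[Filtration.natural a hm N] A) :
    ∫ ω in A, ‖∑ n ∈ Finset.range (N + 1 + 1), a n ω • v n‖ ^ 2 ∂P =
      ∫ ω in A, ‖∑ n ∈ Finset.range (N + 1), a n ω • v n‖ ^ 2 ∂P +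
        ∫ ω in A, ‖a (N + 1) ω • v (N + 1)‖ ^ 2 ∂P := by
  set S : Ω → V := fun ω => ∑ n ∈ Finset.range (N + 1), a n ω • v n with hS
  have hA' : MeasurableSet A := (Filtration.natural a hm).le N A hA
  have hSL : MemLp S 2 P := memLp_sum_smul ha v _
  have hXL : MemLp (fun ω => a (N + 1) ω • v (N + 1)) 2 P := by
    simpa using memLp_sum_smul ha v {N + 1}
  have hexp : ∀ ω, ‖∑ n ∈ Finset.range (N + 1 + 1), a n ω • v n‖ ^ 2 =
      (‖S ω‖ ^ 2 + ‖a (N + 1) ω • v (N + 1)‖ ^ 2) +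
        2 * (inner ℂ (S ω) (v (N + 1)) * a (N + 1) ω).re := by
    intro ω
    rw [Finset.sum_range_succ, norm_add_sq (𝕜 := ℂ), inner_smul_right]
    simp only [RCLike.re_eq_complex_re, hS]
    rw [mul_comm (a (N + 1) ω)]
    ring
  set Y : Ω → ℂ := A.indicator (fun ω => inner ℂ (S ω) (v (N + 1))) with hY
  have hYm : StronglyMeasurable[Filtration.natural a hm N] Y := by
    refine StronglyMeasurable.indicator ?_ hA
    have : StronglyMeasurable[Filtration.natural a hm N] S :=
      stronglyMeasurable_sum_smul _ v _ fun n hn =>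
        ((Filtration.stronglyAdapted_natural hm) n).mono
          ((Filtration.natural a hm).mono (by simpa [Nat.lt_succ_iff] using hn))
    exact this.inner stronglyMeasurable_const
  have hind : IndepFun Y (a (N + 1)) P := by
    have h := ha.indep.indep_comap_natural_of_lt hm (Nat.lt_succ_self N)
    rw [IndepFun_iff_Indep]
    exact indep_of_indep_of_le_left h.symm hYm.measurable.comap_le
  have hint : Integrable (fun ω => inner ℂ (S ω) (v (N + 1)) * a (N + 1) ω) P := by
    have hi : MemLp (fun ω => inner ℂ (S ω) (v (N + 1))) 2 P := by
      have := hSL.inner_const (𝕜 := ℂ) (v (N + 1))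
      exact this
    exact hi.integrable_mul (ha.memLp _)
  have hz : ∫ ω in A, inner ℂ (S ω) (v (N + 1)) * a (N + 1) ω ∂P = 0 := by
    rw [← integral_indicator hA']
    have : (A.indicator fun ω => inner ℂ (S ω) (v (N + 1)) * a (N + 1) ω) =
        fun ω => Y ω * a (N + 1) ω := by
      ext ω; by_cases h : ω ∈ A <;> simp [hY, h]
    rw [this, hind.integral_fun_mul_eq_mul_integral
      ((hYm.mono ((Filtration.natural a hm).le N)).aestronglyMeasurable)
      (hm _).aestronglyMeasurable, ha.integral_eq_zero, mul_zero]
  have h1 : IntegrableOn (fun ω => ‖S ω‖ ^ 2) A P :=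
    (hSL.integrable_norm_pow (by norm_num)).integrableOn
  have h2 : IntegrableOn (fun ω => ‖a (N + 1) ω • v (N + 1)‖ ^ 2) A P :=
    (hXL.integrable_norm_pow (by norm_num)).integrableOn
  have h12 : IntegrableOn (fun ω => ‖S ω‖ ^ 2 + ‖a (N + 1) ω • v (N + 1)‖ ^ 2) A P := h1.add h2
  have h3 : IntegrableOn (fun ω => 2 * (inner ℂ (S ω) (v (N + 1)) * a (N + 1) ω).re) A P :=
    (hint.re.const_mul 2).integrableOn
  have h4 : ∫ ω in A, (inner ℂ (S ω) (v (N + 1)) * a (N + 1) ω).re ∂P = 0 := by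
    have h := integral_re (𝕜 := ℂ) hint.integrableOn (μ := P.restrict A)
    simp only [RCLike.re_eq_complex_re] at h
    rw [h, hz]; simp
  simp_rw [hexp]
  rw [integral_add h12 h3, integral_add h1 h2, integral_const_mul, h4]
  ring

lemma submartingale_norm_sq_sum [IsProbabilityMeasure P]
    (ha : IsComplexGaussianSeq P a) (hm : ∀ n, StronglyMeasurable (a n)) (v : ℕ → V) :
    Submartingale (fun N ω => ‖∑ n ∈ Finset.range (N + 1), a n ω • v n‖ ^ 2)
      (Filtration.natural a hm) P := by
  refine submartingale_of_setIntegral_le_succ ?_ ?_ ?_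
  · intro N
    refine (StronglyMeasurable.norm ?_).pow 2
    exact stronglyMeasurable_sum_smul _ v _ fun n hn =>
        ((Filtration.stronglyAdapted_natural hm) n).mono
          ((Filtration.natural a hm).mono (by simpa [Nat.lt_succ_iff] using hn))
  · exact fun N => (memLp_sum_smul ha v _).integrable_norm_pow (by norm_num)
  · intro N A hA
    rw [setIntegral_norm_sq_sum_succ ha hm v N hA]
    exact le_add_of_nonneg_right (integral_nonneg fun ω => by positivity)

lemma integral_norm_sq_sum_range [IsProbabilityMeasure P]
    (ha : IsComplexGaussianSeq P a) (hm : ∀ n, StronglyMeasurable (a n)) (v : ℕ → V) (N : ℕ) :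
    ∫ ω, ‖∑ n ∈ Finset.range N, a n ω • v n‖ ^ 2 ∂P = ∑ n ∈ Finset.range N, ‖v n‖ ^ 2 := by
  have h1 : ∀ n, ∫ ω, ‖a n ω • v n‖ ^ 2 ∂P = ‖v n‖ ^ 2 := by
    intro n
    simp_rw [norm_smul, mul_pow]
    rw [integral_mul_const, ha.integral_norm_sq, one_mul]
  rcases N with _ | N
  · simp
  induction N with
  | zero => simp [h1]
  | succ N ih =>
    have := setIntegral_norm_sq_sum_succ ha hm v N (A := Set.univ) MeasurableSet.univ
    simp only [Measure.restrict_univ] at this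
    rw [this, ih, h1, Finset.sum_range_succ _ (N + 1)]

/-- Kolmogorov's convergence theorem for Gaussian series in a Hilbert space. For fixed `M`, the
squared distances `‖S_N - S_M‖ ^ 2` form a submartingale in `N`, which converges; by Fatou's lemma
the limits tend to `0` along a subsequence of `M`, so that `S_N` is a Cauchy sequence. -/
lemma ae_exists_tendsto_sum_smul [IsProbabilityMeasure P] [CompleteSpace V]
    (ha : IsComplexGaussianSeq P a) (v : ℕ → V) (hv : Summable fun n => ‖v n‖ ^ 2) :
    ∀ᵐ ω ∂P, ∃ l, Tendsto (fun N => ∑ n ∈ Finset.range N, a n ω • v n) atTop (𝓝 l) := by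
  wlog hm : ∀ n, Measurable (a n) generalizing a
  · obtain ⟨a', ha', hm', h⟩ := ha.exists_measurable
    filter_upwards [this ha' hm', h] with ω h1 h2
    simpa only [h2] using h1
  have hm' : ∀ n, StronglyMeasurable (a n) := fun n => (hm n).stronglyMeasurable
  -- `w M` is the sequence `v` with its first `M` terms removed
  set w : ℕ → ℕ → V := fun M n => if n < M then 0 else v n with hw
  have hdiff : ∀ M N ω, M ≤ N → ∑ n ∈ Finset.range N, a n ω • w M n =
      ∑ n ∈ Finset.range N, a n ω • v n - ∑ n ∈ Finset.range M, a n ω • v n := by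
    intro M N ω hMN
    rw [← Finset.sum_range_add_sum_Ico _ hMN, ← Finset.sum_range_add_sum_Ico _ hMN,
      add_sub_cancel_left]
    rw [Finset.sum_eq_zero, zero_add]
    · exact Finset.sum_congr rfl fun n hn => by
        simp [hw, not_lt.2 (Finset.mem_Ico.1 hn).1]
    · intro n hn; simp [hw, Finset.mem_range.1 hn]
  set t : ℕ → ℝ := fun M => ∑' n, ‖v (n + M)‖ ^ 2 with ht
  have hwt : ∀ M N, ∑ n ∈ Finset.range N, ‖w M n‖ ^ 2 ≤ t M := by
    intro M N
    calc ∑ n ∈ Finset.range N, ‖w M n‖ ^ 2 ≤ ∑ n ∈ Finset.range (M + N), ‖w M n‖ ^ 2 :=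
          Finset.sum_le_sum_of_subset_of_nonneg (by simp) fun _ _ _ => by positivity
      _ = ∑ n ∈ Finset.range N, ‖v (n + M)‖ ^ 2 := by
          rw [Finset.sum_range_add, Finset.sum_eq_zero, zero_add]
          · refine Finset.sum_congr rfl fun n _ => ?_
            simp [hw, add_comm]
          · intro n hn; simp [hw, Finset.mem_range.1 hn]
      _ ≤ t M := ((summable_nat_add_iff M).2 hv).sum_le_tsum _ fun _ _ => by positivity
  have ht0 : Tendsto t atTop (𝓝 0) := tendsto_sum_nat_add fun n => ‖v n‖ ^ 2
  set f : ℕ → ℕ → Ω → ℝ := fun M N ω => ‖∑ n ∈ Finset.range (N + 1), a n ω • w M n‖ ^ 2 with hf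
  have hfint : ∀ M N, ∫⁻ ω, ENNReal.ofReal (f M N ω) ∂P ≤ ENNReal.ofReal (t M) := by
    intro M N
    rw [← ofReal_integral_eq_lintegral_ofReal
      ((memLp_sum_smul ha (w M) _).integrable_norm_pow (by norm_num))
      (ae_of_all _ fun ω => by positivity), integral_norm_sq_sum_range ha hm']
    exact ENNReal.ofReal_le_ofReal (hwt M _)
  have hfm : ∀ M N, Measurable fun ω => ENNReal.ofReal (f M N ω) := fun M N =>
    (((stronglyMeasurable_sum_smul _ (w M) _ fun n _ => hm' n).norm.pow
      2).measurable).ennreal_ofReal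
  have hconv : ∀ᵐ ω ∂P, ∀ M, ∃ d, Tendsto (fun N => f M N ω) atTop (𝓝 d) := by
    refine ae_all_iff.2 fun M => ?_
    refine (submartingale_norm_sq_sum ha hm' (w M)).exists_ae_tendsto_of_bdd
      (R := (t M).toNNReal) fun N => ?_
    rw [eLpNorm_one_eq_lintegral_enorm]
    refine le_trans (le_of_eq (lintegral_congr fun ω => ?_)) (hfint M N)
    rw [Real.enorm_eq_ofReal (by positivity)]
  -- `E ‖S_N - S_M‖ ^ 2 ≤ t M → 0`, and Fatou's lemma is applied first in `N` and then in `M`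
  have hlim : ∫⁻ ω, liminf (fun M => liminf (fun N => ENNReal.ofReal (f M N ω)) atTop) atTop ∂P
      = 0 := by
    refine le_antisymm ?_ bot_le
    calc _ ≤ liminf (fun M => ∫⁻ ω, liminf (fun N => ENNReal.ofReal (f M N ω)) atTop ∂P) atTop :=
          lintegral_liminf_le fun M => .liminf fun N => hfm M N
      _ ≤ liminf (fun M => ENNReal.ofReal (t M)) atTop := by
          refine liminf_le_liminf (Eventually.of_forall fun M => ?_)
          refine (lintegral_liminf_le fun N => hfm M N).trans ?_
          refine (liminf_le_liminf (Eventually.of_forall fun N => hfint M N)).trans ?_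
          simp
      _ = 0 := by
          have := (ENNReal.tendsto_ofReal ht0).liminf_eq
          simpa using this
  rw [lintegral_eq_zero_iff (.liminf fun M => .liminf fun N => hfm M N)] at hlim
  filter_upwards [hconv, hlim] with ω h1 h2
  refine cauchySeq_tendsto_of_complete (Metric.cauchySeq_iff'.2 fun ε hε => ?_)
  have h3 : ∃ᶠ M in atTop, liminf (fun N => ENNReal.ofReal (f M N ω)) atTop <
      ENNReal.ofReal ((ε / 2) ^ 2) := by
    refine frequently_lt_of_liminf_lt (by isBoundedDefault) ?_
    rw [h2]; simpa using by positivity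
  obtain ⟨M, hM⟩ := h3.exists
  obtain ⟨d, hd⟩ := h1 M
  rw [(ENNReal.tendsto_ofReal hd).liminf_eq, ENNReal.ofReal_lt_ofReal_iff (by positivity)] at hM
  obtain ⟨N₀, hN₀⟩ := eventually_atTop.1 (hd.eventually_lt_const hM)
  have hfin : ∀ N ≥ max N₀ M + 1, dist (∑ n ∈ Finset.range N, a n ω • v n)
      (∑ n ∈ Finset.range M, a n ω • v n) < ε / 2 := by
    intro N hN
    obtain ⟨N, rfl⟩ : ∃ K, N = K + 1 := ⟨N - 1, by omega⟩
    have h4 := hN₀ N (by omega)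
    rw [dist_eq_norm, ← hdiff M (N + 1) ω (by omega)]
    exact lt_of_pow_lt_pow_left₀ 2 (by positivity) h4
  refine ⟨max N₀ M + 1, fun N hN => ?_⟩
  calc _ ≤ _ := dist_triangle_right _ _ (∑ n ∈ Finset.range M, a n ω • v n)
    _ < ε / 2 + ε / 2 := add_lt_add (hfin N hN) (hfin _ le_rfl)
    _ = ε := add_halves ε

lemma eLpNorm_sum_smul [IsProbabilityMeasure P] (ha : IsComplexGaussianSeq P a) (v : ℕ → V)
    (s : Finset ℕ) :
    eLpNorm (fun ω => ∑ n ∈ s, a n ω • v n) 2 P =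
      ENNReal.ofReal (√(∑ n ∈ s, ‖v n‖ ^ 2)) := by
  wlog hm : ∀ n, Measurable (a n) generalizing a
  · obtain ⟨a', ha', hm', h⟩ := ha.exists_measurable
    rw [← this ha' hm']
    refine eLpNorm_congr_ae ?_
    filter_upwards [h] with ω h2
    simp only [h2]
  obtain ⟨N, hN⟩ := s.exists_nat_subset_range
  have key := integral_norm_sq_sum_range ha (fun n => (hm n).stronglyMeasurable)
    (fun n => if n ∈ s then v n else 0) N
  have h1 : ∀ ω, ∑ n ∈ Finset.range N, a n ω • (if n ∈ s then v n else 0) =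
      ∑ n ∈ s, a n ω • v n := by
    intro ω
    simp only [smul_ite, smul_zero]
    rw [← Finset.sum_filter]
    congr 1; ext n; simpa using fun h => hN h
  have h2 : ∑ n ∈ Finset.range N, ‖if n ∈ s then v n else 0‖ ^ 2 = ∑ n ∈ s, ‖v n‖ ^ 2 := by
    have : ∀ n, ‖if n ∈ s then v n else 0‖ ^ 2 = if n ∈ s then ‖v n‖ ^ 2 else 0 := by
      intro n; split_ifs <;> simp
    simp only [this]
    rw [← Finset.sum_filter]
    congr 1; ext n; simpa using fun h => hN h
  simp only [h1, h2] at key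
  rw [(memLp_sum_smul ha v s).eLpNorm_eq_integral_rpow_norm (by simp) (by simp), Real.sqrt_eq_rpow]
  congr 1
  rw [← key]
  norm_num

/-- The limit of a Gaussian series with square summable scalar coefficients is square integrable,
and the distance to the partial sums is controlled by the tail of the coefficients. -/
lemma eLpNorm_sum_sub_lim_le [IsProbabilityMeasure P] (ha : IsComplexGaussianSeq P a)
    {v : ℕ → ℂ} (hv : Summable fun n => ‖v n‖ ^ 2) {X : Ω → ℂ}
    (hX : ∀ᵐ ω ∂P, Tendsto (fun N => ∑ n ∈ Finset.range N, a n ω * v n) atTop (𝓝 (X ω))) (N : ℕ) :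
    eLpNorm (fun ω => ∑ n ∈ Finset.range N, a n ω * v n - X ω) 2 P ≤
      ENNReal.ofReal (√(∑' n, ‖v (n + N)‖ ^ 2)) := by
  have hmem : ∀ N, AEStronglyMeasurable (fun ω => ∑ n ∈ Finset.range N, a n ω * v n) P :=
    fun N => (memLp_sum_smul ha v _).1
  have h1 := Lp.eLpNorm_lim_le_liminf_eLpNorm (p := 2) (μ := P)
    (f := fun M ω => ∑ n ∈ Finset.range N, a n ω * v n - ∑ n ∈ Finset.range M, a n ω * v n)
    (fun M => (hmem N).sub (hmem M)) (fun ω => ∑ n ∈ Finset.range N, a n ω * v n - X ω)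
    (by filter_upwards [hX] with ω h using h.const_sub _)
  refine h1.trans ?_
  refine (liminf_le_liminf (v := fun _ => ENNReal.ofReal (√(∑' n, ‖v (n + N)‖ ^ 2))) ?_).trans
    (by simp)
  filter_upwards [eventually_ge_atTop N] with M hM
  rw [← eLpNorm_neg]
  have h2 : (-fun ω => ∑ n ∈ Finset.range N, a n ω * v n - ∑ n ∈ Finset.range M, a n ω * v n) =
      fun ω => ∑ n ∈ Finset.Ico N M, a n ω • v n := by
    ext ω
    rw [Finset.sum_Ico_eq_sub _ hM]
    simp
  rw [h2, eLpNorm_sum_smul ha, Finset.sum_Ico_eq_sum_range]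
  refine ENNReal.ofReal_le_ofReal (Real.sqrt_le_sqrt ?_)
  simp_rw [add_comm N]
  exact ((summable_nat_add_iff N).2 hv).sum_le_tsum _ fun _ _ => by positivity

lemma aemeasurable_lim_sum (ha : IsComplexGaussianSeq P a) {v : ℕ → ℂ} {X : Ω → ℂ}
    (hX : ∀ᵐ ω ∂P, Tendsto (fun N => ∑ n ∈ Finset.range N, a n ω * v n) atTop (𝓝 (X ω))) :
    AEMeasurable X P :=
  aemeasurable_of_tendsto_metrizable_ae atTop
    (fun _ => (memLp_sum_smul ha v _).1.aemeasurable) hX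

lemma memLp_lim_sum [IsProbabilityMeasure P] (ha : IsComplexGaussianSeq P a)
    {v : ℕ → ℂ} (hv : Summable fun n => ‖v n‖ ^ 2) {X : Ω → ℂ}
    (hX : ∀ᵐ ω ∂P, Tendsto (fun N => ∑ n ∈ Finset.range N, a n ω * v n) atTop (𝓝 (X ω))) :
    MemLp X 2 P := by
  have h := eLpNorm_sum_sub_lim_le ha hv hX 0
  simp only [Finset.range_zero, Finset.sum_empty, zero_sub] at h
  rw [← memLp_neg_iff]
  exact ⟨(aemeasurable_lim_sum ha hX).neg.aestronglyMeasurable, h.trans_lt ENNReal.ofReal_lt_top⟩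

lemma tendsto_eLpNorm_sum_sub_lim [IsProbabilityMeasure P] (ha : IsComplexGaussianSeq P a)
    {v : ℕ → ℂ} (hv : Summable fun n => ‖v n‖ ^ 2) {X : Ω → ℂ}
    (hX : ∀ᵐ ω ∂P, Tendsto (fun N => ∑ n ∈ Finset.range N, a n ω * v n) atTop (𝓝 (X ω))) :
    Tendsto (fun N : ℕ => eLpNorm (fun ω => ∑ n ∈ Finset.range N, a n ω * v n - X ω) 2 P)
      atTop (𝓝 0) := by
  refine tendsto_of_tendsto_of_tendsto_of_le_of_le tendsto_const_nhds ?_ (fun _ => zero_le)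
    (eLpNorm_sum_sub_lim_le ha hv hX)
  have := ENNReal.tendsto_ofReal ((tendsto_sum_nat_add fun n => ‖v n‖ ^ 2).sqrt)
  simpa using this

/-! ### The law of a Gaussian series -/

/-- The limit of a Gaussian series `∑ aₙ vₙ` is a centred complex Gaussian variable of variance
`∑ |vₙ| ^ 2`. -/
lemma integral_cexp_re_lim_sum [IsProbabilityMeasure P] (ha : IsComplexGaussianSeq P a)
    {v : ℕ → ℂ} {r : ℝ} (hv : HasSum (fun n => ‖v n‖ ^ 2) r) {X : Ω → ℂ}
    (hX : ∀ᵐ ω ∂P, Tendsto (fun N => ∑ n ∈ Finset.range N, a n ω * v n) atTop (𝓝 (X ω))) :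
    ∫ ω, Complex.exp (Complex.I * ((X ω).re : ℝ)) ∂P = Complex.exp (-((r / 4 : ℝ) : ℂ)) := by
  have hone : ∀ x : ℝ, ‖Complex.exp (Complex.I * (x : ℂ))‖ = 1 := by
    intro x; rw [mul_comm, Complex.norm_exp_ofReal_mul_I]
  have h1 : ∀ N, ∫ ω, Complex.exp (Complex.I * ((∑ n ∈ Finset.range N, a n ω * v n).re : ℝ)) ∂P =
      Complex.exp (-(((∑ n ∈ Finset.range N, ‖v n‖ ^ 2) / 4 : ℝ) : ℂ)) := by
    intro N
    have hind : iIndepFun (fun n : Finset.range N => fun ω =>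
        Complex.exp (Complex.I * ((a n ω * v n).re : ℝ))) P :=
      (ha.indep.precomp (g := fun n : Finset.range N => (n : ℕ)) Subtype.val_injective).comp
        (fun n z => Complex.exp (Complex.I * ((z * v n).re : ℝ))) fun n => by fun_prop
    have hprod := hind.integral_fun_prod_eq_prod_integral fun n => by
      have := (ha.law n).aemeasurable
      fun_prop
    have e1 : ∀ ω, Complex.exp (Complex.I * ((∑ n ∈ Finset.range N, a n ω * v n).re : ℝ)) =
        ∏ n : Finset.range N, Complex.exp (Complex.I * ((a n ω * v n).re : ℝ)) := by
      intro ω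
      rw [Finset.prod_coe_sort (Finset.range N)
        (fun n => Complex.exp (Complex.I * ((a n ω * v n).re : ℝ))), ← Complex.exp_sum,
        ← Finset.mul_sum, Complex.re_sum, Complex.ofReal_sum]
    have e2 : ∀ n, ∫ ω, Complex.exp (Complex.I * ((a n ω * v n).re : ℝ)) ∂P =
        Complex.exp (-((‖v n‖ ^ 2 / 4 : ℝ) : ℂ)) := by
      intro n
      rw [← integral_cexp_re_mul_stdComplexGaussian, ← (ha.law n).map_eq,
        integral_map (ha.law n).aemeasurable (by fun_prop)]
    simp_rw [e1]
    rw [hprod]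
    simp_rw [e2]
    rw [Finset.prod_coe_sort (Finset.range N)
        (fun n => Complex.exp (-((‖v n‖ ^ 2 / 4 : ℝ) : ℂ))), ← Complex.exp_sum]
    congr 1
    rw [Finset.sum_div]
    push_cast
    rw [Finset.sum_neg_distrib]
  refine tendsto_nhds_unique (tendsto_integral_of_dominated_convergence (fun _ => 1)
    (F := fun N ω => Complex.exp (Complex.I * ((∑ n ∈ Finset.range N, a n ω * v n).re : ℝ)))
    (fun N => ?_) (integrable_const _) (fun N => ae_of_all _ fun ω => (hone _).le) ?_) ?_
  · have := (memLp_sum_smul ha v (Finset.range N)).1.aemeasurable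
    simp only [smul_eq_mul] at this
    exact (Complex.measurable_exp.comp (measurable_const.mul
      (Complex.measurable_ofReal.comp Complex.measurable_re))).comp_aemeasurable this
      |>.aestronglyMeasurable
  · filter_upwards [hX] with ω h
    have : Continuous fun z : ℂ => Complex.exp (Complex.I * ((z.re : ℝ) : ℂ)) := by fun_prop
    exact (this.tendsto _).comp h
  · simp_rw [h1]
    have : Continuous fun x : ℝ => Complex.exp (-((x / 4 : ℝ) : ℂ)) := by fun_prop
    exact (this.tendsto r).comp hv.tendsto_sum_nat

end GaussianSeries

section GaussianProcess

lemma HilbertBasis.hasSum_norm_inner_sq {H : Type*} [NormedAddCommGroup H] [InnerProductSpace ℂ H]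
    (e : HilbertBasis ℕ ℂ H) (u : H) : HasSum (fun n => ‖inner ℂ u (e n)‖ ^ 2) (‖u‖ ^ 2) := by
  have h := (e.hasSum_inner_mul_inner u u).mapL Complex.reCLM
  simp only [Complex.reCLM_apply] at h
  rw [← RCLike.re_eq_complex_re, inner_self_eq_norm_sq] at h
  convert h using 2 with n
  rw [← inner_conj_symm (e n) u, Complex.mul_conj, RCLike.re_eq_complex_re, Complex.ofReal_re,
    Complex.normSq_eq_norm_sq]

variable {Ω Ω' : Type*} [MeasurableSpace Ω] [MeasurableSpace Ω'] {P : Measure Ω} {P' : Measure Ω'}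
  {a : ℕ → Ω → ℂ} {a' : ℕ → Ω' → ℂ}
  {H H' : Type*} [NormedAddCommGroup H] [InnerProductSpace ℂ H]
  [NormedAddCommGroup H'] [InnerProductSpace ℂ H']

lemma ae_exists_tendsto_sum_inner [IsProbabilityMeasure P] (ha : IsComplexGaussianSeq P a)
    (e : HilbertBasis ℕ ℂ H) (u : H) : ∀ᵐ ω ∂P, ∃ l,
      Tendsto (fun N => ∑ n ∈ Finset.range N, a n ω * inner ℂ u (e n)) atTop (𝓝 l) :=
  ae_exists_tendsto_sum_smul ha (fun n => inner ℂ u (e n)) (e.hasSum_norm_inner_sq u).summable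

lemma Complex.re_sum_mul_eq_strongDual {ι : Type*} [Fintype ι] [DecidableEq ι]
    (L : StrongDual ℝ (ι → ℂ)) : ∃ c : ι → ℂ, ∀ x, L x = (∑ i, x i * c i).re := by
  refine ⟨fun i => (L (Pi.single i (1 : ℂ)) : ℂ) - (L (Pi.single i Complex.I) : ℂ) * Complex.I,
    fun x => ?_⟩
  have hx : x = ∑ i, ((x i).re • (Pi.single i (1 : ℂ) : ι → ℂ) +
      (x i).im • (Pi.single i Complex.I : ι → ℂ)) := by
    ext j
    simp only [Finset.sum_apply, Pi.add_apply, Pi.smul_apply, Finset.sum_add_distrib]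
    simp [Pi.single_apply]
  conv_lhs => rw [hx]
  simp [map_sum]

/-- The joint characteristic function of finitely many Gaussian series depends only on the norms of
the linear combinations of the vectors. -/
lemma charFunDual_map_lim_sum [IsProbabilityMeasure P] (ha : IsComplexGaussianSeq P a)
    (e : HilbertBasis ℕ ℂ H) {ι : Type*} [Fintype ι] {s : ι → H} {X : ι → Ω → ℂ}
    (hX : ∀ i, ∀ᵐ ω ∂P, Tendsto (fun N => ∑ n ∈ Finset.range N, a n ω * inner ℂ (s i) (e n)) atTop
      (𝓝 (X i ω))) (L : StrongDual ℝ (ι → ℂ)) (c : ι → ℂ) (hc : ∀ x, L x = (∑ i, x i * c i).re) :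
    charFunDual (P.map fun ω i => X i ω) L =
      Complex.exp (-((‖∑ i, conj (c i) • s i‖ ^ 2 / 4 : ℝ) : ℂ)) := by
  have hm : AEMeasurable (fun ω i => X i ω) P :=
    aemeasurable_pi_lambda _ fun i => aemeasurable_lim_sum ha (hX i)
  rw [charFunDual_apply, integral_map hm (by fun_prop),
    ← integral_cexp_re_lim_sum ha (e.hasSum_norm_inner_sq _) (X := fun ω => ∑ i, X i ω * c i)]
  · simp_rw [hc, mul_comm Complex.I]
  · filter_upwards [ae_all_iff.2 hX] with ω h
    have h1 := tendsto_finsetSum Finset.univ fun i _ => (h i).mul_const (c i)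
    refine h1.congr fun N => ?_
    simp_rw [Finset.sum_mul]
    rw [Finset.sum_comm]
    refine Finset.sum_congr rfl fun n _ => ?_
    rw [sum_inner, Finset.mul_sum]
    refine Finset.sum_congr rfl fun i _ => ?_
    rw [inner_smul_left, Complex.conj_conj]; ring

/-- The law of a family of Gaussian series is determined by the Gram matrix of the family of
vectors. -/
theorem identDistrib_lim_sum_of_gram_eq [IsProbabilityMeasure P] [IsProbabilityMeasure P']
    (ha : IsComplexGaussianSeq P a) (ha' : IsComplexGaussianSeq P' a')
    (e : HilbertBasis ℕ ℂ H) (e' : HilbertBasis ℕ ℂ H') {ι : Type*} [Countable ι]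
    {s : ι → H} {s' : ι → H'} (hs : ∀ i j, inner ℂ (s i) (s j) = inner ℂ (s' i) (s' j))
    {X : ι → Ω → ℂ} {X' : ι → Ω' → ℂ}
    (hX : ∀ i, ∀ᵐ ω ∂P, Tendsto (fun N => ∑ n ∈ Finset.range N, a n ω * inner ℂ (s i) (e n)) atTop
      (𝓝 (X i ω)))
    (hX' : ∀ i, ∀ᵐ ω ∂P', Tendsto (fun N => ∑ n ∈ Finset.range N, a' n ω * inner ℂ (s' i) (e' n))
      atTop (𝓝 (X' i ω))) :
    IdentDistrib (fun ω i => X i ω) (fun ω i => X' i ω) P P' := by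
  have hm : AEMeasurable (fun ω i => X i ω) P :=
    aemeasurable_pi_lambda _ fun i => aemeasurable_lim_sum ha (hX i)
  have hm' : AEMeasurable (fun ω i => X' i ω) P' :=
    aemeasurable_pi_lambda _ fun i => aemeasurable_lim_sum ha' (hX' i)
  refine ⟨hm, hm', ?_⟩
  have hlaw : ∀ I : Finset ι, P.map (fun ω => I.restrict fun i => X i ω) =
      P'.map (fun ω => I.restrict fun i => X' i ω) := by
    intro I
    have hI : ∀ i : I, AEMeasurable (X i) P := fun i => aemeasurable_lim_sum ha (hX i)
    have hI' : ∀ i : I, AEMeasurable (X' i) P' := fun i => aemeasurable_lim_sum ha' (hX' i)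
    have := Measure.isProbabilityMeasure_map (aemeasurable_pi_lambda _ hI)
    have := Measure.isProbabilityMeasure_map (aemeasurable_pi_lambda _ hI')
    change P.map (fun ω (i : I) => X i ω) = P'.map (fun ω (i : I) => X' i ω)
    classical
    refine Measure.ext_of_charFunDual (funext fun L => ?_)
    obtain ⟨c, hc⟩ := Complex.re_sum_mul_eq_strongDual L
    rw [charFunDual_map_lim_sum ha e (fun i : I => hX i) L c hc,
      charFunDual_map_lim_sum ha' e' (fun i : I => hX' i) L c hc]
    congr 4
    rw [← inner_self_eq_norm_sq (𝕜 := ℂ), ← inner_self_eq_norm_sq (𝕜 := ℂ)]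
    simp only [sum_inner, inner_sum, inner_smul_left, inner_smul_right, hs]
  have h1 := isProjectiveLimit_map hm
  simp_rw [hlaw] at h1
  exact h1.unique (isProjectiveLimit_map hm')

lemma tendsto_sum_inner_self (e : HilbertBasis ℕ ℂ H) (a : ℕ → ℂ) (i : ℕ) :
    Tendsto (fun N => ∑ n ∈ Finset.range N, a n * inner ℂ (e i) (e n)) atTop (𝓝 (a i)) := by
  refine tendsto_const_nhds.congr' ?_
  filter_upwards [eventually_gt_atTop i] with N hN
  rw [Finset.sum_eq_single i]
  · simp [e.orthonormal.1 i]
  · intro n _ hn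
    rw [e.orthonormal.2 hn.symm, mul_zero]
  · intro h; exact absurd (Finset.mem_range.2 hN) h

/-- The values of white noise at an orthonormal family are independent standard complex
Gaussians. -/
theorem isComplexGaussianSeq_of_orthonormal [IsProbabilityMeasure P]
    (ha : IsComplexGaussianSeq P a) (e : HilbertBasis ℕ ℂ H) {s : ℕ → H} (hs : Orthonormal ℂ s)
    {X : ℕ → Ω → ℂ}
    (hX : ∀ i, ∀ᵐ ω ∂P, Tendsto (fun N => ∑ n ∈ Finset.range N, a n ω * inner ℂ (s i) (e n)) atTop
      (𝓝 (X i ω))) :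
    IsComplexGaussianSeq P X := by
  have h := identDistrib_lim_sum_of_gram_eq ha ha e e (s := s) (s' := e) (X := X) (X' := a)
    (fun i j => by rw [orthonormal_iff_ite.1 hs, orthonormal_iff_ite.1 e.orthonormal]) hX
    (fun i => ae_of_all _ fun ω => tendsto_sum_inner_self e (fun n => a n ω) i)
  have hi : ∀ i, IdentDistrib (X i) (a i) P P := fun i => h.comp (measurable_pi_apply i)
  refine ⟨?_, fun n => (hi n).symm.hasLaw (ha.law n)⟩
  rw [iIndepFun_iff_map_fun_eq_infinitePi_map₀' fun i => (hi i).aemeasurable_fst, h.map_eq,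
    ha.indep.map_fun_eq_infinitePi_map₀' fun i => (ha.law i).aemeasurable]
  congr 1
  ext1 i
  rw [(hi i).map_eq]

/-- The value of white noise at a nonzero vector almost surely does not vanish. -/
lemma ae_lim_sum_ne_zero [IsProbabilityMeasure P] (ha : IsComplexGaussianSeq P a)
    (e : HilbertBasis ℕ ℂ H) {u : H} (hu : u ≠ 0) {X : Ω → ℂ}
    (hX : ∀ᵐ ω ∂P, Tendsto (fun N => ∑ n ∈ Finset.range N, a n ω * inner ℂ u (e n)) atTop
      (𝓝 (X ω))) : ∀ᵐ ω ∂P, X ω ≠ 0 := by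
  have h := identDistrib_lim_sum_of_gram_eq ha ha e e (ι := Unit)
    (s := fun _ => ((‖u‖⁻¹ : ℝ) : ℂ) • u) (s' := fun _ => e 0)
    (X := fun _ ω => ((‖u‖⁻¹ : ℝ) : ℂ) * X ω) (X' := fun _ => a 0)
    (fun i j => by
      have hu' : (‖u‖ : ℂ) ≠ 0 := by simpa using hu
      rw [inner_smul_left, inner_smul_right, inner_self_eq_norm_sq_to_K,
        inner_self_eq_norm_sq_to_K, e.orthonormal.1 0, Complex.conj_ofReal]
      push_cast
      field_simp
      simp)
    (fun _ => by
      filter_upwards [hX] with ω h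
      refine (h.const_mul ((‖u‖⁻¹ : ℝ) : ℂ)).congr fun N => ?_
      rw [Finset.mul_sum]
      refine Finset.sum_congr rfl fun n _ => ?_
      rw [inner_smul_left, Complex.conj_ofReal]; ring)
    (fun i => ae_of_all _ fun ω => tendsto_sum_inner_self e (fun n => a n ω) 0)
  have h0 : IdentDistrib (fun ω => ((‖u‖⁻¹ : ℝ) : ℂ) * X ω) (a 0) P P :=
    h.comp (measurable_pi_apply ())
  have hl := h0.symm.hasLaw (ha.law 0)
  have h2 : P {ω | ((‖u‖⁻¹ : ℝ) : ℂ) * X ω = 0} = 0 := by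
    rw [hl.measure_eq (p := fun z => z = 0) (measurableSet_singleton 0)]
    exact stdComplexGaussian_singleton_zero
  filter_upwards [measure_eq_zero_iff_ae_notMem.1 h2] with ω h3 h4
  exact h3 (by simp [h4])

end GaussianProcess

/-! ### Locally uniform convergence of Gaussian series of analytic functions -/

section AnalyticSeries

lemma isOpen_upperHalf : IsOpen upperHalf := isOpen_lt continuous_const Complex.continuous_im

lemma closedBall_subset_upperHalf {z : ℂ} {r : ℝ} (hr : r < z.im) :
    Metric.closedBall z r ⊆ upperHalf := by
  intro w hw
  have h1 : |(w - z).im| ≤ r := (Complex.abs_im_le_norm _).trans (by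
    rwa [← dist_eq_norm, ← Metric.mem_closedBall])
  have h2 := (abs_le.1 h1).1
  simp only [Complex.sub_im] at h2
  simp only [upperHalf, Set.mem_ofPred_eq]
  linarith

/-- Arc length (in the angle) on a circle. -/
noncomputable abbrev angleMeasure : Measure ℝ := volume.restrict (Set.Ioc 0 (2 * Real.pi))

lemma continuous_comp_circleMap {F : ℂ → ℂ} {c : ℂ} {R : ℝ} (hR : 0 ≤ R)
    (hF : ContinuousOn F (Metric.closedBall c R)) : Continuous fun θ => F (circleMap c R θ) :=
  hF.comp_continuous (continuous_circleMap c R) fun θ => circleMap_mem_closedBall c hR θ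

lemma memLp_comp_circleMap {F : ℂ → ℂ} {c : ℂ} {R : ℝ} (hR : 0 ≤ R)
    (hF : ContinuousOn F (Metric.closedBall c R)) :
    MemLp (fun θ => F (circleMap c R θ)) 2 angleMeasure := by
  have hc := continuous_comp_circleMap hR hF
  obtain ⟨C, hC⟩ := ((isCompact_sphere c R).image_of_continuousOn
    (hF.mono Metric.sphere_subset_closedBall)).isBounded.exists_norm_le
  exact MemLp.of_bound hc.aestronglyMeasurable C (ae_of_all _ fun θ =>
    hC _ ⟨_, circleMap_mem_sphere c hR θ, rfl⟩)

/-- By Cauchy's formula, an analytic function is controlled in the concentric disc of half the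
radius by its `L²` norm on the circle. -/
lemma norm_le_eLpNorm_circleMap {F : ℂ → ℂ} {c : ℂ} {R : ℝ} (hR : 0 < R)
    (hF : DifferentiableOn ℂ F (Metric.closedBall c R)) {z : ℂ}
    (hz : z ∈ Metric.closedBall c (R / 2)) :
    ‖F z‖ ≤ √(2 * Real.pi) *
      (eLpNorm (fun θ => F (circleMap c R θ)) 2 angleMeasure).toReal := by
  have hzb : z ∈ Metric.ball c R := Metric.closedBall_subset_ball (by linarith) hz
  have hcont := continuous_comp_circleMap hR.le hF.continuousOn
  have hmem := memLp_comp_circleMap hR.le hF.continuousOn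
  have h1 :=
    Complex.two_pi_I_inv_smul_circleIntegral_sub_inv_smul_of_differentiable_on_off_countable
    Set.countable_empty hzb hF.continuousOn fun x hx =>
      hF.differentiableAt (Metric.closedBall_mem_nhds_of_mem hx.1)
  have h2 : ‖∮ w in C(c, R), (w - z)⁻¹ • F w‖ ≤ 2 * ∫ θ, ‖F (circleMap c R θ)‖ ∂angleMeasure := by
    rw [circleIntegral, intervalIntegral.integral_of_le Real.two_pi_pos.le, ← integral_const_mul]
    refine norm_integral_le_of_norm_le (hcont.norm.integrableOn_Ioc.const_mul 2)
      (ae_of_all _ fun θ => ?_)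
    have h3 : R / 2 ≤ ‖circleMap c R θ - z‖ := by
      have h4 : ‖circleMap c R θ - c‖ = R := by
        simp [abs_of_pos hR]
      have h5 : ‖z - c‖ ≤ R / 2 := by rwa [← dist_eq_norm, ← Metric.mem_closedBall]
      have h6 := norm_sub_le_norm_sub_add_norm_sub (circleMap c R θ) z c
      linarith
    rw [norm_smul, norm_smul, norm_inv, deriv_circleMap, norm_mul, norm_circleMap_zero,
      Complex.norm_I, mul_one, abs_of_pos hR, ← mul_assoc]
    refine mul_le_mul_of_nonneg_right ?_ (norm_nonneg _)
    rw [← div_eq_mul_inv, div_le_iff₀ (by linarith)]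
    linarith
  have h3 : ∫ θ, ‖F (circleMap c R θ)‖ ∂angleMeasure ≤ √(2 * Real.pi) *
      (eLpNorm (fun θ => F (circleMap c R θ)) 2 angleMeasure).toReal := by
    rw [integral_norm_eq_lintegral_enorm hcont.aestronglyMeasurable,
      ← eLpNorm_one_eq_lintegral_enorm]
    have h4 := eLpNorm_le_eLpNorm_mul_rpow_measure_univ (p := 1) (q := 2) (by norm_num)
      hcont.aestronglyMeasurable (μ := angleMeasure)
    have h5 : angleMeasure Set.univ = ENNReal.ofReal (2 * Real.pi) := by simp [angleMeasure]
    rw [h5, ENNReal.ofReal_rpow_of_pos (by positivity)] at h4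
    refine (ENNReal.toReal_mono (ENNReal.mul_ne_top hmem.2.ne ENNReal.ofReal_ne_top) h4).trans
      (le_of_eq ?_)
    rw [ENNReal.toReal_mul, ENNReal.toReal_ofReal (by positivity), mul_comm, Real.sqrt_eq_rpow]
    norm_num
  rw [← h1, norm_smul]
  have h4 : ‖(2 * Real.pi * Complex.I : ℂ)⁻¹‖ = (2 * Real.pi)⁻¹ := by simp [Real.pi_pos.le]
  rw [h4, ← div_eq_inv_mul, div_le_iff₀ Real.two_pi_pos]
  have h5 := Real.pi_gt_three
  have h6 : 0 ≤ √(2 * Real.pi) *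
      (eLpNorm (fun θ => F (circleMap c R θ)) 2 angleMeasure).toReal := by positivity
  nlinarith

lemma partialSum_sub {Ω : Type*} (a : ℕ → Ω → ℂ) (φ : ℕ → ℂ → ℂ) (ω : Ω) (z : ℂ) {M N : ℕ}
    (h : M ≤ N) : partialSum a φ ω N z - partialSum a φ ω M z =
      ∑ n ∈ Finset.Ico M N, a n ω * φ n z := by
  simp only [partialSum]
  rw [Finset.sum_Ico_eq_sub _ h]

lemma tendsto_randomSeries {Ω : Type*} {a : ℕ → Ω → ℂ} {φ : ℕ → ℂ → ℂ} {ω : Ω} {z : ℂ}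
    (h : ∃ l, Tendsto (fun N => partialSum a φ ω N z) atTop (𝓝 l)) :
    Tendsto (fun N => partialSum a φ ω N z) atTop (𝓝 (randomSeries a φ ω z)) :=
  tendsto_nhds_limUnder h

lemma SeriesConverges.tendsto {Ω : Type*} {a : ℕ → Ω → ℂ} {φ : ℕ → ℂ → ℂ} {ω : Ω}
    (h : SeriesConverges a φ ω) {z : ℂ} (hz : z ∈ upperHalf) :
    Tendsto (fun N => partialSum a φ ω N z) atTop (𝓝 (randomSeries a φ ω z)) :=
  h.tendsto_at hz

lemma differentiableOn_partialSum {Ω : Type*} (a : ℕ → Ω → ℂ) {φ : ℕ → ℂ → ℂ}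
    (hφ : ∀ n, DifferentiableOn ℂ (φ n) upperHalf) (ω : Ω) (N : ℕ) :
    DifferentiableOn ℂ (partialSum a φ ω N) upperHalf :=
  DifferentiableOn.fun_sum fun n _ => (hφ n).const_mul (a n ω)

lemma SeriesConverges.differentiableOn {Ω : Type*} {a : ℕ → Ω → ℂ} {φ : ℕ → ℂ → ℂ}
    (hφ : ∀ n, DifferentiableOn ℂ (φ n) upperHalf) {ω : Ω} (h : SeriesConverges a φ ω) :
    DifferentiableOn ℂ (randomSeries a φ ω) upperHalf :=
  TendstoLocallyUniformlyOn.differentiableOn h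
    (Eventually.of_forall fun N => differentiableOn_partialSum a hφ ω N) isOpen_upperHalf

lemma seriesConverges_of_uniformCauchySeqOn {Ω : Type*} {a : ℕ → Ω → ℂ} {φ : ℕ → ℂ → ℂ} {ω : Ω}
    (h : ∀ z ∈ upperHalf, ∃ t ∈ 𝓝[upperHalf] z, UniformCauchySeqOn (partialSum a φ ω) atTop t) :
    SeriesConverges a φ ω := by
  intro u hu z hz
  obtain ⟨t, ht, hc⟩ := h z hz
  have := hc.tendstoUniformlyOn_of_tendsto (f := randomSeries a φ ω) fun w hw =>
    tendsto_randomSeries (cauchySeq_tendsto_of_complete (hc.cauchySeq hw))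
  exact ⟨t, ht, this u hu⟩

variable {Ω : Type*} [MeasurableSpace Ω] {P : Measure Ω} {a : ℕ → Ω → ℂ}

/-- Restricted to a circle, the terms are vectors of an `L²` space whose squared norms sum to the
integral of `k`, so that the series converges there almost surely; Cauchy's formula turns this into
uniform convergence on a smaller disc. -/
lemma ae_uniformCauchySeqOn_closedBall [IsProbabilityMeasure P] (ha : IsComplexGaussianSeq P a)
    {φ : ℕ → ℂ → ℂ} {k : ℂ → ℝ} {c : ℂ} {R : ℝ} (hR : 0 < R)
    (hφ : ∀ n, DifferentiableOn ℂ (φ n) (Metric.closedBall c R))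
    (hk : ContinuousOn k (Metric.closedBall c R))
    (hφk : ∀ z ∈ Metric.closedBall c R, HasSum (fun n => ‖φ n z‖ ^ 2) (k z)) :
    ∀ᵐ ω ∂P, UniformCauchySeqOn (partialSum a φ ω) atTop (Metric.closedBall c (R / 2)) := by
  have hmem : ∀ n, MemLp (fun θ => φ n (circleMap c R θ)) 2 angleMeasure := fun n =>
    memLp_comp_circleMap hR.le (hφ n).continuousOn
  set v : ℕ → Lp ℂ 2 angleMeasure := fun n => (hmem n).toLp _ with hv
  have hnorm : ∀ n, ‖v n‖ ^ 2 = ∫ θ, ‖φ n (circleMap c R θ)‖ ^ 2 ∂angleMeasure := by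
    intro n
    rw [hv, Lp.norm_toLp, (hmem n).eLpNorm_eq_integral_rpow_norm (by simp) (by simp),
      ENNReal.toReal_ofReal (by positivity), ← Real.rpow_natCast, ← Real.rpow_mul (by positivity)]
    norm_num
  have hsum : Summable fun n => ‖v n‖ ^ 2 := by
    have hkint : Integrable (fun θ => k (circleMap c R θ)) angleMeasure :=
      (hk.comp_continuous (continuous_circleMap c R) fun θ =>
        circleMap_mem_closedBall c hR.le θ).integrableOn_Ioc
    refine summable_of_sum_range_le (c := ∫ θ, k (circleMap c R θ) ∂angleMeasure)
      (fun _ => by positivity) fun N => ?_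
    simp_rw [hnorm]
    rw [← integral_finsetSum _ fun n _ => (hmem n).integrable_norm_pow (by norm_num)]
    refine integral_mono (integrable_finsetSum _ fun n _ =>
      (hmem n).integrable_norm_pow (by norm_num)) hkint fun θ => ?_
    exact sum_le_hasSum _ (fun _ _ => by positivity) (hφk _ (circleMap_mem_closedBall c hR.le θ))
  filter_upwards [ae_exists_tendsto_sum_smul ha v hsum] with ω hω
  obtain ⟨l, hl⟩ := hω
  have hbound : ∀ M N, M ≤ N → ∀ z ∈ Metric.closedBall c (R / 2),
      dist (partialSum a φ ω M z) (partialSum a φ ω N z) ≤ √(2 * Real.pi) *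
        dist (∑ n ∈ Finset.range M, a n ω • v n) (∑ n ∈ Finset.range N, a n ω • v n) := by
    intro M N hMN z hz
    rw [dist_comm, dist_eq_norm, partialSum_sub _ _ _ _ hMN, dist_comm, dist_eq_norm,
      ← Finset.sum_Ico_eq_sub _ hMN]
    refine (norm_le_eLpNorm_circleMap hR (F := fun z => ∑ n ∈ Finset.Ico M N, a n ω * φ n z)
      (DifferentiableOn.fun_sum fun n _ => (hφ n).const_mul (a n ω)) hz).trans (le_of_eq ?_)
    congr 1
    rw [Lp.norm_def]
    congr 1
    refine eLpNorm_congr_ae ?_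
    have h1 := ae_all_iff.2 fun n => (hmem n).coeFn_toLp
    have h2 := ae_all_iff.2 fun n => Lp.coeFn_smul (a n ω) (v n)
    filter_upwards [Lp.coeFn_finsetSum (Finset.Ico M N) (fun n => a n ω • v n), h1, h2]
      with θ h3 h4 h5
    rw [h3, Finset.sum_apply]
    exact Finset.sum_congr rfl fun n _ => by rw [h5, Pi.smul_apply, hv, h4, smul_eq_mul]
  refine Metric.uniformCauchySeqOn_iff.2 fun ε hε => ?_
  obtain ⟨N₀, hN₀⟩ := Metric.cauchySeq_iff.1 hl.cauchySeq (ε / √(2 * Real.pi)) (by positivity)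
  have key : ∀ M ≥ N₀, ∀ N ≥ N₀, M ≤ N → ∀ z ∈ Metric.closedBall c (R / 2),
      dist (partialSum a φ ω M z) (partialSum a φ ω N z) < ε := by
    intro M hM N hN hMN z hz
    refine (hbound M N hMN z hz).trans_lt ?_
    rw [mul_comm, ← lt_div_iff₀ (by positivity)]
    exact hN₀ M hM N hN
  refine ⟨N₀, fun M hM N hN z hz => ?_⟩
  rcases le_total M N with h | h
  · exact key M hM N hN h z hz
  · rw [dist_comm]; exact key N hN M hM h z hz

/-- A Gaussian series of analytic functions with a continuous variance converges almost surely
locally uniformly. -/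
theorem ae_seriesConverges [IsProbabilityMeasure P] (ha : IsComplexGaussianSeq P a)
    {φ : ℕ → ℂ → ℂ} {k : ℂ → ℝ} (hφ : ∀ n, DifferentiableOn ℂ (φ n) upperHalf)
    (hk : ContinuousOn k upperHalf)
    (hφk : ∀ z ∈ upperHalf, HasSum (fun n => ‖φ n z‖ ^ 2) (k z)) :
    ∀ᵐ ω ∂P, SeriesConverges a φ ω := by
  obtain ⟨t, htU, htc, ht⟩ := TopologicalSpace.countable_cover_nhdsWithin
    (f := fun z : ℂ => Metric.ball z (z.im / 2 / 2)) (s := upperHalf) fun z hz =>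
      mem_nhdsWithin_of_mem_nhds (Metric.ball_mem_nhds z (by
        have : 0 < z.im := hz
        positivity))
  have h : ∀ᵐ ω ∂P, ∀ c ∈ t,
      UniformCauchySeqOn (partialSum a φ ω) atTop (Metric.closedBall c (c.im / 2 / 2)) := by
    refine (ae_ball_iff htc).2 fun c hc => ?_
    have hc0 : 0 < c.im := htU hc
    have hsub := closedBall_subset_upperHalf (z := c) (r := c.im / 2) (by linarith)
    exact ae_uniformCauchySeqOn_closedBall ha (by positivity) (fun n => (hφ n).mono hsub)
      (hk.mono hsub) fun z hz => hφk z (hsub hz)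
  filter_upwards [h] with ω hω
  refine seriesConverges_of_uniformCauchySeqOn fun z hz => ?_
  obtain ⟨c, hc, hzc⟩ := Set.mem_iUnion₂.1 (ht hz)
  exact ⟨_, mem_nhdsWithin_of_mem_nhds (Metric.isOpen_ball.mem_nhds hzc),
    (hω c hc).mono Metric.ball_subset_closedBall⟩

end AnalyticSeries

/-! ### Measurability of the zero set of a random analytic function -/

section ZeroSet

/-- A countable dense subset of the upper half-plane. -/
noncomputable def upperHalfDense : Set ℂ := Set.range (TopologicalSpace.denseSeq ℂ) ∩ upperHalf

instance countable_upperHalfDense : Countable upperHalfDense :=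
  ((Set.countable_range _).mono Set.inter_subset_left).to_subtype

lemma upperHalf_subset_closure_upperHalfDense : upperHalf ⊆ closure upperHalfDense := by
  rw [upperHalfDense, Set.inter_comm]
  exact (TopologicalSpace.denseRange_denseSeq ℂ).open_subset_closure_inter isOpen_upperHalf

/-- Functions that are analytic and not identically zero on the upper half-plane. -/
structure NonzeroAnalytic where
  /-- The underlying function. -/
  toFun : ℂ → ℂ
  differentiableOn : DifferentiableOn ℂ toFun upperHalf
  exists_ne_zero : ∃ z ∈ upperHalf, toFun z ≠ 0

/-- The `σ`-algebra generated by the evaluations on the countable dense set. -/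
noncomputable instance measurableSpace_nonzeroAnalytic : MeasurableSpace NonzeroAnalytic :=
  MeasurableSpace.comap (fun f (z : upperHalfDense) => f.1 z) inferInstance

lemma measurable_eval_nonzeroAnalytic (z : upperHalfDense) :
    Measurable fun f : NonzeroAnalytic => f.1 z :=
  (measurable_pi_apply z).comp (comap_measurable fun (f : NonzeroAnalytic) (z : upperHalfDense) =>
    f.1 z)

/-- By continuity and compactness, whether an analytic function vanishes at all coordinates of
some point of a compact set of `k`-tuples is decided by its values on the dense set. -/
lemma measurableSet_exists_zero_tuple {k : ℕ} {T : Set (Fin k → ℂ)} (hT : IsCompact T)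
    (hTU : ∀ z ∈ T, ∀ i, z i ∈ upperHalf) :
    MeasurableSet {f : NonzeroAnalytic | ∃ z ∈ T, ∀ i, f.1 (z i) = 0} := by
  have h : {f : NonzeroAnalytic | ∃ z ∈ T, ∀ i, f.1 (z i) = 0} =
      ⋂ n : ℕ, ⋃ d : Fin k → upperHalfDense,
        ⋃ _ : ∃ z ∈ T, ∀ i, dist (d i : ℂ) (z i) < 1 / (n + 1 : ℝ),
        {f | ∀ i, ‖f.1 (d i)‖ < 1 / (n + 1 : ℝ)} := by
    ext f
    simp only [Set.mem_ofPred_eq, Set.mem_iInter, Set.mem_iUnion, exists_prop]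
    constructor
    · rintro ⟨z, hzT, hz⟩ n
      have hn : (0 : ℝ) < 1 / (n + 1 : ℝ) := by positivity
      have : ∀ i, ∃ d : upperHalfDense, dist (d : ℂ) (z i) < 1 / (n + 1 : ℝ) ∧
          ‖f.1 d‖ < 1 / (n + 1 : ℝ) := by
        intro i
        have hi := hTU z hzT i
        have hc : ContinuousAt f.1 (z i) :=
          (f.2.differentiableAt (isOpen_upperHalf.mem_nhds hi)).continuousAt
        have h1 : ∀ᶠ w in 𝓝 (z i), ‖f.1 w‖ < 1 / (n + 1 : ℝ) := by
          have := hc.norm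
          rw [ContinuousAt, hz i, norm_zero] at this
          exact this.eventually_lt_const hn
        have h2 : ∀ᶠ w in 𝓝 (z i), dist w (z i) < 1 / (n + 1 : ℝ) := Metric.ball_mem_nhds _ hn
        obtain ⟨w, ⟨hw2, hw1⟩, hwD⟩ := mem_closure_iff_nhds.1
          (upperHalf_subset_closure_upperHalfDense hi) _ (h2.and h1)
        exact ⟨⟨w, hwD⟩, hw2, hw1⟩
      choose d hd using this
      exact ⟨d, ⟨z, hzT, fun i => (hd i).1⟩, fun i => (hd i).2⟩
    · intro hf
      choose d hd hfd using hf
      choose z hzT hdz using hd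
      obtain ⟨y, hyT, σ, hσ, hlim⟩ := hT.tendsto_subseq hzT
      refine ⟨y, hyT, fun i => ?_⟩
      have h0 : Tendsto (fun n => 1 / ((σ n : ℝ) + 1)) atTop (𝓝 0) :=
        tendsto_one_div_add_atTop_nhds_zero_nat.comp hσ.tendsto_atTop
      have h1 : Tendsto (fun n => z (σ n) i) atTop (𝓝 (y i)) := (tendsto_pi_nhds.1 hlim) i
      have h2 : Tendsto (fun n => (d (σ n) i : ℂ)) atTop (𝓝 (y i)) := by
        refine (tendsto_iff_of_dist ?_).2 h1
        exact squeeze_zero (fun _ => dist_nonneg) (fun n => (hdz (σ n) i).le) h0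
      have hc : ContinuousAt f.1 (y i) :=
        (f.2.differentiableAt (isOpen_upperHalf.mem_nhds (hTU y hyT i))).continuousAt
      have h3 := (hc.tendsto.comp h2).norm
      have h4 := squeeze_zero (fun _ => norm_nonneg _) (fun n => (hfd (σ n) i).le) h0
      exact norm_eq_zero.1 (tendsto_nhds_unique h3 h4)
  rw [h]
  refine MeasurableSet.iInter fun n => MeasurableSet.iUnion fun d =>
    MeasurableSet.iUnion fun _ => ?_
  rw [Set.ofPred_forall]
  exact MeasurableSet.iInter fun i =>
    measurableSet_lt (measurable_eval_nonzeroAnalytic (d i)).norm measurable_const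

/-- A set has at least `k` elements if and only if it contains a `k`-tuple with some positive
separation; for a fixed separation this is a closed condition on the tuple. -/
lemma natCast_le_encard_iff {S : Set ℂ} {k : ℕ} : (k : ℕ∞) ≤ S.encard ↔
    ∃ m : ℕ, ∃ z : Fin k → ℂ, (∀ i, z i ∈ S) ∧
      ∀ i j, i ≠ j → 1 / (m + 1 : ℝ) ≤ dist (z i) (z j) := by
  constructor
  · intro h
    obtain ⟨t, htS, ht⟩ := Set.exists_subset_encard_eq h
    have hfin : t.Finite := Set.finite_of_encard_eq_coe ht
    obtain ⟨z⟩ : Nonempty (Fin k ≃ t) := by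
      have : Fintype t := hfin.fintype
      refine ⟨(Fintype.equivFinOfCardEq ?_).symm⟩
      rw [← Set.coe_fintypeCard t] at ht
      exact_mod_cast ht
    have hpos : ∀ i j, ∃ m : ℕ, i ≠ j → 1 / (m + 1 : ℝ) ≤ dist (z i : ℂ) (z j) := by
      intro i j
      by_cases hij : i = j
      · exact ⟨0, fun h => absurd hij h⟩
      · obtain ⟨m, hm⟩ := exists_nat_one_div_lt
          (dist_pos.2 fun h => hij (z.injective (Subtype.ext h)) : 0 < dist (z i : ℂ) (z j))
        exact ⟨m, fun _ => hm.le⟩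
    choose m hm using hpos
    refine ⟨∑ i, ∑ j, m i j, fun i => z i, fun i => htS (z i).2, fun i j hij => ?_⟩
    refine le_trans (one_div_le_one_div_of_le (by positivity) ?_) (hm i j hij)
    gcongr
    exact (Finset.single_le_sum (f := fun j => m i j) (fun _ _ => Nat.zero_le _)
      (Finset.mem_univ j)).trans (Finset.single_le_sum (f := fun i => ∑ j, m i j)
        (fun _ _ => Nat.zero_le _) (Finset.mem_univ i))
  · rintro ⟨m, z, hzS, hz⟩
    have hinj : Function.Injective z := by
      intro i j hij
      by_contra hne
      have := hz i j hne
      rw [hij, dist_self] at this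
      exact absurd this (not_le.2 (by positivity))
    calc (k : ℕ∞) = (Set.range z).encard := by
          rw [← Set.image_univ, hinj.encard_image, Set.encard_univ]; simp
      _ ≤ S.encard := Set.encard_le_encard (Set.range_subset_iff.2 hzS)

/-- The number of zeros in a compact set is measurable: it is at least `k` if and only if some
`k`-tuple in one of countably many compact sets of separated tuples consists of zeros. -/
lemma measurable_count_zeros {C : Set ℂ} (hC : IsCompact C) (hCU : C ⊆ upperHalf) :
    Measurable fun f : NonzeroAnalytic => zeroMeasure f.1 C := by
  have hset : ∀ k : ℕ, MeasurableSet
      {f : NonzeroAnalytic | (k : ℕ∞) ≤ {z | z ∈ C ∧ f.1 z = 0}.encard} := by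
    intro k
    simp_rw [natCast_le_encard_iff]
    rw [Set.ofPred_exists]
    refine MeasurableSet.iUnion fun m => ?_
    have hT : IsCompact {z : Fin k → ℂ | (∀ i, z i ∈ C) ∧
        ∀ i j, i ≠ j → 1 / (m + 1 : ℝ) ≤ dist (z i) (z j)} := by
      have h1 : IsCompact {z : Fin k → ℂ | ∀ i, z i ∈ C} := isCompact_pi_infinite fun _ => hC
      have h2 : IsClosed {z : Fin k → ℂ | ∀ i j, i ≠ j → 1 / (m + 1 : ℝ) ≤ dist (z i) (z j)} := by
        simp only [Set.ofPred_forall]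
        exact isClosed_iInter fun i => isClosed_iInter fun j => isClosed_iInter fun _ =>
          isClosed_le continuous_const (by fun_prop)
      exact h1.inter_right h2
    convert measurableSet_exists_zero_tuple hT (fun z hz i => hCU (hz.1 i)) using 1
    ext f
    simp only [Set.mem_ofPred_eq]
    exact ⟨fun ⟨z, h1, h2⟩ => ⟨z, ⟨fun i => (h1 i).1, h2⟩, fun i => (h1 i).2⟩,
      fun ⟨z, h1, h2⟩ => ⟨z, fun i => ⟨h1.1 i, h2 i⟩, h1.2⟩⟩
  have heq : ∀ f : NonzeroAnalytic, zeroMeasure f.1 C =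
      ⨆ k : ℕ, {f : NonzeroAnalytic | (k : ℕ∞) ≤ {z | z ∈ C ∧ f.1 z = 0}.encard}.indicator
        (fun _ => (k : ℝ≥0∞)) f := by
    intro f
    have hCm : MeasurableSet C := hC.measurableSet
    have hZ : C ∩ {z | z ∈ upperHalf ∧ f.1 z = 0} = {z | z ∈ C ∧ f.1 z = 0} := by
      ext z; exact ⟨fun h => ⟨h.1, h.2.2⟩, fun h => ⟨h.1, hCU h.1, h.2⟩⟩
    have hZm : MeasurableSet {z | z ∈ C ∧ f.1 z = 0} := by
      have : IsClosed (C ∩ f.1 ⁻¹' {0}) :=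
        (f.2.continuousOn.mono hCU).preimage_isClosed_of_isClosed hC.isClosed isClosed_singleton
      exact this.measurableSet
    rw [zeroMeasure, Measure.restrict_apply hCm, hZ, Measure.count_apply hZm]
    refine le_antisymm ?_ (iSup_le fun k => ?_)
    · rcases eq_or_ne {z | z ∈ C ∧ f.1 z = 0}.encard ⊤ with h | h
      · refine le_top.trans (ENNReal.iSup_natCast.ge.trans (iSup_mono fun k => ?_))
        rw [Set.indicator_of_mem (by simp [h])]
      · obtain ⟨n, hn⟩ := ENat.ne_top_iff_exists.1 h
        refine le_iSup_of_le n ?_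
        rw [Set.indicator_of_mem (by simp [hn]), ← hn]
        simp
    · by_cases hk : f ∈ {f : NonzeroAnalytic | (k : ℕ∞) ≤ {z | z ∈ C ∧ f.1 z = 0}.encard}
      · rw [Set.indicator_of_mem hk]
        exact_mod_cast ENat.toENNReal_mono hk
      · rw [Set.indicator_of_notMem hk]; exact zero_le
  simp_rw [heq]
  exact .iSup fun k => measurable_const.indicator (hset k)

/-- A compact set contains finitely many zeros, since the zeros of a nonzero analytic function are
isolated. -/
lemma zeroMeasure_lt_top_of_isCompact (f : NonzeroAnalytic) {C : Set ℂ} (hC : IsCompact C)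
    (hCU : C ⊆ upperHalf) : zeroMeasure f.1 C < ⊤ := by
  rw [zeroMeasure, Measure.restrict_apply hC.measurableSet, Measure.count_apply_lt_top]
  by_contra hinf
  obtain ⟨x, hx, hacc⟩ := (show Set.Infinite _ from hinf).exists_accPt_of_subset_isCompact hC
    Set.inter_subset_left
  have han : AnalyticOnNhd ℂ f.1 upperHalf := f.2.analyticOnNhd isOpen_upperHalf
  have hconn : IsPreconnected upperHalf := (convex_halfSpace_im_gt 0).isPreconnected
  have hfr : ∃ᶠ z in 𝓝[≠] x, f.1 z = 0 := by
    rw [accPt_iff_frequently_nhdsNE] at hacc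
    exact hacc.mono fun z hz => hz.2.2
  have h0 := han.eqOn_zero_of_preconnected_of_frequently_eq_zero hconn (hCU hx) hfr
  obtain ⟨z, hz, hfz⟩ := f.3
  exact hfz (h0 hz)

/-- An exhaustion of the upper half-plane by compact sets. -/
def upperHalfExhaustion (n : ℕ) : Set ℂ := {z | 1 / (n + 1 : ℝ) ≤ z.im} ∩ Metric.closedBall 0 n

lemma isCompact_upperHalfExhaustion (n : ℕ) : IsCompact (upperHalfExhaustion n) :=
  (isCompact_closedBall 0 (n : ℝ)).inter_left (isClosed_le continuous_const Complex.continuous_im)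

lemma upperHalfExhaustion_subset (n : ℕ) : upperHalfExhaustion n ⊆ upperHalf := fun z hz =>
  lt_of_lt_of_le (by positivity : (0 : ℝ) < 1 / (n + 1 : ℝ)) hz.1

lemma monotone_upperHalfExhaustion : Monotone upperHalfExhaustion := by
  intro m n hmn z hz
  have h : (m : ℝ) ≤ n := by exact_mod_cast hmn
  have h0 : (0 : ℝ) < m + 1 := by positivity
  exact ⟨(one_div_le_one_div_of_le h0 (by linarith)).trans hz.1,
    Metric.closedBall_subset_closedBall h hz.2⟩

lemma iUnion_upperHalfExhaustion : ⋃ n, upperHalfExhaustion n = upperHalf := by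
  refine Set.Subset.antisymm (Set.iUnion_subset upperHalfExhaustion_subset) fun z hz => ?_
  obtain ⟨m, hm⟩ := exists_nat_one_div_lt (show (0 : ℝ) < z.im from hz)
  obtain ⟨n, hn⟩ := exists_nat_ge ‖z‖
  refine Set.mem_iUnion.2 ⟨m + n, ?_, ?_⟩
  · refine le_trans (one_div_le_one_div_of_le (by positivity) ?_) hm.le
    push_cast; linarith [(Nat.cast_nonneg n : (0 : ℝ) ≤ n)]
  · rw [mem_closedBall_zero_iff]; push_cast; linarith [(Nat.cast_nonneg m : (0 : ℝ) ≤ m)]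

/-- The zero set is a measurable function of the values on the countable dense set. -/
theorem measurable_zeroMeasure : Measurable fun f : NonzeroAnalytic => zeroMeasure f.1 := by
  have hfin : ∀ n, Measurable fun f : NonzeroAnalytic =>
      (zeroMeasure f.1).restrict (upperHalfExhaustion n) := by
    intro n
    have : ∀ f : NonzeroAnalytic,
        IsFiniteMeasure ((zeroMeasure f.1).restrict (upperHalfExhaustion n)) := fun f =>
      ⟨by rw [Measure.restrict_apply_univ]
          exact zeroMeasure_lt_top_of_isCompact f (isCompact_upperHalfExhaustion n)
            (upperHalfExhaustion_subset n)⟩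
    have hclosed : ∀ A : Set ℂ, IsClosed A → Measurable fun f : NonzeroAnalytic =>
        (zeroMeasure f.1).restrict (upperHalfExhaustion n) A := by
      intro A hA
      simp_rw [Measure.restrict_apply hA.measurableSet]
      exact measurable_count_zeros ((isCompact_upperHalfExhaustion n).inter_left hA)
        (Set.inter_subset_right.trans (upperHalfExhaustion_subset n))
    -- a closed set meets the exhaustion in a compact set, and closed sets form a `π`-system
    refine Measurable.measure_of_isPiSystem (S := {A | IsClosed A}) ?_ isPiSystem_isClosed
      (fun A hA => hclosed A hA) (hclosed _ isClosed_univ)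
    rw [← borel_eq_generateFrom_isClosed]
    exact BorelSpace.measurable_eq
  refine Measure.measurable_of_measurable_coe _ fun A hA => ?_
  have heq : ∀ f : NonzeroAnalytic, zeroMeasure f.1 A =
      ⨆ n, (zeroMeasure f.1).restrict (upperHalfExhaustion n) A := by
    intro f
    have h1 : zeroMeasure f.1 A = zeroMeasure f.1 (⋃ n, A ∩ upperHalfExhaustion n) := by
      rw [← Set.inter_iUnion, iUnion_upperHalfExhaustion, zeroMeasure,
        Measure.restrict_apply hA, Measure.restrict_apply (hA.inter isOpen_upperHalf.measurableSet)]
      congr 1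
      ext z; exact ⟨fun h => ⟨⟨h.1, h.2.1⟩, h.2⟩, fun h => ⟨h.1.1, h.2⟩⟩
    rw [h1, Monotone.measure_iUnion fun m n h =>
      Set.inter_subset_inter_right _ (monotone_upperHalfExhaustion h)]
    simp_rw [Measure.restrict_apply hA]
  simp_rw [heq]
  exact .iSup fun n => (Measure.measurable_coe hA).comp (hfin n)

/-- Almost everywhere measurability for the `σ`-algebra induced by `ρ`. A measurable version of
`ρ ∘ F` need not take values in the range of `ρ`, so `F` itself is modified on a null set. -/
lemma aemeasurable_of_comp_measurable_comap {Ω A E : Type*} [MeasurableSpace Ω] {P : Measure Ω}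
    [mE : MeasurableSpace E] {ρ : A → E} {F : Ω → A} [Nonempty A]
    (h : AEMeasurable (fun ω => ρ (F ω)) P) :
    @AEMeasurable Ω A (MeasurableSpace.comap ρ mE) _ F P := by
  classical
  obtain ⟨a₀⟩ := ‹Nonempty A›
  obtain ⟨G, hGsub, hGm, hG⟩ := exists_measurable_superset_of_null h.ae_eq_mk
  refine ⟨fun ω => if ω ∈ G then a₀ else F ω, ?_, ?_⟩
  · refine measurable_comap_iff.2 ?_
    have : (ρ ∘ fun ω => if ω ∈ G then a₀ else F ω) = G.piecewise (fun _ => ρ a₀) (h.mk _) := by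
      ext ω
      by_cases hω : ω ∈ G
      · simp [hω]
      · have h1 : ρ (F ω) = h.mk _ ω := by
          by_contra hne
          exact hω (hGsub hne)
        simp [hω, h1]
    rw [this]
    exact measurable_const.piecewise hGm h.measurable_mk
  · filter_upwards [measure_eq_zero_iff_ae_notMem.1 hG] with ω hω
    simp [hω]

/-- Every event of the `σ`-algebra induced by `ρ` is an event about `ρ ∘ F`. -/
lemma identDistrib_of_comp_comap {Ω Ω' A E : Type*} [MeasurableSpace Ω] [MeasurableSpace Ω']
    {P : Measure Ω} {P' : Measure Ω'} [mE : MeasurableSpace E] {ρ : A → E} {F : Ω → A} {F' : Ω' → A}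
    [Nonempty A] (h : IdentDistrib (fun ω => ρ (F ω)) (fun ω => ρ (F' ω)) P P') :
    @IdentDistrib Ω Ω' A _ _ (MeasurableSpace.comap ρ mE) F F' P P' := by
  let : MeasurableSpace A := MeasurableSpace.comap ρ mE
  have hF := aemeasurable_of_comp_measurable_comap h.aemeasurable_fst
  have hF' := aemeasurable_of_comp_measurable_comap h.aemeasurable_snd
  refine ⟨hF, hF', Measure.ext fun B hB => ?_⟩
  rw [Measure.map_apply_of_aemeasurable hF hB, Measure.map_apply_of_aemeasurable hF' hB]
  obtain ⟨B', hB', rfl⟩ := hB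
  exact h.measure_mem_eq hB'

/-- Two random analytic functions, almost surely nonzero, whose values on the countable dense set
have the same joint law have zero sets with the same law. -/
theorem identDistrib_zeroMeasure {Ω Ω' : Type*} [MeasurableSpace Ω] [MeasurableSpace Ω']
    {P : Measure Ω} {P' : Measure Ω'} {F : Ω → ℂ → ℂ} {F' : Ω' → ℂ → ℂ}
    (hF : ∀ᵐ ω ∂P, DifferentiableOn ℂ (F ω) upperHalf ∧ ∃ z ∈ upperHalf, F ω z ≠ 0)
    (hF' : ∀ᵐ ω ∂P', DifferentiableOn ℂ (F' ω) upperHalf ∧ ∃ z ∈ upperHalf, F' ω z ≠ 0)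
    (h : IdentDistrib (fun ω (z : upperHalfDense) => F ω z) (fun ω (z : upperHalfDense) => F' ω z)
      P P') :
    IdentDistrib (fun ω => zeroMeasure (F ω)) (fun ω => zeroMeasure (F' ω)) P P' := by
  classical
  -- a default value on the exceptional null set
  let f₀ : NonzeroAnalytic := ⟨fun _ => 1, differentiableOn_const 1, Complex.I, by simp [upperHalf]⟩
  let lift (f : ℂ → ℂ) : NonzeroAnalytic :=
    if hf : DifferentiableOn ℂ f upperHalf ∧ ∃ z ∈ upperHalf, f z ≠ 0 then ⟨f, hf.1, hf.2⟩ else f₀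
  have hlift : ∀ f : ℂ → ℂ, (DifferentiableOn ℂ f upperHalf ∧ ∃ z ∈ upperHalf, f z ≠ 0) →
      (lift f).toFun = f := fun f hf => by simp only [lift, dif_pos hf]
  let ρ : NonzeroAnalytic → upperHalfDense → ℂ := fun f z => f.toFun z
  have e : (fun ω (z : upperHalfDense) => F ω z) =ᵐ[P] fun ω => ρ (lift (F ω)) := by
    filter_upwards [hF] with ω hω
    simp only [ρ, hlift _ hω]
  have e' : (fun ω (z : upperHalfDense) => F' ω z) =ᵐ[P'] fun ω => ρ (lift (F' ω)) := by
    filter_upwards [hF'] with ω hω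
    simp only [ρ, hlift _ hω]
  have h1 : IdentDistrib (fun ω => ρ (lift (F ω))) (fun ω => ρ (lift (F' ω))) P P' :=
    ((IdentDistrib.of_ae_eq h.aemeasurable_fst e).symm.trans h).trans
      (IdentDistrib.of_ae_eq h.aemeasurable_snd e')
  have : Nonempty NonzeroAnalytic := ⟨f₀⟩
  have h2 : IdentDistrib (fun ω => lift (F ω)) (fun ω => lift (F' ω)) P P' :=
    identDistrib_of_comp_comap h1
  have h3 := h2.comp measurable_zeroMeasure
  have z : (fun ω => zeroMeasure (F ω)) =ᵐ[P] fun ω => zeroMeasure (lift (F ω)).toFun := by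
    filter_upwards [hF] with ω hω
    rw [hlift _ hω]
  have z' : (fun ω => zeroMeasure (F' ω)) =ᵐ[P'] fun ω => zeroMeasure (lift (F' ω)).toFun := by
    filter_upwards [hF'] with ω hω
    rw [hlift _ hω]
  exact ((IdentDistrib.of_ae_eq h3.aemeasurable_fst z.symm).symm.trans h3).trans
    (IdentDistrib.of_ae_eq h3.aemeasurable_snd z'.symm)

end ZeroSet

/-! ### The reproducing kernel of the weighted Bergman space -/

section Bergman

/-- The real Jacobian of multiplication by `c`. -/
lemma abs_det_smul_one (c : ℂ) : |(c • (1 : ℂ →L[ℝ] ℂ)).det| = ‖c‖ ^ 2 := by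
  have : (c • (1 : ℂ →L[ℝ] ℂ)).det = Algebra.norm ℝ c := by
    rw [Algebra.norm_apply, ContinuousLinearMap.det]
    congr 1
  rw [this, Algebra.norm_complex_apply, abs_of_nonneg (Complex.normSq_nonneg c),
    Complex.normSq_eq_norm_sq]

lemma setIntegral_image_of_hasDerivAt {s : Set ℂ} (hs : MeasurableSet s) {φ φ' : ℂ → ℂ}
    (hφ : ∀ z ∈ s, HasDerivAt φ (φ' z) z) (hinj : Set.InjOn φ s) (g : ℂ → ℂ) :
    ∫ z in φ '' s, g z = ∫ z in s, (‖φ' z‖ ^ 2 : ℝ) • g (φ z) := by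
  rw [integral_image_eq_integral_abs_det_fderiv_smul volume hs
    (fun z hz => (hφ z hz).complexToReal_fderiv.hasFDerivWithinAt) hinj]
  simp_rw [abs_det_smul_one]

lemma integrableOn_image_of_hasDerivAt {s : Set ℂ} (hs : MeasurableSet s) {φ φ' : ℂ → ℂ}
    (hφ : ∀ z ∈ s, HasDerivAt φ (φ' z) z) (hinj : Set.InjOn φ s) (g : ℂ → ℂ) :
    IntegrableOn g (φ '' s) ↔ IntegrableOn (fun z => (‖φ' z‖ ^ 2 : ℝ) • g (φ z)) s := by
  rw [integrableOn_image_iff_integrableOn_abs_det_fderiv_smul volume hs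
    (fun z hz => (hφ z hz).complexToReal_fderiv.hasFDerivWithinAt) hinj]
  simp_rw [abs_det_smul_one]

section Radial

variable {α : ℝ}

lemma hasDerivAt_radial_primitive (hα : 1 < α) {r : ℝ} (hr : r ∈ Set.Ioo (0 : ℝ) 1) :
    HasDerivAt (fun r => -(1 - r ^ 2) ^ (α - 1) / (2 * (α - 1))) (r * (1 - r ^ 2) ^ (α - 2)) r := by
  have h0 : 0 < 1 - r ^ 2 := by nlinarith [hr.1, hr.2]
  have h1 : HasDerivAt (fun r : ℝ => 1 - r ^ 2) (-(2 * r)) r := by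
    simpa using (hasDerivAt_pow 2 r).const_sub 1
  have h2 := (h1.rpow_const (p := α - 1) (Or.inl h0.ne')).neg.div_const (2 * (α - 1))
  refine h2.congr_deriv ?_
  have : α - 1 ≠ 0 := by linarith
  rw [show α - 1 - 1 = α - 2 by ring]
  field_simp

lemma continuous_radial_primitive (hα : 1 < α) :
    Continuous fun r : ℝ => -(1 - r ^ 2) ^ (α - 1) / (2 * (α - 1)) := by
  have : Continuous fun r : ℝ => (1 - r ^ 2) ^ (α - 1) :=
    (by fun_prop : Continuous fun r : ℝ => 1 - r ^ 2).rpow_const fun _ => Or.inr (by linarith)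
  exact this.neg.div_const _

lemma integrableOn_radial (hα : 1 < α) :
    IntegrableOn (fun r : ℝ => r * (1 - r ^ 2) ^ (α - 2)) (Set.Ioo 0 1) := by
  refine (intervalIntegral.integrableOn_deriv_of_nonneg
    (continuous_radial_primitive hα).continuousOn
    (fun r hr => hasDerivAt_radial_primitive hα hr) fun r hr => ?_).mono_set
    Set.Ioo_subset_Ioc_self
  have h0 : 0 < 1 - r ^ 2 := by nlinarith [hr.1, hr.2]
  have := hr.1
  positivity

lemma integral_radial (hα : 1 < α) :
    ∫ r in Set.Ioo (0 : ℝ) 1, r * (1 - r ^ 2) ^ (α - 2) = 1 / (2 * (α - 1)) := by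
  rw [← integral_Ioc_eq_integral_Ioo, ← intervalIntegral.integral_of_le zero_le_one,
    intervalIntegral.integral_eq_sub_of_hasDerivAt_of_le zero_le_one
      (continuous_radial_primitive hα).continuousOn
      (fun r hr => hasDerivAt_radial_primitive hα hr)]
  · have : α - 1 ≠ 0 := by linarith
    simp [Real.zero_rpow this]
    field_simp
  · rw [intervalIntegrable_iff_integrableOn_Ioo_of_le zero_le_one]
    exact integrableOn_radial hα

lemma indicator_polarCoord_target_indicator_ball {M : Type*} [Zero M] (F : ℝ × ℝ → ℂ → M) :
    polarCoord.target.indicator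
      (fun p => (Metric.ball (0 : ℂ) 1).indicator (F p) (Complex.polarCoord.symm p)) =
    (Set.Ioo (0 : ℝ) 1 ×ˢ Set.Ioo (-Real.pi) Real.pi).indicator
      (fun p => F p (circleMap 0 p.1 p.2)) := by
  ext p
  have h1 : Complex.polarCoord.symm p = circleMap 0 p.1 p.2 := by
    rw [Complex.polarCoord_symm_apply, circleMap, zero_add, Complex.exp_mul_I]
    simp
  have h3 : p ∈ polarCoord.target ↔ 0 < p.1 ∧ p.2 ∈ Set.Ioo (-Real.pi) Real.pi := by
    rw [polarCoord_target]; rfl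
  by_cases hp : p ∈ polarCoord.target
  · rw [Set.indicator_of_mem hp, h1]
    have h4 : circleMap 0 p.1 p.2 ∈ Metric.ball (0 : ℂ) 1 ↔ p.1 < 1 := by
      simp [abs_of_pos (h3.1 hp).1]
    by_cases hp1 : p.1 < 1
    · rw [Set.indicator_of_mem (h4.2 hp1), Set.indicator_of_mem]
      exact ⟨⟨(h3.1 hp).1, hp1⟩, (h3.1 hp).2⟩
    · rw [Set.indicator_of_notMem (mt h4.1 hp1), Set.indicator_of_notMem]
      exact fun h => hp1 h.1.2
  · rw [Set.indicator_of_notMem hp, Set.indicator_of_notMem]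
    exact fun h => hp (h3.2 ⟨h.1.1, h.2⟩)

/-- Polar coordinates on the unit disc. -/
lemma setIntegral_ball_eq_polar (g : ℂ → ℂ) :
    ∫ z in Metric.ball (0 : ℂ) 1, g z =
      ∫ p in Set.Ioo (0 : ℝ) 1 ×ˢ Set.Ioo (-Real.pi) Real.pi, p.1 • g (circleMap 0 p.1 p.2) := by
  rw [← integral_indicator Metric.isOpen_ball.measurableSet,
    ← Complex.integral_comp_polarCoord_symm,
    ← integral_indicator polarCoord.open_target.measurableSet,
    ← integral_indicator (measurableSet_Ioo.prod measurableSet_Ioo),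
    ← indicator_polarCoord_target_indicator_ball fun p z => p.1 • g z]
  simp_rw [Set.indicator_const_smul_apply]

lemma setLIntegral_ball_eq_polar (g : ℂ → ℝ≥0∞) :
    ∫⁻ z in Metric.ball (0 : ℂ) 1, g z =
      ∫⁻ p in Set.Ioo (0 : ℝ) 1 ×ˢ Set.Ioo (-Real.pi) Real.pi,
        ENNReal.ofReal p.1 • g (circleMap 0 p.1 p.2) := by
  rw [← lintegral_indicator Metric.isOpen_ball.measurableSet,
    ← Complex.lintegral_comp_polarCoord_symm,
    ← lintegral_indicator polarCoord.open_target.measurableSet,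
    ← lintegral_indicator (measurableSet_Ioo.prod measurableSet_Ioo),
    ← indicator_polarCoord_target_indicator_ball fun p z => ENNReal.ofReal p.1 • g z]
  simp_rw [Set.indicator_const_smul_apply]

lemma integrableOn_ball_radial (hα : 1 < α) :
    IntegrableOn (fun z : ℂ => (1 - ‖z‖ ^ 2) ^ (α - 2)) (Metric.ball 0 1) := by
  have hmeas : Measurable fun z : ℂ => (1 - ‖z‖ ^ 2) ^ (α - 2) := by fun_prop
  refine ⟨hmeas.aestronglyMeasurable, ?_⟩
  rw [HasFiniteIntegral, setLIntegral_ball_eq_polar]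
  have h1 : Integrable (fun p : ℝ × ℝ => p.1 * (1 - p.1 ^ 2) ^ (α - 2))
      ((volume.restrict (Set.Ioo 0 1)).prod (volume.restrict (Set.Ioo (-Real.pi) Real.pi))) :=
    (integrableOn_radial hα).comp_fst _
  rw [Measure.prod_restrict] at h1
  refine lt_of_le_of_lt (le_of_eq ?_) h1.2
  refine setLIntegral_congr_fun (measurableSet_Ioo.prod measurableSet_Ioo) fun p hp => ?_
  simp only [norm_circleMap_zero, sq_abs, smul_eq_mul]
  rw [enorm_mul, Real.enorm_eq_ofReal hp.1.1.le]

/-- The mean value property with a radial weight. -/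
lemma setIntegral_ball_radial_smul (hα : 1 < α) {g : ℂ → ℂ}
    (hg : DifferentiableOn ℂ g (Metric.ball 0 1))
    (hint : IntegrableOn (fun z : ℂ => ((1 - ‖z‖ ^ 2) ^ (α - 2) : ℝ) • g z) (Metric.ball 0 1)) :
    ∫ z in Metric.ball (0 : ℂ) 1, ((1 - ‖z‖ ^ 2) ^ (α - 2) : ℝ) • g z =
      (Real.pi / (α - 1) : ℝ) • g 0 := by
  have hmem : ∀ p ∈ Set.Ioo (0 : ℝ) 1 ×ˢ Set.Ioo (-Real.pi) Real.pi,
      circleMap 0 p.1 p.2 ∈ Metric.ball (0 : ℂ) 1 := fun p hp => by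
    simp [abs_of_pos hp.1.1, hp.1.2]
  have hm : MeasurableSet (Set.Ioo (0 : ℝ) 1 ×ˢ Set.Ioo (-Real.pi) Real.pi) :=
    measurableSet_Ioo.prod measurableSet_Ioo
  have hint' : IntegrableOn (fun p : ℝ × ℝ =>
      p.1 • ((1 - ‖circleMap 0 p.1 p.2‖ ^ 2) ^ (α - 2) : ℝ) • g (circleMap 0 p.1 p.2))
      (Set.Ioo (0 : ℝ) 1 ×ˢ Set.Ioo (-Real.pi) Real.pi) := by
    refine ⟨ContinuousOn.aestronglyMeasurable ?_ hm, ?_⟩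
    · have hc : Continuous fun p : ℝ × ℝ => circleMap 0 p.1 p.2 := by
        simp only [circleMap]; fun_prop
      have hgc : ContinuousOn (fun p : ℝ × ℝ => g (circleMap 0 p.1 p.2))
          (Set.Ioo (0 : ℝ) 1 ×ˢ Set.Ioo (-Real.pi) Real.pi) :=
        hg.continuousOn.comp hc.continuousOn hmem
      have hw : ContinuousOn (fun p : ℝ × ℝ => ((1 - ‖circleMap 0 p.1 p.2‖ ^ 2) ^ (α - 2) : ℝ))
          (Set.Ioo (0 : ℝ) 1 ×ˢ Set.Ioo (-Real.pi) Real.pi) := by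
        refine ContinuousOn.rpow_const (by fun_prop) fun p hp => Or.inl ?_
        have := hmem p hp
        rw [mem_ball_zero_iff] at this
        nlinarith [norm_nonneg (circleMap 0 p.1 p.2)]
      exact continuous_fst.continuousOn.smul (hw.smul hgc)
    · have h := hint.2
      rw [HasFiniteIntegral, setLIntegral_ball_eq_polar] at h
      refine lt_of_le_of_lt (le_of_eq ?_) h
      refine setLIntegral_congr_fun hm fun p hp => ?_
      simp only [smul_eq_mul]
      rw [enorm_smul, Real.enorm_eq_ofReal hp.1.1.le]
  rw [setIntegral_ball_eq_polar, Measure.volume_eq_prod, setIntegral_prod _ hint']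
  have hinner : ∀ r ∈ Set.Ioo (0 : ℝ) 1, ∫ θ in Set.Ioo (-Real.pi) Real.pi,
      r • ((1 - ‖circleMap 0 r θ‖ ^ 2) ^ (α - 2) : ℝ) • g (circleMap 0 r θ) =
      (r * (1 - r ^ 2) ^ (α - 2)) • ((2 * Real.pi : ℝ) • g 0) := by
    intro r hr
    have hd : DiffContOnCl ℂ g (Metric.ball 0 |r|) := by
      rw [abs_of_pos hr.1]
      exact (hg.mono (Metric.closedBall_subset_ball hr.2)).diffContOnCl_ball le_rfl
    have hav := hd.circleAverage
    have hper : Function.Periodic (fun θ => g (circleMap 0 r θ)) (2 * Real.pi) := fun θ => by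
      simp only [(periodic_circleMap 0 r) θ]
    simp_rw [norm_circleMap_zero, sq_abs, smul_smul]
    rw [integral_smul, mul_smul, mul_smul, mul_smul, ← hav, Real.circleAverage,
      smul_smul (2 * Real.pi),
      mul_inv_cancel₀ Real.two_pi_pos.ne', one_smul, ← integral_Ioc_eq_integral_Ioo,
      ← intervalIntegral.integral_of_le (by linarith [Real.pi_pos])]
    have := hper.intervalIntegral_add_eq (-Real.pi) 0
    rw [zero_add, show -Real.pi + 2 * Real.pi = Real.pi by ring] at this
    rw [this]
  rw [setIntegral_congr_fun measurableSet_Ioo hinner, integral_smul_const, integral_radial hα,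
    smul_smul]
  congr 1
  have : α - 1 ≠ 0 := by linarith
  field_simp

end Radial

section Cayley

/-- The Möbius transformation of the unit disc onto the upper half-plane that maps `0` to `w`. -/
noncomputable def cayleyMap (w ζ : ℂ) : ℂ := (w - conj w * ζ) / (1 - ζ)

variable {w ζ : ℂ}

lemma one_sub_re_pos (hζ : ζ ∈ Metric.ball (0 : ℂ) 1) : 0 < (1 - ζ).re := by
  rw [mem_ball_zero_iff] at hζ
  have := (le_abs_self _).trans (Complex.abs_re_le_norm ζ)
  simp only [Complex.sub_re, Complex.one_re]
  linarith

lemma one_sub_ne_zero (hζ : ζ ∈ Metric.ball (0 : ℂ) 1) : 1 - ζ ≠ 0 := by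
  intro h
  have := one_sub_re_pos hζ
  rw [h] at this
  simp at this

lemma sub_conj_eq (w : ℂ) : w - conj w = 2 * Complex.I * w.im := by
  apply Complex.ext <;> simp; ring

lemma cayleyMap_zero (w : ℂ) : cayleyMap w 0 = w := by simp [cayleyMap]

lemma cayleyMap_sub_conj (hζ : ζ ∈ Metric.ball (0 : ℂ) 1) :
    cayleyMap w ζ - conj w = 2 * Complex.I * w.im / (1 - ζ) := by
  have := one_sub_ne_zero hζ
  rw [cayleyMap, ← sub_conj_eq]
  field_simp
  ring

lemma cayleyMap_im (hζ : ζ ∈ Metric.ball (0 : ℂ) 1) :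
    (cayleyMap w ζ).im = w.im * (1 - ‖ζ‖ ^ 2) / ‖1 - ζ‖ ^ 2 := by
  have h : cayleyMap w ζ = conj w + 2 * Complex.I * w.im / (1 - ζ) := by
    rw [← cayleyMap_sub_conj hζ]; ring
  have h0 : ‖1 - ζ‖ ^ 2 ≠ 0 := by
    have := one_sub_ne_zero hζ
    positivity
  rw [h, Complex.add_im, Complex.conj_im, Complex.div_im]
  rw [← Complex.normSq_eq_norm_sq] at h0 ⊢
  rw [← Complex.normSq_eq_norm_sq]
  simp only [Complex.mul_re, Complex.mul_im, Complex.re_ofNat, Complex.im_ofNat, Complex.I_re,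
    Complex.I_im, Complex.ofReal_re, Complex.ofReal_im, Complex.sub_re, Complex.sub_im,
    Complex.one_re, Complex.one_im]
  field_simp
  simp only [Complex.normSq_apply, Complex.sub_re, Complex.sub_im, Complex.one_re, Complex.one_im]
  ring

lemma hasDerivAt_cayleyMap (hζ : ζ ∈ Metric.ball (0 : ℂ) 1) :
    HasDerivAt (cayleyMap w) (2 * Complex.I * w.im / (1 - ζ) ^ 2) ζ := by
  have h1 : HasDerivAt (fun ζ => w - conj w * ζ) (-conj w) ζ := by
    simpa using ((hasDerivAt_id ζ).const_mul (conj w)).const_sub w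
  have h2 : HasDerivAt (fun ζ : ℂ => 1 - ζ) (-1) ζ := by
    simpa using (hasDerivAt_id ζ).const_sub 1
  refine (h1.div h2 (one_sub_ne_zero hζ)).congr_deriv ?_
  rw [← sub_conj_eq]
  congr 1
  ring

lemma cayleyMap_mem (hw : w ∈ upperHalf) (hζ : ζ ∈ Metric.ball (0 : ℂ) 1) :
    cayleyMap w ζ ∈ upperHalf := by
  have hw' : 0 < w.im := hw
  have h0 := one_sub_ne_zero hζ
  rw [mem_ball_zero_iff] at hζ
  have h1 : 0 < 1 - ‖ζ‖ ^ 2 := by nlinarith [norm_nonneg ζ]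
  simp only [upperHalf, Set.mem_ofPred_eq]
  rw [cayleyMap_im (by simpa using hζ)]
  positivity

lemma sub_conj_ne_zero {z : ℂ} (hw : w ∈ upperHalf) (hz : z ∈ upperHalf) : z - conj w ≠ 0 := by
  intro h
  have h1 := congrArg Complex.im h
  have hw' : 0 < w.im := hw
  have hz' : 0 < z.im := hz
  simp at h1
  linarith

lemma injOn_cayleyMap (hw : w ∈ upperHalf) : Set.InjOn (cayleyMap w) (Metric.ball 0 1) := by
  intro ζ hζ ξ hξ h
  have h1 := cayleyMap_sub_conj (w := w) hζ
  rw [h, cayleyMap_sub_conj hξ] at h1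
  have hw' : (w.im : ℂ) ≠ 0 := by exact_mod_cast (show 0 < w.im from hw).ne'
  have h2 := one_sub_ne_zero hζ
  have h3 := one_sub_ne_zero hξ
  have hI := Complex.I_ne_zero
  field_simp at h1
  linear_combination -h1

lemma image_cayleyMap (hw : w ∈ upperHalf) : cayleyMap w '' Metric.ball 0 1 = upperHalf := by
  refine Set.Subset.antisymm (Set.image_subset_iff.2 fun ζ hζ => cayleyMap_mem hw hζ) fun z hz => ?_
  have h0 := sub_conj_ne_zero hw hz
  have hw' : 0 < w.im := hw
  have hz' : 0 < z.im := hz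
  refine ⟨(z - w) / (z - conj w), ?_, ?_⟩
  · rw [mem_ball_zero_iff, norm_div, div_lt_one (norm_pos_iff.2 h0)]
    refine lt_of_pow_lt_pow_left₀ 2 (norm_nonneg _) ?_
    rw [← Complex.normSq_eq_norm_sq, ← Complex.normSq_eq_norm_sq, Complex.normSq_apply,
      Complex.normSq_apply]
    simp
    nlinarith [mul_pos hw' hz']
  · have h1 : 1 - (z - w) / (z - conj w) = (w - conj w) / (z - conj w) := by
      field_simp; ring
    have h2 : w - conj w ≠ 0 := sub_conj_ne_zero hw hw
    rw [cayleyMap, h1]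
    field_simp
    ring

end Cayley

/-- The reproducing kernel of `A²_α` at the point `w`. -/
noncomputable def bergmanKernel (α : ℝ) (w z : ℂ) : ℂ :=
  ((α - 1) / 4 : ℝ) * ((z - conj w) / (2 * Complex.I)) ^ (-(α : ℂ))

lemma re_sub_conj_div_pos {w z : ℂ} (hw : w ∈ upperHalf) (hz : z ∈ upperHalf) :
    0 < ((z - conj w) / (2 * Complex.I)).re := by
  have hw' : 0 < w.im := hw
  have hz' : 0 < z.im := hz
  rw [Complex.div_re]
  simp
  positivity

lemma differentiableOn_bergmanKernel (α : ℝ) {w : ℂ} (hw : w ∈ upperHalf) :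
    DifferentiableOn ℂ (bergmanKernel α w) upperHalf := by
  intro z hz
  refine DifferentiableAt.differentiableWithinAt (DifferentiableAt.const_mul ?_ _)
  exact DifferentiableAt.cpow_const (by fun_prop) (Or.inl (re_sub_conj_div_pos hw hz))

lemma ofReal_mul_cpow {r : ℝ} (hr : 0 < r) {z : ℂ} (hz : z ≠ 0) (s : ℂ) :
    ((r : ℂ) * z) ^ s = (r : ℂ) ^ s * z ^ s := by
  have hr' : (r : ℂ) ≠ 0 := by exact_mod_cast hr.ne'
  rw [Complex.cpow_def_of_ne_zero (mul_ne_zero hr' hz), Complex.cpow_def_of_ne_zero hr',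
    Complex.cpow_def_of_ne_zero hz, Complex.log_ofReal_mul hr hz, ← Complex.exp_add,
    Complex.ofReal_log hr.le]
  ring_nf

/-- In the coordinate of the disc centred at `w`, the kernel at `w` is a power of `1 - ζ`. -/
lemma bergmanKernel_cayleyMap (α : ℝ) {w ζ : ℂ} (hw : w ∈ upperHalf)
    (hζ : ζ ∈ Metric.ball (0 : ℂ) 1) :
    bergmanKernel α w (cayleyMap w ζ) =
      ((α - 1) / 4 * w.im ^ (-α) : ℝ) * (1 - ζ) ^ (α : ℂ) := by
  have hw' : 0 < w.im := hw
  have h0 := one_sub_ne_zero hζ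
  have h1 := one_sub_re_pos hζ
  have harg : (1 - ζ).arg ≠ Real.pi := fun h => by
    have := Complex.arg_eq_pi_iff.1 h
    linarith [this.1]
  have hI := Complex.I_ne_zero
  rw [bergmanKernel, cayleyMap_sub_conj hζ]
  have h2 : 2 * Complex.I * w.im / (1 - ζ) / (2 * Complex.I) = (w.im : ℂ) * (1 - ζ)⁻¹ := by
    field_simp
  rw [h2, ofReal_mul_cpow hw' (inv_ne_zero h0), Complex.inv_cpow _ _ harg, ← Complex.cpow_neg,
    neg_neg,
    Complex.ofReal_mul, Complex.ofReal_cpow hw'.le, mul_assoc]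
  push_cast
  rfl

lemma integrable_bergmanMeasure_iff {α : ℝ} (g : ℂ → ℂ) : Integrable g (bergmanMeasure α) ↔
    IntegrableOn (fun z => (z.im ^ (α - 2) / Real.pi) • g z) upperHalf := by
  rw [bergmanMeasure, integrable_withDensity_iff_integrable_smul' (by fun_prop) (by simp),
    IntegrableOn]
  refine integrable_congr ?_
  filter_upwards [ae_restrict_mem isOpen_upperHalf.measurableSet] with z hz
  have : 0 < z.im := hz
  rw [ENNReal.toReal_ofReal (by positivity)]

lemma integral_bergmanMeasure {α : ℝ} (g : ℂ → ℂ) : ∫ z, g z ∂(bergmanMeasure α) =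
    ∫ z in upperHalf, (z.im ^ (α - 2) / Real.pi) • g z := by
  rw [bergmanMeasure, integral_withDensity_eq_integral_toReal_smul (by fun_prop) (by simp)]
  refine setIntegral_congr_fun isOpen_upperHalf.measurableSet fun z hz => ?_
  have : 0 < z.im := hz
  rw [ENNReal.toReal_ofReal (by positivity)]

lemma aestronglyMeasurable_bergmanMeasure {α : ℝ} {g : ℂ → ℂ} (hg : ContinuousOn g upperHalf) :
    AEStronglyMeasurable g (bergmanMeasure α) :=
  (hg.aestronglyMeasurable isOpen_upperHalf.measurableSet).mono_ac
    (withDensity_absolutelyContinuous _ _)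

/-- The Bergman weight in the coordinate of the disc. -/
lemma cayleyMap_weight {α : ℝ} {w ζ : ℂ} (hw : w ∈ upperHalf) (hζ : ζ ∈ Metric.ball (0 : ℂ) 1) :
    ‖2 * Complex.I * w.im / (1 - ζ) ^ 2‖ ^ 2 * ((cayleyMap w ζ).im ^ (α - 2) / Real.pi) =
      4 / Real.pi * w.im ^ α * (1 - ‖ζ‖ ^ 2) ^ (α - 2) * ‖1 - ζ‖ ^ (-(2 * α)) := by
  have hw' : 0 < w.im := hw
  have h0 : 0 < ‖1 - ζ‖ := norm_pos_iff.2 (one_sub_ne_zero hζ)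
  have h1 : 0 < 1 - ‖ζ‖ ^ 2 := by
    rw [mem_ball_zero_iff] at hζ
    nlinarith [norm_nonneg ζ]
  rw [cayleyMap_im hζ, Real.div_rpow (by positivity) (by positivity),
    Real.mul_rpow hw'.le h1.le]
  simp only [norm_div, norm_mul, norm_pow, Complex.norm_I, Complex.norm_real, Complex.norm_ofNat,
    Real.norm_eq_abs, abs_of_pos hw', mul_one]
  have e1 : w.im ^ α = w.im ^ (α - 2) * w.im ^ 2 := by
    rw [← Real.rpow_natCast, ← Real.rpow_add hw']; norm_num
  have e2 : ‖1 - ζ‖ ^ (-(2 * α)) = ((‖1 - ζ‖ ^ 2) ^ (α - 2))⁻¹ * (‖1 - ζ‖ ^ 4)⁻¹ := by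
    rw [← Real.rpow_natCast, ← Real.rpow_natCast, ← Real.rpow_mul h0.le, ← Real.rpow_neg h0.le,
      ← Real.rpow_neg h0.le, ← Real.rpow_add h0]
    congr 1; push_cast; ring
  rw [e1, e2]
  field_simp
  ring

lemma integrable_bergmanMeasure_iff_ball {α : ℝ} {w : ℂ} (hw : w ∈ upperHalf) (g : ℂ → ℂ) :
    Integrable g (bergmanMeasure α) ↔ IntegrableOn (fun ζ => (4 / Real.pi * w.im ^ α *
      (1 - ‖ζ‖ ^ 2) ^ (α - 2) * ‖1 - ζ‖ ^ (-(2 * α))) • g (cayleyMap w ζ)) (Metric.ball 0 1) := by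
  rw [integrable_bergmanMeasure_iff, ← image_cayleyMap hw,
    integrableOn_image_of_hasDerivAt Metric.isOpen_ball.measurableSet
      (fun ζ hζ => hasDerivAt_cayleyMap hζ) (injOn_cayleyMap hw)]
  refine integrableOn_congr_fun (fun ζ hζ => ?_) Metric.isOpen_ball.measurableSet
  rw [smul_smul, cayleyMap_weight hw hζ]

lemma integral_bergmanMeasure_eq_ball {α : ℝ} {w : ℂ} (hw : w ∈ upperHalf) (g : ℂ → ℂ) :
    ∫ z, g z ∂(bergmanMeasure α) = ∫ ζ in Metric.ball (0 : ℂ) 1, (4 / Real.pi * w.im ^ α *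
      (1 - ‖ζ‖ ^ 2) ^ (α - 2) * ‖1 - ζ‖ ^ (-(2 * α))) • g (cayleyMap w ζ) := by
  rw [integral_bergmanMeasure, ← image_cayleyMap hw,
    setIntegral_image_of_hasDerivAt Metric.isOpen_ball.measurableSet
      (fun ζ hζ => hasDerivAt_cayleyMap hζ) (injOn_cayleyMap hw)]
  refine setIntegral_congr_fun Metric.isOpen_ball.measurableSet fun ζ hζ => ?_
  rw [smul_smul, cayleyMap_weight hw hζ]

lemma memLp_bergmanKernel {α : ℝ} (hα : 1 < α) {w : ℂ} (hw : w ∈ upperHalf) :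
    MemLp (bergmanKernel α w) 2 (bergmanMeasure α) := by
  have hw' : 0 < w.im := hw
  rw [memLp_two_iff_integrable_sq_norm (aestronglyMeasurable_bergmanMeasure
    (differentiableOn_bergmanKernel α hw).continuousOn)]
  suffices hc : Integrable (fun z => ((‖bergmanKernel α w z‖ ^ 2 : ℝ) : ℂ)) (bergmanMeasure α) by
    simpa only [RCLike.re_eq_complex_re, Complex.ofReal_re] using hc.re
  rw [integrable_bergmanMeasure_iff_ball hw]
  have h := ((integrableOn_ball_radial hα).const_mul
    (4 / Real.pi * w.im ^ α * ((α - 1) / 4 * w.im ^ (-α)) ^ 2)).ofReal (𝕜 := ℂ)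
  refine (integrableOn_congr_fun (fun ζ hζ => ?_) Metric.isOpen_ball.measurableSet).1 h
  have h0 : 0 < ‖1 - ζ‖ := norm_pos_iff.2 (one_sub_ne_zero hζ)
  have h1 : ‖bergmanKernel α w (cayleyMap w ζ)‖ ^ 2 =
      ((α - 1) / 4 * w.im ^ (-α)) ^ 2 * ‖1 - ζ‖ ^ (2 * α) := by
    rw [bergmanKernel_cayleyMap α hw hζ, norm_mul, mul_pow, Complex.norm_real, Real.norm_eq_abs,
      sq_abs, Complex.norm_cpow_real, mul_comm 2 α, Real.rpow_mul h0.le]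
    norm_num
  simp only [RCLike.ofReal_eq_complex_ofReal] at h1 ⊢
  rw [h1, Complex.real_smul, ← Complex.ofReal_mul, Real.rpow_neg h0.le]
  have h2 : ‖1 - ζ‖ ^ (2 * α) ≠ 0 := by positivity
  congr 1
  field_simp

/-- The reproducing property: in the coordinate of the disc centred at `w` the integrand is an
analytic function with a radial weight, and the mean value property applies. -/
theorem integral_conj_bergmanKernel_mul {α : ℝ} (hα : 1 < α) {w : ℂ} (hw : w ∈ upperHalf)
    {f : ℂ → ℂ} (hf : DifferentiableOn ℂ f upperHalf) (hfL : MemLp f 2 (bergmanMeasure α)) :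
    ∫ z, conj (bergmanKernel α w z) * f z ∂(bergmanMeasure α) = f w := by
  have hw' : 0 < w.im := hw
  have hint : Integrable (fun z => conj (bergmanKernel α w z) * f z) (bergmanMeasure α) :=
    (memLp_bergmanKernel hα hw).star.integrable_mul hfL
  set G : ℂ → ℂ := fun ζ => ((α - 1) / Real.pi : ℝ) * ((1 - ζ) ^ (-(α : ℂ)) * f (cayleyMap w ζ))
    with hG
  have hGd : DifferentiableOn ℂ G (Metric.ball 0 1) := by
    intro ζ hζ
    refine DifferentiableWithinAt.const_mul (DifferentiableWithinAt.mul ?_ ?_) _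
    · exact (DifferentiableAt.cpow_const (by fun_prop)
        (Or.inl (one_sub_re_pos hζ))).differentiableWithinAt
    · exact ((hf.differentiableAt (isOpen_upperHalf.mem_nhds (cayleyMap_mem hw hζ))).comp ζ
        (hasDerivAt_cayleyMap hζ).differentiableAt).differentiableWithinAt
  have hpt : ∀ ζ ∈ Metric.ball (0 : ℂ) 1, (4 / Real.pi * w.im ^ α *
      (1 - ‖ζ‖ ^ 2) ^ (α - 2) * ‖1 - ζ‖ ^ (-(2 * α))) •
        (conj (bergmanKernel α w (cayleyMap w ζ)) * f (cayleyMap w ζ)) =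
      ((1 - ‖ζ‖ ^ 2) ^ (α - 2) : ℝ) • G ζ := by
    intro ζ hζ
    have h0 : 0 < ‖1 - ζ‖ := norm_pos_iff.2 (one_sub_ne_zero hζ)
    -- the antianalytic factor of the kernel cancels against the weight
    have h1 : ((‖1 - ζ‖ ^ (-(2 * α)) : ℝ) : ℂ) * conj ((1 - ζ) ^ (α : ℂ)) =
        (1 - ζ) ^ (-(α : ℂ)) := by
      have h2 : (1 - ζ) ^ (α : ℂ) ≠ 0 := by
        rw [Complex.cpow_ne_zero_iff]; exact Or.inl (one_sub_ne_zero hζ)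
      have h3 : (1 - ζ) ^ (α : ℂ) * conj ((1 - ζ) ^ (α : ℂ)) = ((‖1 - ζ‖ ^ (2 * α) : ℝ) : ℂ) := by
        rw [Complex.mul_conj, Complex.normSq_eq_norm_sq, Complex.norm_cpow_real, mul_comm 2 α,
          Real.rpow_mul h0.le]
        norm_num
      rw [Complex.cpow_neg, Real.rpow_neg h0.le]
      have h4 : ((‖1 - ζ‖ ^ (2 * α) : ℝ) : ℂ) ≠ 0 := by
        exact_mod_cast (by positivity : ‖1 - ζ‖ ^ (2 * α) ≠ 0)
      rw [Complex.ofReal_inv]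
      field_simp
      rw [mul_comm, ← h3]
      ring
    have h5 : w.im ^ α * w.im ^ (-α) = 1 := by
      rw [← Real.rpow_add hw']; simp
    rw [bergmanKernel_cayleyMap α hw hζ, map_mul, Complex.conj_ofReal, hG]
    simp only [Complex.real_smul]
    rw [← h1]
    have h6 : ((w.im ^ α : ℝ) : ℂ) * ((w.im ^ (-α) : ℝ) : ℂ) = 1 := by
      rw [← Complex.ofReal_mul, h5, Complex.ofReal_one]
    push_cast at h6 ⊢
    linear_combination ((α - 1) / Real.pi * ((1 - ‖ζ‖ ^ 2) ^ (α - 2) : ℝ) *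
      (‖1 - ζ‖ ^ (-(2 * α)) : ℝ) * conj ((1 - ζ) ^ (α : ℂ)) * f (cayleyMap w ζ)) * h6
  rw [integral_bergmanMeasure_eq_ball hw, setIntegral_congr_fun
    Metric.isOpen_ball.measurableSet hpt,
    setIntegral_ball_radial_smul hα hGd]
  · have h1 : α - 1 ≠ 0 := by linarith
    have h2 := Real.pi_ne_zero
    rw [hG]
    simp only [cayleyMap_zero, sub_zero, Complex.one_cpow, one_mul]
    rw [Complex.real_smul, ← mul_assoc, ← Complex.ofReal_mul]
    have : Real.pi / (α - 1) * ((α - 1) / Real.pi) = 1 := by field_simp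
    rw [this, Complex.ofReal_one, one_mul]
  · rw [integrable_bergmanMeasure_iff_ball hw] at hint
    exact (integrableOn_congr_fun hpt Metric.isOpen_ball.measurableSet).1 hint

end Bergman

open scoped SchwartzMap

/-! ### The Fourier transform on `L¹ ∩ L²` -/

lemma continuous_neg_innerₗ : Continuous fun p : ℝ × ℝ => (-innerₗ ℝ) p.1 p.2 := by
  change Continuous fun p : ℝ × ℝ => -(inner ℝ p.1 p.2)
  fun_prop

/-- The multiplication formula. -/
lemma integral_fourierInv_mul {f g : ℝ → ℂ} (hf : Integrable f) (hg : Integrable g) :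
    ∫ x, 𝓕⁻ g x • f x = ∫ x, g x • 𝓕⁻ f x := by
  have := VectorFourier.integral_fourierIntegral_smul_eq_flip (L := -innerₗ ℝ)
    (μ := volume) (ν := volume)
    Real.continuous_fourierChar continuous_neg_innerₗ hg hf
  have h2 : (-innerₗ ℝ).flip = -innerₗ ℝ := by
    ext; simp
  rw [h2] at this
  exact this

/-- The multiplication formula for an `L²` function and a Schwartz function. -/
lemma integral_schwartz_smul_fourierInv (F : L2R) (φ : 𝓢(ℝ, ℂ)) :
    ∫ x, φ x • (𝓕⁻ F : L2R) x = ∫ x, 𝓕⁻ (φ : ℝ → ℂ) x • F x := by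
  rw [← Lp.toTemperedDistribution_apply, ← Lp.fourierInv_toTemperedDistribution_eq,
    TemperedDistribution.fourierInv_apply, Lp.toTemperedDistribution_apply,
    SchwartzMap.fourierInv_coe]

lemma ae_eq_of_integral_schwartz_smul {f g : ℝ → ℂ} (hf : LocallyIntegrable f)
    (hg : LocallyIntegrable g)
    (h : ∀ φ : 𝓢(ℝ, ℂ), ∫ x, φ x • f x = ∫ x, φ x • g x) : f =ᵐ[volume] g := by
  refine ae_eq_of_integral_contDiff_smul_eq hf hg fun φ h1 h2 => ?_
  have hg₁ : HasCompactSupport (Complex.ofRealCLM ∘ φ) := h2.comp_left rfl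
  have hg₂ : ContDiff ℝ _ (Complex.ofRealCLM ∘ φ) := Complex.ofRealCLM.contDiff.comp h1
  simpa using h (hg₁.toSchwartzMap hg₂)

/-- On `L¹ ∩ L²` the inverse Fourier transform of `L²` is given by the Fourier integral. -/
lemma fourierInv_toLp_ae_eq {f : ℝ → ℂ} (hf : Integrable f) (hf2 : MemLp f 2) :
    (𝓕⁻ (hf2.toLp f) : L2R) =ᵐ[volume] 𝓕⁻ f := by
  have hc : Continuous (𝓕⁻ f) := VectorFourier.fourierIntegral_continuous (L := -innerₗ ℝ)
    Real.continuous_fourierChar continuous_neg_innerₗ hf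
  refine ae_eq_of_integral_schwartz_smul ((Lp.memLp _).locallyIntegrable (by norm_num))
    hc.locallyIntegrable fun φ => ?_
  rw [integral_schwartz_smul_fourierInv, ← integral_fourierInv_mul hf φ.integrable]
  refine integral_congr_ae ?_
  filter_upwards [hf2.coeFn_toLp] with x hx
  rw [hx]

/-- Uniqueness for the Fourier transform of integrable functions. -/
lemma ae_eq_zero_of_fourierInv_eq_zero {f : ℝ → ℂ} (hf : Integrable f) (h : ∀ x, 𝓕⁻ f x = 0) :
    f =ᵐ[volume] 0 := by
  refine ae_eq_of_integral_schwartz_smul hf.locallyIntegrable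
    (locallyIntegrable_const 0) fun φ => ?_
  have h1 : (φ : ℝ → ℂ) = 𝓕⁻ (((𝓕 φ : 𝓢(ℝ, ℂ)) : ℝ → ℂ)) := by
    rw [← SchwartzMap.fourierInv_coe, FourierTransform.fourierInv_fourier_eq]
  rw [h1, integral_fourierInv_mul hf (SchwartzMap.integrable _)]
  simp [h]

/-! ### The Gamma integral with a complex rate -/

lemma integrableOn_rpow_mul_exp_neg_mul {s b : ℝ} (hs : -1 < s) (hb : 0 < b) :
    IntegrableOn (fun u : ℝ => u ^ s * Real.exp (-b * u)) (Set.Ioi 0) := by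
  simpa using integrableOn_rpow_mul_exp_neg_mul_rpow hs one_pos hb

lemma measurable_rpow_mul_cexp (s : ℝ) (r : ℂ) :
    Measurable fun u : ℝ => ((u ^ s : ℝ) : ℂ) * Complex.exp (-(r * u)) := by
  fun_prop

lemma norm_rpow_mul_cexp {s u : ℝ} (hu : 0 < u) (r : ℂ) :
    ‖((u ^ s : ℝ) : ℂ) * Complex.exp (-(r * u))‖ = u ^ s * Real.exp (-r.re * u) := by
  rw [norm_mul, Complex.norm_real, Complex.norm_exp, Real.norm_of_nonneg (by positivity)]
  simp

lemma integrableOn_rpow_mul_cexp {s : ℝ} (hs : -1 < s) {r : ℂ} (hr : 0 < r.re) :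
    IntegrableOn (fun u : ℝ => ((u ^ s : ℝ) : ℂ) * Complex.exp (-(r * u))) (Set.Ioi 0) := by
  refine (integrableOn_rpow_mul_exp_neg_mul hs hr).mono'
    (measurable_rpow_mul_cexp s r).aestronglyMeasurable ?_
  filter_upwards [ae_restrict_mem measurableSet_Ioi] with u hu
  exact (norm_rpow_mul_cexp hu r).le

lemma differentiableOn_integral_rpow_mul_cexp {s : ℝ} (hs : -1 < s) :
    DifferentiableOn ℂ (fun r : ℂ => ∫ u in Set.Ioi (0 : ℝ),
      ((u ^ s : ℝ) : ℂ) * Complex.exp (-(r * u))) {r | 0 < r.re} := by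
  intro r hr
  replace hr : 0 < r.re := hr
  have hopen : IsOpen {x : ℂ | r.re / 2 < x.re} := isOpen_lt continuous_const Complex.continuous_re
  refine (hasDerivAt_integral_of_dominated_loc_of_deriv_le
    (F := fun (x : ℂ) (u : ℝ) => ((u ^ s : ℝ) : ℂ) * Complex.exp (-(x * u)))
    (F' := fun (x : ℂ) (u : ℝ) => ((u ^ s : ℝ) : ℂ) * (Complex.exp (-(x * u)) * -(1 * u)))
    (bound := fun u => u ^ (s + 1) * Real.exp (-(r.re / 2) * u))
    (hopen.mem_nhds (by simp [hr])) ?_ (integrableOn_rpow_mul_cexp hs hr) ?_ ?_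
    (integrableOn_rpow_mul_exp_neg_mul (by linarith) (by linarith))
    ?_).2.differentiableAt.differentiableWithinAt
  · exact .of_forall fun x => (measurable_rpow_mul_cexp s x).aestronglyMeasurable
  · exact (by fun_prop : Measurable _).aestronglyMeasurable
  · filter_upwards [ae_restrict_mem measurableSet_Ioi] with u hu x hx
    replace hu : 0 < u := hu
    replace hx : r.re / 2 < x.re := hx
    rw [← mul_assoc, norm_mul, norm_rpow_mul_cexp hu, Real.rpow_add hu, Real.rpow_one, norm_neg,
      one_mul, Complex.norm_real, Real.norm_of_nonneg hu.le]
    have : Real.exp (-x.re * u) ≤ Real.exp (-(r.re / 2) * u) := by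
      gcongr
    calc _ = u ^ s * u * Real.exp (-x.re * u) := by ring
      _ ≤ _ := by gcongr
  · refine .of_forall fun u x _ => ?_
    exact ((((hasDerivAt_id x).mul_const (u : ℂ)).neg).cexp).const_mul _

/-- `∫₀^∞ u ^ (α - 1) e ^ (-r u) du = Γ(α) r ^ (-α)` on the right half-plane, by analytic
continuation from real `r`. -/
lemma integral_rpow_mul_cexp {α : ℝ} (hα : 0 < α) {r : ℂ} (hr : 0 < r.re) :
    ∫ u in Set.Ioi (0 : ℝ), ((u ^ (α - 1) : ℝ) : ℂ) * Complex.exp (-(r * u)) =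
      Real.Gamma α * r ^ (-(α : ℂ)) := by
  have hopen : IsOpen {x : ℂ | 0 < x.re} := isOpen_lt continuous_const Complex.continuous_re
  have hG : DifferentiableOn ℂ (fun r : ℂ => (Real.Gamma α : ℂ) * r ^ (-(α : ℂ))) {r | 0 < r.re} :=
    fun x hx => ((differentiableAt_id.cpow_const (Or.inl hx)).const_mul _).differentiableWithinAt
  have hconv : Convex ℝ {x : ℂ | 0 < x.re} := convex_halfSpace_re_gt 0
  refine ((differentiableOn_integral_rpow_mul_cexp (by linarith)).analyticOnNhd
    hopen).eqOn_of_preconnected_of_frequently_eq (hG.analyticOnNhd hopen) hconv.isPreconnected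
    (z₀ := 1) (by simp) ?_ hr
  have hreal : ∀ x : ℝ, 0 < x → ∫ u in Set.Ioi (0 : ℝ),
      ((u ^ (α - 1) : ℝ) : ℂ) * Complex.exp (-((x : ℂ) * u)) =
        Real.Gamma α * (x : ℂ) ^ (-(α : ℂ)) := by
    intro x hx
    have h1 := Complex.integral_cpow_mul_exp_neg_mul_Ioi (a := α) (by simpa using hα) hx
    rw [Complex.Gamma_ofReal, one_div, Complex.inv_cpow _ _ (by
      rw [Complex.arg_ofReal_of_nonneg hx.le]; exact Real.pi_pos.ne), ← Complex.cpow_neg,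
      mul_comm] at h1
    rw [← h1]
    refine setIntegral_congr_fun measurableSet_Ioi fun u hu => ?_
    rw [Complex.ofReal_cpow (le_of_lt hu)]
    push_cast
    rfl
  have ht : Tendsto (fun t : ℝ => (t : ℂ)) (𝓝[≠] 1) (𝓝[≠] (1 : ℂ)) := by
    refine tendsto_nhdsWithin_of_tendsto_nhds_of_eventually_within _ ?_ ?_
    · exact (Complex.continuous_ofReal.tendsto' 1 1 (by simp)).mono_left nhdsWithin_le_nhds
    · filter_upwards [self_mem_nhdsWithin] with t ht
      simpa using ht
  refine ht.frequently (Eventually.frequently ?_)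
  filter_upwards [nhdsWithin_le_nhds (lt_mem_nhds (zero_lt_one' ℝ))] with t h
  exact hreal t h

/-! ### The wavelet atoms as an analytic family in the Hardy space -/

/-- The constant `c_α` with `c_α² = (α - 1) 2 ^ α / (8 π Γ(α))`. -/
noncomputable def waveletConst (α : ℝ) : ℝ :=
  √((α - 1) * 2 ^ α / (8 * Real.pi * Real.Gamma α))

/-- The Fourier transform, in the normalization `∫ f(t) e ^ (-2π i t u) dt`, of
`t ↦ c_α y ^ (-α/2) (T_x D_y ψ_α)(t)` at `w = x + iy`. -/
noncomputable def atomHat (α : ℝ) (w : ℂ) (u : ℝ) : ℂ :=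
  (Set.Ioi (0 : ℝ)).indicator (fun u => ((2 * Real.pi * waveletConst α *
    (2 * Real.pi) ^ ((α - 1) / 2) : ℝ) : ℂ) * (((u ^ ((α - 1) / 2) : ℝ) : ℂ) *
      Complex.exp (-(2 * Real.pi * Complex.I * conj w * u)))) u

lemma waveletConst_pos {α : ℝ} (hα : 1 < α) : 0 < waveletConst α := by
  have := Real.Gamma_pos_of_pos (by linarith : 0 < α)
  have : 0 < α - 1 := by linarith
  unfold waveletConst
  positivity

lemma two_pi_I_mul_conj_re (w : ℂ) :
    (2 * Real.pi * Complex.I * conj w).re = 2 * Real.pi * w.im := by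
  simp

lemma measurable_atomHat (α : ℝ) (w : ℂ) : Measurable (atomHat α w) := by
  unfold atomHat
  refine Measurable.indicator ?_ measurableSet_Ioi
  fun_prop

lemma integrable_atomHat {α : ℝ} (hα : 1 < α) {w : ℂ} (hw : w ∈ upperHalf) :
    Integrable (atomHat α w) := by
  replace hw : 0 < w.im := hw
  refine (integrable_indicator_iff measurableSet_Ioi).2 (Integrable.const_mul ?_ _)
  exact integrableOn_rpow_mul_cexp (by linarith) (by rw [two_pi_I_mul_conj_re]; positivity)

/-- The product of two atoms on the Fourier side, in the form of a Gamma integrand. -/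
lemma conj_atomHat_mul (α : ℝ) (z w : ℂ) (u : ℝ) :
    conj (atomHat α z u) * atomHat α w u = (Set.Ioi (0 : ℝ)).indicator (fun u =>
      (((2 * Real.pi * waveletConst α) ^ 2 * (2 * Real.pi) ^ (α - 1) : ℝ) : ℂ) *
        (((u ^ (α - 1) : ℝ) : ℂ) *
          Complex.exp (-(4 * Real.pi * ((z - conj w) / (2 * Complex.I)) * u)))) u := by
  unfold atomHat
  by_cases hu : u ∈ Set.Ioi (0 : ℝ)
  · simp only [Set.indicator_of_mem hu]
    have hp : ∀ x : ℝ, 0 < x → ((x ^ (α - 1) : ℝ) : ℂ) =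
        ((x ^ ((α - 1) / 2) : ℝ) : ℂ) * ((x ^ ((α - 1) / 2) : ℝ) : ℂ) := by
      intro x hx
      rw [← Complex.ofReal_mul, ← Real.rpow_add hx]
      ring_nf
    have he : Complex.exp (-(4 * Real.pi * ((z - conj w) / (2 * Complex.I)) * u)) =
        conj (Complex.exp (-(2 * Real.pi * Complex.I * conj z * u))) *
          Complex.exp (-(2 * Real.pi * Complex.I * conj w * u)) := by
      rw [← Complex.exp_conj, ← Complex.exp_add]
      congr 1
      simp only [map_neg, map_mul, Complex.conj_ofReal, Complex.conj_I, Complex.conj_conj,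
        map_ofNat]
      field_simp
      linear_combination (-(4 * (u : ℂ) * (z - conj w))) * Complex.I_sq
    rw [he, Complex.ofReal_mul _ ((2 * Real.pi) ^ (α - 1)), hp u hu, hp _ (by positivity)]
    simp only [map_mul, Complex.conj_ofReal]
    push_cast
    ring
  · simp [Set.indicator_of_notMem hu]

lemma re_four_pi_mul_pos {z w : ℂ} (hz : z ∈ upperHalf) (hw : w ∈ upperHalf) :
    0 < (4 * Real.pi * ((z - conj w) / (2 * Complex.I))).re := by
  have h := re_sub_conj_div_pos hw hz
  have h4 : (4 * Real.pi : ℂ) = ((4 * Real.pi : ℝ) : ℂ) := by push_cast; ring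
  rw [h4, Complex.re_ofReal_mul]
  positivity

lemma integrable_conj_atomHat_mul {α : ℝ} (hα : 1 < α) {z w : ℂ} (hz : z ∈ upperHalf)
    (hw : w ∈ upperHalf) : Integrable fun u => conj (atomHat α z u) * atomHat α w u := by
  simp_rw [conj_atomHat_mul]
  exact (integrable_indicator_iff measurableSet_Ioi).2 (Integrable.const_mul
    (integrableOn_rpow_mul_cexp (by linarith) (re_four_pi_mul_pos hz hw)) _)

/-- The Gram kernel of the atoms is the reproducing kernel of `A²_α`; this fixes `c_α`. -/
lemma integral_conj_atomHat_mul {α : ℝ} (hα : 1 < α) {z w : ℂ} (hz : z ∈ upperHalf)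
    (hw : w ∈ upperHalf) :
    ∫ u, conj (atomHat α z u) * atomHat α w u = bergmanKernel α w z := by
  simp_rw [conj_atomHat_mul]
  rw [integral_indicator measurableSet_Ioi, integral_const_mul,
    integral_rpow_mul_cexp (by linarith) (re_four_pi_mul_pos hz hw)]
  have hΓ := Real.Gamma_pos_of_pos (by linarith : 0 < α)
  have h4 : (4 * Real.pi : ℂ) = ((4 * Real.pi : ℝ) : ℂ) := by push_cast; ring
  have hne : (z - conj w) / (2 * Complex.I) ≠ 0 := by
    intro h
    have := re_sub_conj_div_pos hw hz
    simp [h] at this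
  rw [h4, ofReal_mul_cpow (by positivity) hne, bergmanKernel, ← mul_assoc, ← mul_assoc]
  congr 1
  rw [← Complex.ofReal_neg, ← Complex.ofReal_cpow (by positivity), ← Complex.ofReal_mul,
    ← Complex.ofReal_mul]
  congr 1
  have hc : waveletConst α ^ 2 = (α - 1) * 2 ^ α / (8 * Real.pi * Real.Gamma α) := by
    refine Real.sq_sqrt ?_
    have : 0 < α - 1 := by linarith
    positivity
  have h4' : (4 * Real.pi) ^ (-α) = (2 : ℝ) ^ (-α) * (2 * Real.pi) ^ (-α) := by
    rw [← Real.mul_rpow (by norm_num) (by positivity)]; ring_nf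
  rw [mul_pow, hc, h4', Real.rpow_sub (by positivity), Real.rpow_one,
    Real.rpow_neg (by positivity), Real.rpow_neg (by positivity)]
  have : (2 * Real.pi) ^ α ≠ 0 := by positivity
  have : (2 : ℝ) ^ α ≠ 0 := by positivity
  field_simp
  ring

lemma memLp_atomHat {α : ℝ} (hα : 1 < α) {w : ℂ} (hw : w ∈ upperHalf) :
    MemLp (atomHat α w) 2 := by
  rw [memLp_two_iff_integrable_sq_norm (measurable_atomHat α w).aestronglyMeasurable]
  refine (integrable_conj_atomHat_mul hα hw hw).norm.congr (.of_forall fun u => ?_)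
  simp [sq]

/-- The element `κ_w = c_α y ^ (-α/2) T_x D_y ψ_α` of `L²(ℝ)`, `w = x + iy`, defined by its
Fourier transform; it is only meaningful for `w` in the upper half-plane. -/
noncomputable def atom (α : ℝ) (w : ℂ) : L2R :=
  open Classical in
  𝓕⁻ (if h : MemLp (atomHat α w) 2 then h.toLp (atomHat α w) else 0 : L2R)

lemma atom_eq {α : ℝ} (hα : 1 < α) {w : ℂ} (hw : w ∈ upperHalf) :
    atom α w = 𝓕⁻ ((memLp_atomHat hα hw).toLp (atomHat α w) : L2R) := by
  rw [atom, dif_pos (memLp_atomHat hα hw)]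

lemma fourier_atom {α : ℝ} (hα : 1 < α) {w : ℂ} (hw : w ∈ upperHalf) :
    (𝓕 (atom α w) : L2R) = (memLp_atomHat hα hw).toLp (atomHat α w) := by
  rw [atom_eq hα hw, FourierTransform.fourier_fourierInv_eq]

lemma atom_mem_hardySpace {α : ℝ} (hα : 1 < α) {w : ℂ} (hw : w ∈ upperHalf) :
    atom α w ∈ hardySpace := by
  change ∀ᵐ ξ ∂(volume.restrict (Set.Iio (0 : ℝ))), (𝓕 (atom α w) : L2R) ξ = 0
  rw [fourier_atom hα hw]
  filter_upwards [ae_restrict_of_ae (memLp_atomHat hα hw).coeFn_toLp,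
    ae_restrict_mem measurableSet_Iio] with u hu hu0
  rw [hu, atomHat, Set.indicator_of_notMem]
  exact fun h => lt_asymm (Set.mem_Ioi.1 h) hu0

lemma inner_atom_eq_integral {α : ℝ} (hα : 1 < α) {z : ℂ} (hz : z ∈ upperHalf) (h : L2R) :
    inner ℂ (atom α z) h = ∫ u, conj (atomHat α z u) * (𝓕 h : L2R) u := by
  rw [← Lp.inner_fourier_eq, fourier_atom hα hz, L2.inner_def]
  refine integral_congr_ae ?_
  filter_upwards [(memLp_atomHat hα hz).coeFn_toLp] with u hu
  rw [hu, RCLike.inner_apply, mul_comm]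

lemma inner_atom_atom {α : ℝ} (hα : 1 < α) {z w : ℂ} (hz : z ∈ upperHalf) (hw : w ∈ upperHalf) :
    inner ℂ (atom α z) (atom α w) = bergmanKernel α w z := by
  rw [inner_atom_eq_integral hα hz, fourier_atom hα hw, ← integral_conj_atomHat_mul hα hz hw]
  refine integral_congr_ae ?_
  filter_upwards [(memLp_atomHat hα hw).coeFn_toLp] with u hu
  rw [hu]

lemma norm_atom_sq {α : ℝ} (hα : 1 < α) {z : ℂ} (hz : z ∈ upperHalf) :
    ‖atom α z‖ ^ 2 = (α - 1) / 4 * z.im ^ (-α) := by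
  have h := inner_atom_atom hα hz hz
  have h2 : (z - conj z) / (2 * Complex.I) = (z.im : ℂ) := by
    rw [Complex.sub_conj]
    field_simp
    push_cast
    ring
  rw [inner_self_eq_norm_sq_to_K, bergmanKernel, h2, ← Complex.ofReal_neg,
    ← Complex.ofReal_cpow (le_of_lt hz)] at h
  refine Complex.ofReal_injective ?_
  rw [Complex.ofReal_pow, Complex.ofReal_mul]
  exact h

lemma continuousOn_norm_atom_sq {α : ℝ} (hα : 1 < α) :
    ContinuousOn (fun z => ‖atom α z‖ ^ 2) upperHalf := by
  refine ContinuousOn.congr (f := fun z : ℂ => (α - 1) / 4 * z.im ^ (-α)) ?_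
    fun z hz => norm_atom_sq hα hz
  exact (Complex.continuous_im.continuousOn.rpow_const
    fun z hz => Or.inl (ne_of_gt hz)).const_mul _

lemma atom_ne_zero {α : ℝ} (hα : 1 < α) {z : ℂ} (hz : z ∈ upperHalf) : atom α z ≠ 0 := by
  have h := norm_atom_sq hα hz
  replace hz : 0 < z.im := hz
  have : 0 < α - 1 := by linarith
  have hpos : 0 < (α - 1) / 4 * z.im ^ (-α) := by positivity
  intro h0
  rw [h0, norm_zero] at h
  exact hpos.ne (by simpa using h)

/-- The inverse Fourier transform of `atomHat`, by the substitution `ξ = 2 π y u` in the integral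
that defines the Cauchy wavelet. -/
lemma fourierInv_atomHat (α : ℝ) {w : ℂ} (hw : w ∈ upperHalf) (t : ℝ) :
    𝓕⁻ (atomHat α w) t = ((waveletConst α * w.im ^ (-(α / 2)) : ℝ) : ℂ) *
      translateOp w.re (dilateOp w.im (cauchyWavelet α)) t := by
  replace hw : 0 < w.im := hw
  obtain ⟨β, hβ⟩ : ∃ β, β = (α - 1) / 2 := ⟨_, rfl⟩
  have hy : 0 < 2 * Real.pi * w.im := by positivity
  have h1 : cauchyWavelet α ((t - w.re) / w.im) = ∫ ξ in Set.Ioi (0 : ℝ),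
      ((ξ ^ β * Real.exp (-ξ) : ℝ) : ℂ) *
        Complex.exp (Complex.I * ((t - w.re) / w.im : ℝ) * ξ) := by
    rw [cauchyWavelet, ← integral_Ici_eq_integral_Ioi, ← integral_indicator measurableSet_Ici]
    refine integral_congr_ae (.of_forall fun ξ => ?_)
    by_cases h : 0 ≤ ξ <;> simp [cauchyWaveletHat, h, ← hβ]
  have h2 := integral_comp_mul_left_Ioi (fun ξ : ℝ => ((ξ ^ β * Real.exp (-ξ) : ℝ) : ℂ) *
        Complex.exp (Complex.I * ((t - w.re) / w.im : ℝ) * ξ)) 0 hy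
  rw [mul_zero, ← h1, eq_inv_smul_iff₀ hy.ne'] at h2
  rw [translateOp, dilateOp, ← h2, Complex.real_smul, ← integral_const_mul, ← integral_const_mul,
    ← integral_const_mul, Real.fourierInv_eq']
  simp only [atomHat, ← hβ]
  rw [← integral_indicator measurableSet_Ioi]
  refine integral_congr_ae (.of_forall fun u => ?_)
  by_cases hu : u ∈ Set.Ioi (0 : ℝ)
  · simp only [Set.indicator_of_mem hu]
    replace hu : 0 < u := hu
    have e1 : Complex.exp (((2 * Real.pi * inner ℝ u t : ℝ) : ℂ) * Complex.I) *
        Complex.exp (-(2 * Real.pi * Complex.I * conj w * u)) =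
        ((Real.exp (-(2 * Real.pi * w.im * u)) : ℝ) : ℂ) *
        Complex.exp (Complex.I * ((t - w.re) / w.im : ℝ) * ((2 * Real.pi * w.im * u : ℝ) : ℂ)) := by
      rw [Complex.ofReal_exp, ← Complex.exp_add, ← Complex.exp_add]
      congr 1
      have hw' : (w.im : ℂ) ≠ 0 := by exact_mod_cast hw.ne'
      have hc : conj w = (w.re : ℂ) - w.im * Complex.I := by
        apply Complex.ext <;> simp
      rw [hc]
      simp only [RCLike.inner_apply, conj_trivial]
      push_cast
      field_simp
      linear_combination ((w.im : ℂ) * u) * Complex.I_sq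
    have e2 : w.im ^ (-(α / 2)) * (√w.im)⁻¹ * w.im * w.im ^ β = 1 := by
      rw [Real.sqrt_eq_rpow, ← Real.rpow_neg hw.le, ← Real.rpow_add hw]
      nth_rewrite 2 [← Real.rpow_one w.im]
      rw [← Real.rpow_add hw, ← Real.rpow_add hw, hβ]
      ring_nf
      simp
    rw [smul_eq_mul, Real.mul_rpow hy.le hu.le, Real.mul_rpow (by positivity) hw.le]
    have e2' : ((w.im ^ (-(α / 2)) : ℝ) : ℂ) * ((√w.im)⁻¹ : ℝ) * (w.im : ℂ) *
        ((w.im ^ β : ℝ) : ℂ) = 1 := by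
      exact_mod_cast e2
    -- the exponentials become variables, so that only the relation `e1` between them is used
    generalize hA : Complex.exp (((2 * Real.pi * inner ℝ u t : ℝ) : ℂ) * Complex.I) = A at *
    generalize hB : Complex.exp (-(2 * Real.pi * Complex.I * conj w * u)) = B at *
    generalize hC : Complex.exp (Complex.I * ((t - w.re) / w.im : ℝ) *
      ((2 * Real.pi * w.im * u : ℝ) : ℂ)) = C at *
    push_cast at e1 e2' ⊢
    linear_combination (2 * Real.pi * waveletConst α * (((2 * Real.pi) ^ β : ℝ) : ℂ) *
      ((u ^ β : ℝ) : ℂ)) * (e1 - Complex.exp (-(2 * Real.pi * w.im * u)) * C * e2')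
  · simp [Set.indicator_of_notMem hu]

lemma atom_ae_eq {α : ℝ} (hα : 1 < α) {w : ℂ} (hw : w ∈ upperHalf) :
    (atom α w : L2R) =ᵐ[volume] fun t => ((waveletConst α * w.im ^ (-(α / 2)) : ℝ) : ℂ) *
      translateOp w.re (dilateOp w.im (cauchyWavelet α)) t := by
  rw [atom_eq hα hw]
  exact (fourierInv_toLp_ae_eq (integrable_atomHat hα hw) (memLp_atomHat hα hw)).trans
    (.of_forall fun t => fourierInv_atomHat α hw t)

lemma pairing_eq_inner {s : ℝ → ℂ} (hs : MemLp s 2) (f : L2R) :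
    pairing f s = inner ℂ (hs.toLp s) f := by
  rw [pairing, L2.inner_def]
  refine integral_congr_ae ?_
  filter_upwards [hs.coeFn_toLp] with t ht
  rw [ht, RCLike.inner_apply]

lemma pairing_coe_eq_inner (f g : L2R) : pairing f g = inner ℂ g f := by
  rw [pairing, L2.inner_def]
  exact integral_congr_ae (.of_forall fun t => (RCLike.inner_apply _ _).symm)

lemma waveletConst_mul_rpow_ne_zero {α : ℝ} (hα : 1 < α) {z : ℂ} (hz : z ∈ upperHalf) (s : ℝ) :
    ((waveletConst α * z.im ^ s : ℝ) : ℂ) ≠ 0 := by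
  replace hz : 0 < z.im := hz
  have := waveletConst_pos hα
  exact_mod_cast (by positivity : waveletConst α * z.im ^ s ≠ 0)

lemma memLp_waveletAtom {α : ℝ} (hα : 1 < α) {z : ℂ} (hz : z ∈ upperHalf) :
    MemLp (translateOp z.re (dilateOp z.im (cauchyWavelet α))) 2 := by
  refine (((Lp.memLp (atom α z)).ae_eq (atom_ae_eq hα hz)).const_mul
    ((waveletConst α * z.im ^ (-(α / 2)) : ℝ) : ℂ)⁻¹).ae_eq (.of_forall fun t => ?_)
  exact inv_mul_cancel_left₀ (waveletConst_mul_rpow_ne_zero hα hz _) _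

/-- The normalized wavelet transform is the pairing with the atoms. -/
lemma normalizedTransform_eq_inner {α : ℝ} (hα : 1 < α) {z : ℂ} (hz : z ∈ upperHalf) (s : L2R) :
    normalizedTransform α (waveletConst α) s z = inner ℂ (atom α z) s := by
  rw [normalizedTransform, waveletTransform, ← pairing_coe_eq_inner, pairing, pairing,
    ← integral_const_mul]
  refine integral_congr_ae ?_
  filter_upwards [atom_ae_eq hα hz] with t ht
  rw [ht, map_mul, Complex.conj_ofReal]
  ring

lemma waveletTransform_eq {α : ℝ} (hα : 1 < α) {z : ℂ} (hz : z ∈ upperHalf) (s : ℝ → ℂ) :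
    waveletTransform (cauchyWavelet α) s z =
      ((z.im ^ (α / 2) / waveletConst α : ℝ) : ℂ) *
        normalizedTransform α (waveletConst α) s z := by
  replace hz : 0 < z.im := hz
  have hc := (waveletConst_pos hα).ne'
  have h : z.im ^ (α / 2) / waveletConst α * (waveletConst α * z.im ^ (-(α / 2))) = 1 := by
    rw [Real.rpow_neg hz.le]
    field_simp
  rw [normalizedTransform, ← mul_assoc, ← Complex.ofReal_mul, h, Complex.ofReal_one, one_mul]

/-! ### The Hardy space is the closed span of the atoms -/

lemma isClosed_hardySpace : IsClosed (hardySpace : Set L2R) := by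
  let T : L2R → Lp ℂ 2 ((volume : Measure ℝ).restrict (Set.Iio (0 : ℝ))) := fun s =>
    LpToLpRestrictCLM ℝ ℂ ℂ volume 2 (Set.Iio (0 : ℝ)) (𝓕 s : L2R)
  have hT : Continuous T := (LpToLpRestrictCLM ℝ ℂ ℂ volume 2 (Set.Iio (0 : ℝ))).continuous.comp
    (Lp.fourierTransformₗᵢ ℝ ℂ).continuous
  have h : (hardySpace : Set L2R) = T ⁻¹' {0} := by
    ext s
    have h1 := LpToLpRestrictCLM_coeFn ℂ (Set.Iio (0 : ℝ)) (𝓕 s : L2R)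
    rw [Set.mem_preimage, Set.mem_singleton_iff, Lp.eq_zero_iff_ae_eq_zero]
    constructor
    · intro hs
      exact h1.trans hs
    · intro hs
      exact h1.symm.trans hs
  rw [h]
  exact isClosed_singleton.preimage hT

instance completeSpace_hardySpace : CompleteSpace hardySpace :=
  isClosed_hardySpace.completeSpace_coe

lemma atomHat_ne_zero {α : ℝ} (hα : 1 < α) (w : ℂ) {u : ℝ} (hu : 0 < u) : atomHat α w u ≠ 0 := by
  have := waveletConst_pos hα
  rw [atomHat, Set.indicator_of_mem (Set.mem_Ioi.2 hu)]
  refine mul_ne_zero ?_ (mul_ne_zero ?_ (Complex.exp_ne_zero _))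
  · exact_mod_cast (by positivity : 2 * Real.pi * waveletConst α *
      (2 * Real.pi) ^ ((α - 1) / 2) ≠ 0)
  · exact_mod_cast (by positivity : u ^ ((α - 1) / 2) ≠ 0)

/-- The atoms are total in the Hardy space: their pairings with `h` along the line `Im z = 1`
are the inverse Fourier transform of an integrable function that vanishes only where the Fourier
transform of `h` does. -/
lemma eq_zero_of_inner_atom_eq_zero {α : ℝ} (hα : 1 < α) {h : L2R} (hh : h ∈ hardySpace)
    (h0 : ∀ z ∈ upperHalf, inner ℂ (atom α z) h = 0) : h = 0 := by
  have hI : Complex.I ∈ upperHalf := by simp [upperHalf]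
  have hq : Integrable fun u => conj (atomHat α Complex.I u) * (𝓕 h : L2R) u := by
    have h1 : MemLp (fun u => conj (atomHat α Complex.I u)) 2 := (memLp_atomHat hα hI).star
    exact h1.integrable_mul (Lp.memLp _)
  have hq0 := ae_eq_zero_of_fourierInv_eq_zero hq fun t => by
    have ht : (t + Complex.I : ℂ) ∈ upperHalf := by simp [upperHalf]
    rw [← h0 _ ht, inner_atom_eq_integral hα ht, Real.fourierInv_eq']
    refine integral_congr_ae (.of_forall fun u => ?_)
    simp only [smul_eq_mul, ← mul_assoc]
    congr 1
    unfold atomHat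
    by_cases hu : u ∈ Set.Ioi (0 : ℝ)
    · simp only [Set.indicator_of_mem hu, map_mul, Complex.conj_ofReal, ← Complex.exp_conj]
      have : Complex.exp (conj (-(2 * Real.pi * Complex.I * conj (t + Complex.I) * u))) =
          Complex.exp (((2 * Real.pi * inner ℝ u t : ℝ) : ℂ) * Complex.I) *
          Complex.exp (conj (-(2 * Real.pi * Complex.I * conj Complex.I * u))) := by
        rw [← Complex.exp_add]
        congr 1
        simp only [map_neg, map_mul, map_add, Complex.conj_ofReal, Complex.conj_I,
          map_ofNat, RCLike.inner_apply, conj_trivial]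
        push_cast
        ring
      rw [this]
      ring
    · simp [Set.indicator_of_notMem hu]
  have hF : (𝓕 h : L2R) = 0 := by
    rw [Lp.eq_zero_iff_ae_eq_zero]
    have hneg : ∀ᵐ ξ ∂(volume.restrict (Set.Iio (0 : ℝ))), (𝓕 h : L2R) ξ = 0 := hh
    rw [ae_restrict_iff' measurableSet_Iio] at hneg
    filter_upwards [hneg, hq0, Measure.ae_ne volume (0 : ℝ)] with u h1 h2 h3
    rcases lt_or_gt_of_ne h3 with hu | hu
    · exact h1 hu
    · exact (mul_eq_zero.1 h2).resolve_left
        ((map_ne_zero _).2 (atomHat_ne_zero hα _ hu))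
  rw [← norm_eq_zero, ← Lp.norm_fourier_eq, hF, norm_zero]

/-! ### The weighted Bergman space as a reproducing kernel Hilbert space -/

lemma ae_mem_upperHalf (α : ℝ) : ∀ᵐ z ∂(bergmanMeasure α), z ∈ upperHalf :=
  (withDensity_absolutelyContinuous _ _).ae_le
    (ae_restrict_mem isOpen_upperHalf.measurableSet)

/-- The reproducing kernel at `w` as an element of `A²_α`. -/
noncomputable def bergmanAtom {α : ℝ} (hα : 1 < α) (w : upperHalf) : bergmanSpace α :=
  ⟨(memLp_bergmanKernel hα w.2).toLp (bergmanKernel α w),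
    bergmanKernel α w, differentiableOn_bergmanKernel α w.2, MemLp.coeFn_toLp _⟩

lemma inner_bergmanAtom {α : ℝ} (hα : 1 < α) (w : upperHalf) {f : Lp ℂ 2 (bergmanMeasure α)}
    {g : ℂ → ℂ} (hg : DifferentiableOn ℂ g upperHalf) (hfg : f =ᵐ[bergmanMeasure α] g) :
    inner ℂ (bergmanAtom hα w : Lp ℂ 2 (bergmanMeasure α)) f = g w := by
  rw [← integral_conj_bergmanKernel_mul hα w.2 hg ((Lp.memLp f).ae_eq hfg), L2.inner_def]
  refine integral_congr_ae ?_
  filter_upwards [hfg, (memLp_bergmanKernel hα w.2).coeFn_toLp] with z h1 h2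
  rw [h1, bergmanAtom, h2, RCLike.inner_apply, mul_comm]

lemma inner_bergmanAtom_bergmanAtom {α : ℝ} (hα : 1 < α) (z w : upperHalf) :
    inner ℂ (bergmanAtom hα z) (bergmanAtom hα w) = bergmanKernel α w z :=
  inner_bergmanAtom hα z (differentiableOn_bergmanKernel α w.2)
    (memLp_bergmanKernel hα w.2).coeFn_toLp

lemma norm_bergmanAtom {α : ℝ} (hα : 1 < α) (z : upperHalf) : ‖bergmanAtom hα z‖ = ‖atom α z‖ := by
  have h := inner_bergmanAtom_bergmanAtom hα z z
  rw [← inner_atom_atom hα z.2 z.2] at h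
  have h1 := inner_self_eq_norm_sq_to_K (𝕜 := ℂ) (bergmanAtom hα z)
  have h2 := inner_self_eq_norm_sq_to_K (𝕜 := ℂ) (atom α z)
  exact (sq_eq_sq₀ (norm_nonneg _) (norm_nonneg _)).1
    (by exact_mod_cast h1.symm.trans (h.trans h2))

/-- `A²_α` is closed in `L²`: point evaluations are locally uniformly bounded, so an `L²` limit
of analytic functions is their locally uniform limit. -/
lemma isClosed_bergmanSpace {α : ℝ} (hα : 1 < α) :
    IsClosed (bergmanSpace α : Set (Lp ℂ 2 (bergmanMeasure α))) := by
  refine IsSeqClosed.isClosed fun f F hf hF => ?_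
  choose g hg hfg using hf
  classical
  -- the candidate for the limit pairs `F` with the reproducing kernels
  let G : ℂ → ℂ := fun z => if hz : z ∈ upperHalf then
    inner ℂ (bergmanAtom hα ⟨z, hz⟩ : Lp ℂ 2 (bergmanMeasure α)) F else 0
  have hbound : ∀ n, ∀ z ∈ upperHalf, dist (G z) (g n z) ≤ ‖atom α z‖ * ‖F - f n‖ := by
    intro n z hz
    rw [dist_eq_norm, ← inner_bergmanAtom hα ⟨z, hz⟩ (hg n) (hfg n)]
    simp only [G, dif_pos hz]
    rw [← inner_sub_right, ← norm_bergmanAtom hα ⟨z, hz⟩]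
    exact norm_inner_le_norm _ _
  have hF0 : Tendsto (fun n => ‖F - f n‖) atTop (𝓝 0) := by
    simpa using ((tendsto_const_nhds (x := F)).sub hF).norm
  have hunif : TendstoLocallyUniformlyOn g G atTop upperHalf := by
    rw [tendstoLocallyUniformlyOn_iff_forall_isCompact isOpen_upperHalf]
    intro K hK hKc
    obtain ⟨C, hC⟩ := (hKc.image_of_continuousOn
      ((continuousOn_norm_atom_sq hα).mono hK)).bddAbove
    rw [Metric.tendstoUniformlyOn_iff]
    intro ε hε
    have h2 : Tendsto (fun n => √C * ‖F - f n‖) atTop (𝓝 0) := by simpa using hF0.const_mul (√C)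
    filter_upwards [h2.eventually (gt_mem_nhds hε)] with n hn z hz
    refine ((hbound n z (hK hz)).trans ?_).trans_lt hn
    gcongr
    exact Real.le_sqrt_of_sq_le (hC ⟨z, hz, rfl⟩)
  refine ⟨G, hunif.differentiableOn (.of_forall hg) isOpen_upperHalf, ?_⟩
  obtain ⟨ns, hns, hlim⟩ := (tendstoInMeasure_of_tendsto_Lp hF).exists_seq_tendsto_ae
  filter_upwards [hlim, ae_all_iff.2 hfg, ae_mem_upperHalf α] with z h1 h2 hz
  refine tendsto_nhds_unique h1 ?_
  simp only [h2]
  exact (hunif.tendsto_at hz).comp hns.tendsto_atTop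

lemma completeSpace_bergmanSpace {α : ℝ} (hα : 1 < α) : CompleteSpace (bergmanSpace α) :=
  (isClosed_bergmanSpace hα).completeSpace_coe

/-! ### The isometry between the Hardy space and the Bergman space -/

lemma norm_linearCombination_eq_of_inner_eq {ι H H' : Type*} [NormedAddCommGroup H]
    [InnerProductSpace ℂ H] [NormedAddCommGroup H'] [InnerProductSpace ℂ H'] {s : ι → H}
    {s' : ι → H'} (h : ∀ i j, inner ℂ (s i) (s j) = inner ℂ (s' i) (s' j)) (x : ι →₀ ℂ) :
    ‖Finsupp.linearCombination ℂ s x‖ = ‖Finsupp.linearCombination ℂ s' x‖ := by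
  have key : inner ℂ (Finsupp.linearCombination ℂ s x) (Finsupp.linearCombination ℂ s x) =
      inner ℂ (Finsupp.linearCombination ℂ s' x) (Finsupp.linearCombination ℂ s' x) := by
    simp only [Finsupp.linearCombination_apply, Finsupp.sum_inner, Finsupp.inner_sum,
      inner_smul_left, inner_smul_right, h]
  rw [inner_self_eq_norm_sq_to_K, inner_self_eq_norm_sq_to_K] at key
  exact (sq_eq_sq₀ (norm_nonneg _) (norm_nonneg _)).1 (by exact_mod_cast key)

lemma denseRange_linearCombination {ι H : Type*} [NormedAddCommGroup H]
    [InnerProductSpace ℂ H] [CompleteSpace H] {s : ι → H}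
    (h : ∀ x, (∀ i, inner ℂ (s i) x = 0) → x = 0) :
    DenseRange (Finsupp.linearCombination ℂ s) := by
  have h1 : Set.range (Finsupp.linearCombination ℂ s) =
      (Submodule.span ℂ (Set.range s) : Set H) := by
    rw [← Finsupp.range_linearCombination]
    rfl
  rw [DenseRange, h1, Submodule.dense_iff_topologicalClosure_eq_top,
    Submodule.topologicalClosure_eq_top_iff, Submodule.eq_bot_iff]
  intro x hx
  exact h x fun i => (Submodule.mem_orthogonal _ _).1 hx _ (Submodule.subset_span ⟨i, rfl⟩)

/-- The atom at `w` as an element of the Hardy space. -/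
noncomputable def hardyAtom {α : ℝ} (hα : 1 < α) (w : upperHalf) : hardySpace :=
  ⟨atom α w, atom_mem_hardySpace hα w.2⟩

lemma inner_hardyAtom {α : ℝ} (hα : 1 < α) (w : upperHalf) (h : hardySpace) :
    inner ℂ (hardyAtom hα w) h = inner ℂ (atom α w) (h : L2R) := rfl

lemma denseRange_hardyAtom {α : ℝ} (hα : 1 < α) :
    DenseRange (Finsupp.linearCombination ℂ (hardyAtom hα)) :=
  denseRange_linearCombination fun h h0 =>
    Subtype.ext (eq_zero_of_inner_atom_eq_zero hα h.2 fun z hz => h0 ⟨z, hz⟩)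

lemma denseRange_bergmanAtom {α : ℝ} (hα : 1 < α) :
    DenseRange (Finsupp.linearCombination ℂ (bergmanAtom hα)) := by
  have := completeSpace_bergmanSpace hα
  refine denseRange_linearCombination fun f h0 => Subtype.ext ?_
  obtain ⟨g, hg, hfg⟩ := f.2
  change (f : Lp ℂ 2 (bergmanMeasure α)) = 0
  rw [Lp.eq_zero_iff_ae_eq_zero]
  filter_upwards [hfg, ae_mem_upperHalf α] with z h1 hz
  rw [h1, ← inner_bergmanAtom hα ⟨z, hz⟩ hg hfg]
  exact h0 ⟨z, hz⟩

/-- The unitary map from the Hardy space onto `A²_α` that sends each atom to the reproducing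
kernel at the same point. It exists because both families are total and have the same Gram
matrix. -/
noncomputable def hardyBergmanEquiv {α : ℝ} (hα : 1 < α) : hardySpace ≃ₗᵢ[ℂ] bergmanSpace α :=
  haveI := completeSpace_bergmanSpace hα
  (LinearEquiv.refl ℂ (upperHalf →₀ ℂ)).extendOfIsometry
    (Finsupp.linearCombination ℂ (hardyAtom hα)) (Finsupp.linearCombination ℂ (bergmanAtom hα))
    (denseRange_hardyAtom hα) (denseRange_bergmanAtom hα)
    (norm_linearCombination_eq_of_inner_eq fun z w => by
      rw [inner_bergmanAtom_bergmanAtom, ← inner_atom_atom hα z.2 w.2]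
      rfl)

lemma hardyBergmanEquiv_hardyAtom {α : ℝ} (hα : 1 < α) (w : upperHalf) :
    hardyBergmanEquiv hα (hardyAtom hα w) = bergmanAtom hα w := by
  have := completeSpace_bergmanSpace hα
  have h := LinearEquiv.extendOfIsometry_eq (LinearEquiv.refl ℂ (upperHalf →₀ ℂ))
    (Finsupp.linearCombination ℂ (hardyAtom hα)) (Finsupp.linearCombination ℂ (bergmanAtom hα))
    (denseRange_hardyAtom hα) (denseRange_bergmanAtom hα)
    (norm_linearCombination_eq_of_inner_eq fun z w => by
      rw [inner_bergmanAtom_bergmanAtom, ← inner_atom_atom hα z.2 w.2]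
      rfl) (Finsupp.single w 1)
  simp only [Finsupp.linearCombination_single, one_smul, LinearEquiv.refl_apply] at h
  exact h

/-- The reproducing property carried over to the Hardy space. -/
lemma inner_bergmanAtom_hardyBergmanEquiv {α : ℝ} (hα : 1 < α) (w : upperHalf) (h : hardySpace) :
    inner ℂ (bergmanAtom hα w) (hardyBergmanEquiv hα h) = inner ℂ (atom α w) (h : L2R) := by
  rw [← hardyBergmanEquiv_hardyAtom, LinearIsometryEquiv.inner_map_map, inner_hardyAtom]

/-- The image of `h` under the isometry is represented by the analytic function
`z ↦ ⟪κ_z, h⟫`. -/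
lemma hardyBergmanEquiv_spec {α : ℝ} (hα : 1 < α) (h : hardySpace) :
    DifferentiableOn ℂ (fun z => inner ℂ (atom α z) (h : L2R)) upperHalf ∧
      (hardyBergmanEquiv hα h : Lp ℂ 2 (bergmanMeasure α)) =ᵐ[bergmanMeasure α]
        fun z => inner ℂ (atom α z) (h : L2R) := by
  obtain ⟨g, hg, hfg⟩ := (hardyBergmanEquiv hα h).2
  have heq : ∀ z ∈ upperHalf, inner ℂ (atom α z) (h : L2R) = g z := fun z hz => by
    rw [← inner_bergmanAtom_hardyBergmanEquiv hα ⟨z, hz⟩]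
    exact inner_bergmanAtom hα ⟨z, hz⟩ hg hfg
  refine ⟨hg.congr heq, ?_⟩
  filter_upwards [hfg, ae_mem_upperHalf α] with z h1 hz
  rw [h1, heq z hz]

lemma differentiableOn_inner_atom {α : ℝ} (hα : 1 < α) (h : L2R) :
    DifferentiableOn ℂ (fun z => inner ℂ (atom α z) h) upperHalf := by
  refine (hardyBergmanEquiv_spec hα (hardySpace.orthogonalProjectionOnto h)).1.congr fun z hz => ?_
  have := Submodule.inner_orthogonalProjectionOnto_eq_of_mem_left (K := hardySpace)
    ⟨atom α z, atom_mem_hardySpace hα hz⟩ h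
  exact this.symm

lemma isBergmanBasis_inner_atom {α : ℝ} (hα : 1 < α) (h : HilbertBasis ℕ ℂ hardySpace) :
    IsBergmanBasis α fun n z => inner ℂ (atom α z) ((h n : hardySpace) : L2R) := by
  refine ⟨fun n => (hardyBergmanEquiv_spec hα (h n)).1,
    HilbertBasis.ofRepr ((hardyBergmanEquiv hα).symm.trans h.repr), fun n => ?_⟩
  have hn : (HilbertBasis.ofRepr ((hardyBergmanEquiv hα).symm.trans h.repr)) n =
      hardyBergmanEquiv hα (h n) := by
    rw [← HilbertBasis.repr_symm_single, ← HilbertBasis.repr_symm_single]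
    rfl
  rw [hn]
  exact (hardyBergmanEquiv_spec hα (h n)).2

/-- Every orthonormal basis of `A²_α` is the image of an orthonormal basis of the Hardy space. -/
lemma IsBergmanBasis.exists_hilbertBasis {α : ℝ} (hα : 1 < α) {b : ℕ → ℂ → ℂ}
    (hb : IsBergmanBasis α b) : ∃ h : HilbertBasis ℕ ℂ hardySpace,
      ∀ n, ∀ z ∈ upperHalf, b n z = inner ℂ (atom α z) ((h n : hardySpace) : L2R) := by
  obtain ⟨hd, B, hB⟩ := hb
  refine ⟨HilbertBasis.ofRepr ((hardyBergmanEquiv hα).trans B.repr), fun n z hz => ?_⟩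
  have hn : (HilbertBasis.ofRepr ((hardyBergmanEquiv hα).trans B.repr)) n =
      (hardyBergmanEquiv hα).symm (B n) := by
    rw [← HilbertBasis.repr_symm_single, ← HilbertBasis.repr_symm_single]
    rfl
  rw [hn, ← inner_bergmanAtom_hardyBergmanEquiv hα ⟨z, hz⟩, LinearIsometryEquiv.apply_symm_apply]
  exact (inner_bergmanAtom hα ⟨z, hz⟩ (hd n) (hB n)).symm

/-! ### White noise expanded in a basis of a closed subspace -/

section WhiteNoise

variable {Ω : Type*} [MeasurableSpace Ω] {P : Measure Ω} [IsProbabilityMeasure P] {a : ℕ → Ω → ℂ}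

/-- The `L²(Ω)` norm of the value of white noise at `u` is at most `‖u‖`. -/
lemma eLpNorm_lim_sum_inner_le {H : Type*} [NormedAddCommGroup H] [InnerProductSpace ℂ H]
    (ha : IsComplexGaussianSeq P a) (e : HilbertBasis ℕ ℂ H) (u : H) {X : Ω → ℂ}
    (hX : ∀ᵐ ω ∂P, Tendsto (fun N => ∑ n ∈ Finset.range N, a n ω * inner ℂ u (e n)) atTop
      (𝓝 (X ω))) : eLpNorm X 2 P ≤ ENNReal.ofReal ‖u‖ := by
  have hs := e.hasSum_norm_inner_sq u
  have h := eLpNorm_sum_sub_lim_le ha hs.summable hX 0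
  simp only [Finset.range_zero, Finset.sum_empty, zero_sub, add_zero, hs.tsum_eq,
    Real.sqrt_sq (norm_nonneg _)] at h
  change eLpNorm (-X) 2 P ≤ _ at h
  rwa [eLpNorm_neg] at h

/-- If `u` lies in a subspace `K`, the value of white noise at `u` may be computed from its values
`ζ n` at an orthonormal basis of `K`: both series have partial sums with the same `L²(Ω)` limit. -/
lemma ae_eq_lim_sum_of_basis {H : Type*} [NormedAddCommGroup H] [InnerProductSpace ℂ H]
    {K : Submodule ℂ H} (ha : IsComplexGaussianSeq P a) (e : HilbertBasis ℕ ℂ H)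
    (h : HilbertBasis ℕ ℂ K) {ζ : ℕ → Ω → ℂ} (hζ : IsComplexGaussianSeq P ζ)
    (hζa : ∀ n, ∀ᵐ ω ∂P, Tendsto (fun N => ∑ k ∈ Finset.range N, a k ω * inner ℂ (h n : H) (e k))
      atTop (𝓝 (ζ n ω)))
    (u : K) {X Y : Ω → ℂ}
    (hX : ∀ᵐ ω ∂P, Tendsto (fun N => ∑ k ∈ Finset.range N, a k ω * inner ℂ (u : H) (e k)) atTop
      (𝓝 (X ω)))
    (hY : ∀ᵐ ω ∂P, Tendsto (fun N => ∑ n ∈ Finset.range N, ζ n ω * inner ℂ u (h n)) atTop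
      (𝓝 (Y ω))) : X =ᵐ[P] Y := by
  have hu := h.hasSum_norm_inner_sq u
  have hXm := (memLp_lim_sum ha (e.hasSum_norm_inner_sq (u : H)).summable hX).1
  have hYm := (memLp_lim_sum hζ hu.summable hY).1
  have hSm : ∀ N, AEStronglyMeasurable
      (fun ω => ∑ n ∈ Finset.range N, ζ n ω * inner ℂ u (h n)) P := fun N =>
    Finset.aestronglyMeasurable_fun_sum _ fun n _ => (hζ.memLp n).1.mul_const _
  have h1 : ∀ N, eLpNorm (fun ω => ∑ n ∈ Finset.range N, ζ n ω * inner ℂ u (h n) - X ω) 2 P ≤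
      ENNReal.ofReal ‖∑ n ∈ Finset.range N, h.repr u n • h n - u‖ := by
    intro N
    refine eLpNorm_lim_sum_inner_le ha e
      ((∑ n ∈ Finset.range N, h.repr u n • h n - u : K) : H) ?_
    filter_upwards [hX, ae_all_iff.2 hζa] with ω h1 h2
    refine ((tendsto_finsetSum (Finset.range N) fun n _ =>
      (h2 n).mul_const (inner ℂ u (h n))).sub h1).congr fun M => ?_
    simp only [Finset.sum_mul]
    rw [Finset.sum_comm, ← Finset.sum_sub_distrib]
    refine Finset.sum_congr rfl fun k _ => ?_
    push_cast
    rw [inner_sub_left, mul_sub, sum_inner, Finset.mul_sum]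
    congr 1
    refine Finset.sum_congr rfl fun n _ => ?_
    rw [inner_smul_left, h.repr_apply_apply, inner_conj_symm]
    ring
  have h2 : Tendsto (fun N => ENNReal.ofReal ‖∑ n ∈ Finset.range N, h.repr u n • h n - u‖) atTop
      (𝓝 0) := by
    have := ((h.hasSum_repr u).tendsto_sum_nat.sub (tendsto_const_nhds (x := u))).norm
    rw [sub_self, norm_zero] at this
    simpa using ENNReal.tendsto_ofReal this
  have h3 := tendsto_eLpNorm_sum_sub_lim hζ hu.summable hY
  have h4 : ∀ N, eLpNorm (X - Y) 2 P ≤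
      ENNReal.ofReal ‖∑ n ∈ Finset.range N, h.repr u n • h n - u‖ +
      eLpNorm (fun ω => ∑ n ∈ Finset.range N, ζ n ω * inner ℂ u (h n) - Y ω) 2 P := by
    intro N
    have h5 : X - Y = (fun ω => ∑ n ∈ Finset.range N, ζ n ω * inner ℂ u (h n) - Y ω) -
        (fun ω => ∑ n ∈ Finset.range N, ζ n ω * inner ℂ u (h n) - X ω) := by
      ext ω
      simp
    rw [h5, add_comm]
    refine (eLpNorm_sub_le ((hSm N).sub hYm) ((hSm N).sub hXm) (by norm_num)).trans ?_
    exact add_le_add le_rfl (h1 N)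
  have h6 : eLpNorm (X - Y) 2 P = 0 := by
    refine le_antisymm (ge_of_tendsto' (by simpa using h2.add h3) h4) ?_
    simp
  rw [eLpNorm_eq_zero_iff (hXm.sub hYm) (by norm_num)] at h6
  filter_upwards [h6] with ω hω
  exact sub_eq_zero.1 hω

lemma isWhiteNoiseValue_of_ae_tendsto (ha : IsComplexGaussianSeq P a) (e : HilbertBasis ℕ ℂ L2R)
    {s : ℝ → ℂ} (hs : MemLp s 2) {X : Ω → ℂ}
    (hX : ∀ᵐ ω ∂P, Tendsto (fun N => ∑ n ∈ Finset.range N, a n ω * pairing (e n : L2R) s) atTop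
      (𝓝 (X ω))) : IsWhiteNoiseValue P a e s X := by
  have hsum : Summable fun n => ‖pairing (e n : L2R) s‖ ^ 2 := by
    simp_rw [pairing_eq_inner hs]
    exact (e.hasSum_norm_inner_sq _).summable
  exact ⟨memLp_lim_sum ha hsum hX, tendsto_eLpNorm_sum_sub_lim ha hsum hX⟩

/-! ### The random analytic function and the wavelet transform of white noise -/

lemma ae_seriesConverges_of_eq_inner_atom {α : ℝ} (hα : 1 < α) (ha : IsComplexGaussianSeq P a)
    {φ : ℕ → ℂ → ℂ} {s : ℕ → L2R} (hφ : ∀ n, ∀ z ∈ upperHalf, φ n z = inner ℂ (atom α z) (s n))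
    (hs : ∀ z ∈ upperHalf, HasSum (fun n => ‖inner ℂ (atom α z) (s n)‖ ^ 2) (‖atom α z‖ ^ 2)) :
    ∀ᵐ ω ∂P, SeriesConverges a φ ω ∧ DifferentiableOn ℂ (randomSeries a φ ω) upperHalf := by
  have hd : ∀ n, DifferentiableOn ℂ (φ n) upperHalf := fun n =>
    (differentiableOn_inner_atom hα (s n)).congr (hφ n)
  filter_upwards [ae_seriesConverges ha hd (continuousOn_norm_atom_sq hα) fun z hz => by
    simpa only [hφ _ z hz] using hs z hz] with ω hω
  exact ⟨hω, hω.differentiableOn hd⟩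

lemma hasSum_norm_inner_atom_sq {α : ℝ} (hα : 1 < α) (h : HilbertBasis ℕ ℂ hardySpace) {z : ℂ}
    (hz : z ∈ upperHalf) :
    HasSum (fun n => ‖inner ℂ (atom α z) ((h n : hardySpace) : L2R)‖ ^ 2) (‖atom α z‖ ^ 2) :=
  h.hasSum_norm_inner_sq (hardyAtom hα ⟨z, hz⟩)

lemma SeriesConverges.tendsto_inner_atom {Ω : Type*} {a : ℕ → Ω → ℂ} {α : ℝ}
    {φ : ℕ → ℂ → ℂ} {s : ℕ → L2R}
    (hφ : ∀ n, ∀ z ∈ upperHalf, φ n z = inner ℂ (atom α z) (s n)) {ω : Ω}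
    (h : SeriesConverges a φ ω) {z : ℂ} (hz : z ∈ upperHalf) :
    Tendsto (fun N => ∑ n ∈ Finset.range N, a n ω * inner ℂ (atom α z) (s n)) atTop
      (𝓝 (randomSeries a φ ω z)) := by
  refine (h.tendsto hz).congr fun N => ?_
  simp only [partialSum, hφ _ z hz]

lemma continuousOn_waveletFactor (α : ℝ) :
    ContinuousOn (fun z : ℂ => ((z.im ^ (α / 2) / waveletConst α : ℝ) : ℂ)) upperHalf := by
  refine Complex.continuous_ofReal.comp_continuousOn (ContinuousOn.div_const ?_ _)
  exact Complex.continuous_im.continuousOn.rpow_const fun z hz => Or.inl (ne_of_gt hz)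

/-- Multiplication of the terms by a factor that is continuous on the half-plane preserves locally
uniform convergence. -/
lemma SeriesConverges.const_mul {Ω : Type*} {a : ℕ → Ω → ℂ} {φ ψ : ℕ → ℂ → ℂ}
    {g : ℂ → ℂ} (hg : ContinuousOn g upperHalf)
    (hψ : ∀ n, ∀ z ∈ upperHalf, ψ n z = g z * φ n z) {ω : Ω} (h : SeriesConverges a φ ω) :
    SeriesConverges a ψ ω ∧ ∀ z ∈ upperHalf, randomSeries a ψ ω z = g z * randomSeries a φ ω z := by
  have hp : ∀ N, ∀ z ∈ upperHalf, partialSum a ψ ω N z = g z * partialSum a φ ω N z := by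
    intro N z hz
    simp only [partialSum, hψ _ z hz, Finset.mul_sum]
    exact Finset.sum_congr rfl fun n _ => by ring
  have hlim : ∀ z ∈ upperHalf, Tendsto (fun N => partialSum a ψ ω N z) atTop
      (𝓝 (g z * randomSeries a φ ω z)) := fun z hz =>
    ((h.tendsto hz).const_mul (g z)).congr fun N => (hp N z hz).symm
  have heq : ∀ z ∈ upperHalf, randomSeries a ψ ω z = g z * randomSeries a φ ω z := fun z hz =>
    (hlim z hz).limUnder_eq
  refine ⟨?_, heq⟩
  unfold SeriesConverges at h ⊢
  rw [tendstoLocallyUniformlyOn_iff_forall_isCompact isOpen_upperHalf] at h ⊢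
  intro K hK hKc
  obtain ⟨C, hC⟩ := (hKc.image_of_continuousOn (hg.mono hK).norm).bddAbove
  have hK2 := h K hK hKc
  rw [Metric.tendstoUniformlyOn_iff] at hK2 ⊢
  intro ε hε
  have hC1 : 0 < max C 0 + 1 := by positivity
  filter_upwards [hK2 (ε / (max C 0 + 1)) (by positivity)] with N hN z hz
  rw [heq z (hK hz), hp N z (hK hz), dist_eq_norm, ← mul_sub, norm_mul, ← dist_eq_norm]
  have hgz : ‖g z‖ ≤ max C 0 := (hC ⟨z, hz, rfl⟩).trans (le_max_left _ _)
  calc ‖g z‖ * dist (randomSeries a φ ω z) (partialSum a φ ω N z)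
      ≤ (max C 0 + 1) * dist (randomSeries a φ ω z) (partialSum a φ ω N z) := by
        gcongr
        linarith
    _ < (max C 0 + 1) * (ε / (max C 0 + 1)) := by
        gcongr
        exact hN z hz
    _ = ε := by field_simp

/-- The random series over a basis of the Hardy space, with coefficients the values of the white
noise at that basis, is the normalized wavelet transform of the white noise. -/
lemma ae_eqOn_randomSeries_of_basis {α : ℝ} (hα : 1 < α) (ha : IsComplexGaussianSeq P a)
    (e : HilbertBasis ℕ ℂ L2R) (h : HilbertBasis ℕ ℂ hardySpace) {ζ : ℕ → Ω → ℂ}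
    (hζ : IsComplexGaussianSeq P ζ)
    (hζa : ∀ n, ∀ᵐ ω ∂P, Tendsto (fun N => ∑ k ∈ Finset.range N,
      a k ω * inner ℂ ((h n : hardySpace) : L2R) (e k)) atTop (𝓝 (ζ n ω)))
    {φ φ' : ℕ → ℂ → ℂ} (hφ : ∀ n, ∀ z ∈ upperHalf, φ n z = inner ℂ (atom α z) (e n))
    (hφ' : ∀ n, ∀ z ∈ upperHalf, φ' n z = inner ℂ (atom α z) ((h n : hardySpace) : L2R)) :
    ∀ᵐ ω ∂P, SeriesConverges ζ φ' ω ∧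
      Set.EqOn (randomSeries a φ ω) (randomSeries ζ φ' ω) upperHalf := by
  have h1 := ae_seriesConverges_of_eq_inner_atom hα ha hφ fun z _ => e.hasSum_norm_inner_sq _
  have h2 := ae_seriesConverges_of_eq_inner_atom hα hζ hφ' fun z hz =>
    hasSum_norm_inner_atom_sq hα h hz
  have h3 : ∀ z : upperHalfDense, ∀ᵐ ω ∂P, randomSeries a φ ω z = randomSeries ζ φ' ω z := by
    intro z
    refine ae_eq_lim_sum_of_basis ha e h hζ hζa (hardyAtom hα ⟨z, z.2.2⟩) ?_ ?_
    · filter_upwards [h1] with ω hω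
      exact hω.1.tendsto_inner_atom hφ z.2.2
    · filter_upwards [h2] with ω hω
      exact hω.1.tendsto_inner_atom hφ' z.2.2
  filter_upwards [h1, h2, ae_all_iff.2 h3] with ω h1 h2 h3
  refine ⟨h2.1, Set.EqOn.of_subset_closure (s := upperHalfDense) (fun z hz => h3 ⟨z, hz⟩)
    h1.2.continuousOn h2.2.continuousOn (fun z hz => hz.2)
    upperHalf_subset_closure_upperHalfDense⟩

/-- The zeros of a random series of pairings with the atoms have a law that depends neither on the
probability space nor on the basis. -/
lemma identDistrib_zeroMeasure_randomSeries {α : ℝ} (hα : 1 < α) (ha : IsComplexGaussianSeq P a)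
    (e : HilbertBasis ℕ ℂ L2R) {Ω' : Type*} [MeasurableSpace Ω'] {P' : Measure Ω'}
    [IsProbabilityMeasure P'] {a' : ℕ → Ω' → ℂ} (ha' : IsComplexGaussianSeq P' a')
    (h : HilbertBasis ℕ ℂ hardySpace)
    {φ φ' : ℕ → ℂ → ℂ} (hφ : ∀ n, ∀ z ∈ upperHalf, φ n z = inner ℂ (atom α z) (e n))
    (hφ' : ∀ n, ∀ z ∈ upperHalf, φ' n z = inner ℂ (atom α z) ((h n : hardySpace) : L2R)) :
    IdentDistrib (fun ω => zeroMeasure (randomSeries a φ ω))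
      (fun ω => zeroMeasure (randomSeries a' φ' ω)) P P' := by
  have hI : Complex.I ∈ upperHalf := by simp [upperHalf]
  have h1 := ae_seriesConverges_of_eq_inner_atom hα ha hφ fun z _ => e.hasSum_norm_inner_sq _
  have h2 := ae_seriesConverges_of_eq_inner_atom hα ha' hφ' fun z hz =>
    hasSum_norm_inner_atom_sq hα h hz
  have t1 : ∀ z ∈ upperHalf, ∀ᵐ ω ∂P, Tendsto (fun N => ∑ n ∈ Finset.range N,
      a n ω * inner ℂ (atom α z) (e n)) atTop (𝓝 (randomSeries a φ ω z)) := by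
    intro z hz
    filter_upwards [h1] with ω hω
    exact hω.1.tendsto_inner_atom hφ hz
  have t2 : ∀ w : upperHalf, ∀ᵐ ω ∂P', Tendsto (fun N => ∑ n ∈ Finset.range N,
      a' n ω * inner ℂ (hardyAtom hα w) (h n)) atTop (𝓝 (randomSeries a' φ' ω w)) := by
    intro w
    filter_upwards [h2] with ω hω
    exact hω.1.tendsto_inner_atom hφ' w.2
  refine identDistrib_zeroMeasure ?_ ?_ ?_
  · filter_upwards [h1, ae_lim_sum_ne_zero ha e (atom_ne_zero hα hI) (t1 _ hI)] with ω hω h0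
    exact ⟨hω.2, _, hI, h0⟩
  · have hne : hardyAtom hα ⟨Complex.I, hI⟩ ≠ 0 := fun h0 =>
      atom_ne_zero hα hI (congrArg Subtype.val h0)
    filter_upwards [h2, ae_lim_sum_ne_zero ha' h hne (t2 ⟨_, hI⟩)] with ω hω h0
    exact ⟨hω.2, _, hI, h0⟩
  · exact identDistrib_lim_sum_of_gram_eq ha ha' e h (s := fun z : upperHalfDense => atom α z)
      (s' := fun z : upperHalfDense => hardyAtom hα ⟨z, z.2.2⟩) (fun _ _ => rfl)
      (fun z => t1 z z.2.2) fun z => t2 ⟨z, z.2.2⟩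

end WhiteNoise

theorem mainTheorem3 (α : ℝ) (hα : 1 < α) :
    ∃ c : ℝ, 0 < c ∧
      -- orthonormal bases of the Hardy space are mapped to orthonormal bases of `A²_α`
      (∀ h : HilbertBasis ℕ ℂ hardySpace,
        IsBergmanBasis α (fun n => normalizedTransform α c ((h n : hardySpace) : L2R))) ∧
      -- complex white noise `∑ aₙ eₙ`, with an arbitrary orthonormal basis of `L²(ℝ)`
      ∀ {Ω : Type*} [MeasurableSpace Ω] (P : Measure Ω) [IsProbabilityMeasure P]
        (a : ℕ → Ω → ℂ) (_ : IsComplexGaussianSeq P a) (e : HilbertBasis ℕ ℂ L2R),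
        -- the series converges almost surely, locally uniformly
        (∀ᵐ ω ∂P, SeriesConverges a
          (fun n => waveletTransform (cauchyWavelet α) (e n : L2R)) ω) ∧
        -- at each point it is the white noise applied to the wavelet atom
        (∀ z ∈ upperHalf, IsWhiteNoiseValue P a e
          (translateOp z.re (dilateOp z.im (cauchyWavelet α)))
          (fun ω => noiseTransform α a e ω z)) ∧
        -- up to the factor it is a random analytic function, given by the rescaled series
        (∀ᵐ ω ∂P,
          SeriesConverges a (fun n => normalizedTransform α c (e n : L2R)) ω ∧
          DifferentiableOn ℂ
            (randomSeries a (fun n => normalizedTransform α c (e n : L2R)) ω) upperHalf ∧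
          ∀ z ∈ upperHalf, noiseTransform α a e ω z =
            ((z.im ^ (α / 2) / c : ℝ) : ℂ) *
              randomSeries a (fun n => normalizedTransform α c (e n : L2R)) ω z) ∧
        -- and this function is the hyperbolic Gaussian analytic function: a random series
        -- over an orthonormal basis of `A²_α` with independent standard Gaussian coefficients
        (∀ h : HilbertBasis ℕ ℂ hardySpace, ∃ ζ : ℕ → Ω → ℂ,
          (∀ n, IsWhiteNoiseValue P a e ((h n : hardySpace) : L2R) (ζ n)) ∧
          IsComplexGaussianSeq P ζ ∧
          ∀ᵐ ω ∂P,
            SeriesConverges ζ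
              (fun n => normalizedTransform α c ((h n : hardySpace) : L2R)) ω ∧
            ∀ z ∈ upperHalf, noiseTransform α a e ω z =
              ((z.im ^ (α / 2) / c : ℝ) : ℂ) *
                randomSeries ζ
                  (fun n => normalizedTransform α c ((h n : hardySpace) : L2R)) ω z) ∧
        -- the zeros have the law of those of the hyperbolic Gaussian analytic function built
        -- on any probability space from any orthonormal basis of `A²_α`
        (∀ {Ω' : Type*} [MeasurableSpace Ω'] (P' : Measure Ω') [IsProbabilityMeasure P']
          (a' : ℕ → Ω' → ℂ) (_ : IsComplexGaussianSeq P' a')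
          (b : ℕ → ℂ → ℂ) (_ : IsBergmanBasis α b),
          (∀ᵐ ω ∂P', SeriesConverges a' b ω ∧
            DifferentiableOn ℂ (randomSeries a' b ω) upperHalf) ∧
          IdentDistrib (fun ω => zeroMeasure (noiseTransform α a e ω))
            (fun ω => zeroMeasure (randomSeries a' b ω)) P P') := by
  have hc := waveletConst_pos hα
  refine ⟨waveletConst α, hc, ?_, ?_⟩
  · intro h
    obtain ⟨hd, B, hB⟩ := isBergmanBasis_inner_atom hα h
    refine ⟨fun n => (hd n).congr fun z hz => normalizedTransform_eq_inner hα hz _,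
      B, fun n => (hB n).trans ?_⟩
    filter_upwards [ae_mem_upperHalf α] with z hz
    exact (normalizedTransform_eq_inner hα hz _).symm
  intro Ω _ P _ a ha e
  have hφ : ∀ n, ∀ z ∈ upperHalf,
      normalizedTransform α (waveletConst α) (e n : L2R) z = inner ℂ (atom α z) (e n) :=
    fun n z hz => normalizedTransform_eq_inner hα hz _
  have hφ' : ∀ (h : HilbertBasis ℕ ℂ hardySpace) (n : ℕ), ∀ z ∈ upperHalf,
      normalizedTransform α (waveletConst α) ((h n : hardySpace) : L2R) z =
        inner ℂ (atom α z) ((h n : hardySpace) : L2R) :=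
    fun h n z hz => normalizedTransform_eq_inner hα hz _
  have hconv := ae_seriesConverges_of_eq_inner_atom hα ha hφ fun z _ => e.hasSum_norm_inner_sq _
  have hwave : ∀ᵐ ω ∂P, SeriesConverges a
      (fun n => waveletTransform (cauchyWavelet α) (e n : L2R)) ω ∧
      ∀ z ∈ upperHalf, noiseTransform α a e ω z =
        ((z.im ^ (α / 2) / waveletConst α : ℝ) : ℂ) *
          randomSeries a (fun n => normalizedTransform α (waveletConst α) (e n : L2R)) ω z := by
    filter_upwards [hconv] with ω hω
    exact hω.1.const_mul (continuousOn_waveletFactor α)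
      fun n z hz => waveletTransform_eq hα hz _
  refine ⟨hwave.mono fun ω hω => hω.1, ?_, ?_, ?_, ?_⟩
  · intro z hz
    refine isWhiteNoiseValue_of_ae_tendsto ha e (memLp_waveletAtom hα hz) ?_
    filter_upwards [hwave] with ω hω
    exact hω.1.tendsto hz
  · filter_upwards [hconv, hwave] with ω h1 h2
    exact ⟨h1.1, h1.2, h2.2⟩
  · intro h
    -- the representative of `⟨𝒩, h n⟩` given by the pointwise limit where it exists
    let ζ : ℕ → Ω → ℂ := fun n ω => limUnder atTop fun N => ∑ k ∈ Finset.range N,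
      a k ω * inner ℂ ((h n : hardySpace) : L2R) (e k)
    have hζa : ∀ n, ∀ᵐ ω ∂P, Tendsto (fun N => ∑ k ∈ Finset.range N,
        a k ω * inner ℂ ((h n : hardySpace) : L2R) (e k)) atTop (𝓝 (ζ n ω)) := by
      intro n
      filter_upwards [ae_exists_tendsto_sum_inner ha e ((h n : hardySpace) : L2R)] with ω hω
      exact tendsto_nhds_limUnder hω
    have hζ : IsComplexGaussianSeq P ζ := isComplexGaussianSeq_of_orthonormal ha e
      (h.orthonormal.comp_linearIsometry hardySpace.subtypeₗᵢ) hζa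
    refine ⟨ζ, fun n => ?_, hζ, ?_⟩
    · refine isWhiteNoiseValue_of_ae_tendsto ha e (Lp.memLp _) ?_
      simpa only [pairing_coe_eq_inner] using hζa n
    · filter_upwards [hwave, ae_eqOn_randomSeries_of_basis hα ha e h hζ hζa hφ (hφ' h)]
        with ω h1 h2
      exact ⟨h2.1, fun z hz => by rw [h1.2 z hz, h2.2 hz]⟩
  · intro Ω' _ P' _ a' ha' b hb
    obtain ⟨h, hbh⟩ := hb.exists_hilbertBasis hα
    refine ⟨ae_seriesConverges_of_eq_inner_atom hα ha' hbh fun z hz =>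
      hasSum_norm_inner_atom_sq hα h hz, ?_⟩
    have hid := identDistrib_zeroMeasure_randomSeries hα ha e ha' h hφ hbh
    refine (IdentDistrib.of_ae_eq hid.aemeasurable_fst ?_).symm.trans hid
    filter_upwards [hwave] with ω hω
    -- the factor relating the two functions does not vanish on the half-plane
    refine congrArg (Measure.count.restrict ·) (Set.ext fun z => and_congr_right fun hz => ?_)
    have hne : ((z.im ^ (α / 2) / waveletConst α : ℝ) : ℂ) ≠ 0 := by
      replace hz : 0 < z.im := hz
      exact_mod_cast (by positivity : z.im ^ (α / 2) / waveletConst α ≠ 0)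
    rw [hω.2 z hz, mul_eq_zero, or_iff_right hne]
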